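/- **Proposition 3.3 (Milnor–Wood inequality).** Let $X$ be a compact connected Riemann surface, $L$ a holomorphic line bundle on $X$, $p,q\ge 1$ integers and $\alpha\in\mathbb{R}$. Let $E=(V,W,\beta,\gamma)$ be an $L$-twisted $\mathrm{U}(p,q)$-Higgs bundle on $X$: $V$ and $W$ are holomorphic vector bundles on $X$ of ranks $p$ and $q$, and $\beta\colon W\to V\otimes L$, $\gamma\colon V\to W\otimes L$ are holomorphic bundle maps. A subobject of $E$ is a pair $(V',W')$ of holomorphic subbundles $V'\subseteq V$, $W'\subseteq W$ with $\beta(W')\subseteq V'\otimes L$ and $\gamma(V')\subseteq W'\otimes L$; it is trivial if it is $(0,0)$ or $(V,W)$. Suppose that $E$ is $\alpha$-semistable, that is, for every non-trivial subobject $(V',W')$, with $p'=\operatorname{rk}V'$ and $q'=\operatorname{rk}W'$, $$\frac{\deg V'+\deg W'}{p'+q'}+\alpha\frac{p'}{p'+q'}\;\le\;\frac{\deg V+\deg W}{p+q}+\alpha\frac{p}{p+q}.$$ Then the Toledo invariant $$\tau(E)=\frac{2pq}{p+q}\left(\frac{\deg V}{p}-\frac{\deg W}{q}\right)$$ satisfies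 $$-\operatorname{rk}(\beta)\deg(L)+\alpha\Bigl(\operatorname{rk}(\beta)-\frac{2pq}{p+q}\Bigr)\;\le\;\tau(E)\;\le\;\operatorname{rk}(\gamma)\deg(L)+\alpha\Bigl(\operatorname{rk}(\gamma)-\frac{2pq}{p+q}\Bigr),$$ where $\operatorname{rk}(\beta)$ and $\operatorname{rk}(\gamma)$ are the generic ranks of $\beta$ and $\gamma$, i.e. the maximal ranks of the maps on fibres. -/

import Mathlib

open scoped Manifold ContDiff TensorProduct Topology
open Module Bundle

noncomputable section

namespace UpqHiggs

/-! ### From complex analytic to real smooth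

A complex manifold modelled on `ℂ` is viewed as a real surface through the same charts, with the
model `𝓘(ℝ, ℂ)`. -/

section RealSmooth

variable {X : Type*} [TopologicalSpace X] [ChartedSpace ℂ X]

theorem contMDiffAt_real {G : Type*} [NormedAddCommGroup G] [NormedSpace ℂ G] {f : X → G} {x : X}
    (hf : ContMDiffAt 𝓘(ℂ) 𝓘(ℂ, G) ω f x) : ContMDiffAt 𝓘(ℝ, ℂ) 𝓘(ℝ, G) ∞ f x := by
  rw [contMDiffAt_iff] at hf ⊢
  exact ⟨hf.1, (hf.2.restrict_scalars ℝ).of_le le_top⟩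

theorem isManifold_real [IsManifold 𝓘(ℂ) ω X] : IsManifold 𝓘(ℝ, ℂ) ∞ X := by
  refine isManifold_of_contDiffOn _ _ _ fun e e' he he' => ?_
  have h : e.symm.trans e' ∈ contDiffGroupoid ω 𝓘(ℂ) := HasGroupoid.compatible he he'
  rw [contDiffGroupoid, mem_groupoid_of_pregroupoid] at h
  exact (ContDiffOn.restrict_scalars ℝ h.1).of_le le_top

variable (X) in
/-- A smooth partition of unity subordinate to the preferred charts of a Riemann surface. -/
structure ChartPartition where
  toFun : SmoothPartitionOfUnity X 𝓘(ℝ, ℂ) X Set.univ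
  subordinate : toFun.IsSubordinate fun c => (chartAt ℂ c).source

instance [IsManifold 𝓘(ℂ) ω X] [CompactSpace X] [T2Space X] : Nonempty (ChartPartition X) := by
  have : IsManifold 𝓘(ℝ, ℂ) ∞ X := isManifold_real
  obtain ⟨f, hf⟩ := SmoothPartitionOfUnity.exists_isSubordinate_chartAt_source 𝓘(ℝ, ℂ) X
  exact ⟨⟨f, hf⟩⟩

end RealSmooth

section Bundles

variable {X : Type*} [TopologicalSpace X] [ChartedSpace ℂ X]
variable (F : Type*) [NormedAddCommGroup F] [NormedSpace ℂ F]
variable (V : X → Type*) [TopologicalSpace (TotalSpace F V)]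
  [∀ x, AddCommGroup (V x)] [∀ x, Module ℂ (V x)] [∀ x, TopologicalSpace (V x)]
  [FiberBundle F V]

/-- A holomorphic subbundle of the holomorphic vector bundle `V`: a family of subspaces of the
fibres which near every point has a frame of holomorphic sections of `V`. (The rank is constant
because the base is connected in all uses.) -/
structure HolomorphicSubbundle where
  rank : ℕ
  fiber : ∀ x, Submodule ℂ (V x)
  exists_frame : ∀ x₀ : X, ∃ s : Fin rank → ∀ x, V x, ∃ U : Set X, IsOpen U ∧ x₀ ∈ U ∧
    (∀ i, ContMDiffOn 𝓘(ℂ) (𝓘(ℂ).prod 𝓘(ℂ, F)) ω (fun x => TotalSpace.mk' F x (s i x)) U) ∧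
    ∀ x ∈ U, LinearIndependent ℂ (fun i => s i x) ∧
      Submodule.span ℂ (Set.range fun i => s i x) = fiber x

variable [VectorBundle ℂ F V]

/-- A smooth Hermitian metric on the holomorphic vector bundle `V`. Smoothness says that the
matrix coefficients in the local trivializations are smooth functions on the real surface. -/
structure HermitianMetric where
  inner : ∀ x, V x →ₗ⋆[ℂ] V x →ₗ[ℂ] ℂ
  conj_symm : ∀ x u v, inner x v u = starRingEnd ℂ (inner x u v)
  pos : ∀ x v, v ≠ 0 → 0 < (inner x v v).re
  smooth : ∀ (x₀ : X) (u v : F), ContMDiffAt 𝓘(ℝ, ℂ) 𝓘(ℝ, ℂ) ∞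
    (fun x => inner x ((trivializationAt F V x₀).symmL ℂ x u)
      ((trivializationAt F V x₀).symmL ℂ x v)) x₀

variable {F V}

instance HermitianMetric.nonempty [FiniteDimensional ℂ F] [IsManifold 𝓘(ℂ) ω X] [CompactSpace X]
    [T2Space X] [ContMDiffVectorBundle ω F V 𝓘(ℂ)] : Nonempty (HermitianMetric F V) := by
  classical
  have : IsManifold 𝓘(ℝ, ℂ) ∞ X := isManifold_real
  obtain ⟨t, ht⟩ := isCompact_univ.elim_finite_subcover
    (fun c : X => (trivializationAt F V c).baseSet)
    (fun c => (trivializationAt F V c).open_baseSet)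
    (fun c _ => Set.mem_iUnion.2 ⟨c, FiberBundle.mem_baseSet_trivializationAt' c⟩)
  obtain ⟨ρ, hρ⟩ := SmoothPartitionOfUnity.exists_isSubordinate 𝓘(ℝ, ℂ) isClosed_univ
    (fun c : t => (trivializationAt F V (c : X)).baseSet)
    (fun c => (trivializationAt F V (c : X)).open_baseSet)
    (fun x hx => by
      obtain ⟨c, hc, hxc⟩ := Set.mem_iUnion₂.1 (ht hx)
      exact Set.mem_iUnion.2 ⟨⟨c, hc⟩, hxc⟩)
  let b := finBasis ℂ F
  let A : t → Fin (finrank ℂ F) → ∀ x, V x →ₗ[ℂ] ℂ := fun c i x =>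
    b.coord i ∘ₗ ((trivializationAt F V (c : X)).continuousLinearMapAt ℂ x).toLinearMap
  have hAdef : ∀ c i x v, A c i x v =
      b.repr ((trivializationAt F V (c : X)).continuousLinearMapAt ℂ x v) i := fun _ _ _ _ => rfl
  refine ⟨⟨fun x => LinearMap.mk₂'ₛₗ (starRingEnd ℂ) (RingHom.id ℂ)
    (fun u v => ∑ c : t, (ρ c x : ℂ) * ∑ i, starRingEnd ℂ (A c i x u) * A c i x v)
    ?_ ?_ ?_ ?_, ?_, ?_, ?_⟩⟩
  · intro u u' v
    simp [-Finset.univ_eq_attach, add_mul, mul_add, Finset.sum_add_distrib]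
  · intro a u v
    simp only [map_smul, smul_eq_mul, map_mul, Finset.mul_sum]
    exact Finset.sum_congr rfl fun _ _ => Finset.sum_congr rfl fun _ _ => by ring
  · intro u v v'
    simp [-Finset.univ_eq_attach, mul_add, Finset.sum_add_distrib]
  · intro a u v
    simp only [map_smul, smul_eq_mul, Finset.mul_sum, RingHom.id_apply]
    exact Finset.sum_congr rfl fun _ _ => Finset.sum_congr rfl fun _ _ => by ring
  · intro x u v
    simp [-Finset.univ_eq_attach, mul_comm]
  · intro x v hv
    have hterm : ∀ c, ((ρ c x : ℂ) * ∑ i, starRingEnd ℂ (A c i x v) * A c i x v).re =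
        ρ c x * ∑ i, Complex.normSq (A c i x v) := fun c => by
      simp [← Complex.normSq_eq_conj_mul_self, ← Complex.ofReal_sum]
    simp only [LinearMap.mk₂'ₛₗ_apply, Complex.re_sum, hterm]
    have hnn : ∀ c i, 0 ≤ Complex.normSq (A c i x v) := fun _ _ => Complex.normSq_nonneg _
    have hsum := ρ.sum_eq_one (Set.mem_univ x)
    obtain ⟨c, hc⟩ : ∃ c, ρ c x ≠ 0 := by
      by_contra! h
      simp [h] at hsum
    refine Finset.sum_pos' (fun c _ => mul_nonneg (ρ.nonneg c x)
      (Finset.sum_nonneg fun i _ => hnn c i)) ⟨c, Finset.mem_univ c, ?_⟩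
    refine mul_pos (lt_of_le_of_ne (ρ.nonneg c x) hc.symm) ?_
    have hx : x ∈ (trivializationAt F V (c : X)).baseSet :=
      hρ c (subset_tsupport _ hc)
    obtain ⟨i, hi⟩ : ∃ i, A c i x v ≠ 0 := by
      by_contra! h
      apply hv
      have h0 : (trivializationAt F V (c : X)).continuousLinearMapAt ℂ x v = 0 :=
        b.repr.injective (by ext i; simpa [hAdef] using h i)
      rw [← (trivializationAt F V (c : X)).symmL_continuousLinearMapAt (R := ℂ) hx v, h0, map_zero]
    exact Finset.sum_pos' (fun i _ => hnn c i) ⟨i, Finset.mem_univ i, Complex.normSq_pos.2 hi⟩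
  · intro x₀ u v
    have hmul : ∀ {f g : X → ℂ}, ContMDiffAt 𝓘(ℝ, ℂ) 𝓘(ℝ, ℂ) ∞ f x₀ →
        ContMDiffAt 𝓘(ℝ, ℂ) 𝓘(ℝ, ℂ) ∞ g x₀ →
        ContMDiffAt 𝓘(ℝ, ℂ) 𝓘(ℝ, ℂ) ∞ (fun x => f x * g x) x₀ := fun {f g} hf hg =>
      ((contDiff_mul (𝕜 := ℝ) (𝔸 := ℂ)).contMDiff (x := (f x₀, g x₀))).comp x₀ (hf.prodMk_space hg)
    simp only [LinearMap.mk₂'ₛₗ_apply]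
    refine ContMDiffAt.sum fun c _ => ?_
    by_cases hc : x₀ ∈ tsupport (ρ c)
    · have h1 : ContMDiffAt 𝓘(ℝ, ℂ) 𝓘(ℝ, ℂ) ∞ (fun x => (ρ c x : ℂ)) x₀ :=
        (Complex.ofRealCLM.contDiff.contMDiff).contMDiffAt.comp x₀ ((ρ c).contMDiff.contMDiffAt)
      have hx := FiberBundle.mem_baseSet_trivializationAt' (F := F) (E := V) x₀
      have hx' := hρ c hc
      have h2 : ∀ i w, ContMDiffAt 𝓘(ℝ, ℂ) 𝓘(ℝ, ℂ) ∞
          (fun x => A c i x ((trivializationAt F V x₀).symmL ℂ x w)) x₀ := fun i w => by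
        apply contMDiffAt_real
        have h3 := contMDiffAt_coordChangeL (n := ω) (IB := 𝓘(ℂ))
          (e := trivializationAt F V x₀) (e' := trivializationAt F V (c : X)) hx hx'
        have h4 : ContMDiffAt 𝓘(ℂ) 𝓘(ℂ) ω (fun x : X =>
            (LinearMap.toContinuousLinearMap (b.coord i)) (((trivializationAt F V x₀).coordChangeL ℂ
              (trivializationAt F V (c : X)) x : F →L[ℂ] F) w)) x₀ :=
          (LinearMap.toContinuousLinearMap (b.coord i)).contDiff.contMDiff.contMDiffAt.comp x₀
            (h3.clm_apply contMDiffAt_const)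
        refine h4.congr_of_eventuallyEq ?_
        filter_upwards [(trivializationAt F V x₀).open_baseSet.mem_nhds hx,
          (trivializationAt F V (c : X)).open_baseSet.mem_nhds hx'] with x hx1 hx2
        rw [hAdef]
        simp [Trivialization.coordChangeL_apply _ _ ⟨hx1, hx2⟩,
          Trivialization.coe_linearMapAt_of_mem _ hx2]
        rw [Trivialization.symmL_apply _ hx1]
      refine hmul h1 (ContMDiffAt.sum fun i _ => ?_)
      exact hmul ((Complex.conjCLE.contDiff.contMDiff).contMDiffAt.comp x₀ (h2 i u)) (h2 i v)
    · refine (contMDiffAt_const (c := (0 : ℂ))).congr_of_eventuallyEq ?_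
      filter_upwards [(isClosed_tsupport (ρ c)).isOpen_compl.mem_nhds hc] with x hx
      simp [image_eq_zero_of_notMem_tsupport hx]

/-- The whole bundle, as a subbundle of itself. -/
def HolomorphicSubbundle.top [FiniteDimensional ℂ F] [ContMDiffVectorBundle ω F V 𝓘(ℂ)] :
    HolomorphicSubbundle F V where
  rank := finrank ℂ F
  fiber _ := ⊤
  exists_frame x₀ := by
    let e := trivializationAt F V x₀
    refine ⟨fun i => e.localFrame (finBasis ℂ F) i, e.baseSet, e.open_baseSet,
      FiberBundle.mem_baseSet_trivializationAt' x₀, fun i => ?_, fun x hx => ?_⟩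
    · exact e.contMDiffOn_localFrame_baseSet ω (finBasis ℂ F) i
    · have h := e.isLocalFrameOn_localFrame_baseSet 𝓘(ℂ) ω (finBasis ℂ F)
      exact ⟨h.linearIndependent hx, top_le_iff.1 (h.generating hx)⟩

namespace HolomorphicSubbundle

variable (S : HolomorphicSubbundle F V)

/-- A frame of sections of `S`, holomorphic near `x₀`. -/
def frame (x₀ : X) : Fin S.rank → ∀ x, V x := (S.exists_frame x₀).choose

/-- `log det (H(sᵢ, sⱼ))` at the point `x`, for the frame `s` of `S` chosen near `x₀`. -/
def logGram (H : HermitianMetric F V) (x₀ x : X) : ℝ :=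
  Real.log (Matrix.of fun i j => H.inner x (S.frame x₀ i x) (S.frame x₀ j x)).det.re

/-- The first Chern form `(i/2π) tr F_H = (i/2π) ∂̄∂ log det H` of the metric induced by `H` on `S`,
in the chart at `c` with coordinate `z = x + iy`: it is `-(1/4π) Δ(log det H) dx ∧ dy`, and this is
its coefficient. Another frame changes `log det H` by a harmonic function, so the coefficient does
not depend on the frame. -/
def chernDensity (H : HermitianMetric F V) (c : X) (z : ℂ) : ℝ :=
  -(1 / (4 * Real.pi)) * Laplacian.laplacian
    (fun w : ℂ => S.logGram H ((chartAt ℂ c).symm z) ((chartAt ℂ c).symm w)) z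

/-- The integral over `X` of the first Chern form of `S`, computed with a partition of unity. -/
def chernIntegral (H : HermitianMetric F V) (ρ : ChartPartition X) : ℝ :=
  ∑ᶠ c : X, ∫ z in (chartAt ℂ c).target,
    ρ.toFun c ((chartAt ℂ c).symm z) * S.chernDensity H c z

variable [FiniteDimensional ℂ F] [IsManifold 𝓘(ℂ) ω X] [CompactSpace X] [T2Space X]
  [ContMDiffVectorBundle ω F V 𝓘(ℂ)]

/-- The degree of a holomorphic (sub)bundle on a compact Riemann surface: the integral of the first
Chern form of a Hermitian metric. It does not depend on the metric nor on the partition of unity. -/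
def degree : ℝ := S.chernIntegral (Classical.arbitrary _) (Classical.arbitrary _)

end HolomorphicSubbundle

variable (F V) in
/-- The degree of a holomorphic vector bundle on a compact Riemann surface. -/
def degree [FiniteDimensional ℂ F] [IsManifold 𝓘(ℂ) ω X] [CompactSpace X] [T2Space X]
    [ContMDiffVectorBundle ω F V 𝓘(ℂ)] : ℝ :=
  (HolomorphicSubbundle.top : HolomorphicSubbundle F V).degree

end Bundles

section Higgs

variable {X : Type*} [TopologicalSpace X] [ChartedSpace ℂ X]
variable (FV : Type*) [NormedAddCommGroup FV] [NormedSpace ℂ FV]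
variable (V : X → Type*) [TopologicalSpace (TotalSpace FV V)]
  [∀ x, AddCommGroup (V x)] [∀ x, Module ℂ (V x)] [∀ x, TopologicalSpace (V x)]
  [FiberBundle FV V] [VectorBundle ℂ FV V]
variable (FW : Type*) [NormedAddCommGroup FW] [NormedSpace ℂ FW]
variable (W : X → Type*) [TopologicalSpace (TotalSpace FW W)]
  [∀ x, AddCommGroup (W x)] [∀ x, Module ℂ (W x)] [∀ x, TopologicalSpace (W x)]
  [FiberBundle FW W] [VectorBundle ℂ FW W]
variable (FL : Type*) [NormedAddCommGroup FL] [NormedSpace ℂ FL]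
variable (L : X → Type*) [TopologicalSpace (TotalSpace FL L)]
  [∀ x, AddCommGroup (L x)] [∀ x, Module ℂ (L x)] [∀ x, TopologicalSpace (L x)]
  [FiberBundle FL L] [VectorBundle ℂ FL L]

/-- A holomorphic bundle map `W ⟶ V ⊗ L`: a family of linear maps between the fibres whose matrix
coefficients in local holomorphic trivializations of `W`, `V` and `L` are holomorphic. (The factor
`V ⊗ L` is read off by contracting the `L`-coordinate with the linear forms on the fibre of `L`.) -/
structure TwistedHom where
  toFun : ∀ x, W x →ₗ[ℂ] V x ⊗[ℂ] L x
  holomorphic : ∀ (x₀ : X) (w : FW) (l : FL →ₗ[ℂ] ℂ), ContMDiffAt 𝓘(ℂ) 𝓘(ℂ, FV) ω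
    (fun x => TensorProduct.rid ℂ FV
      (TensorProduct.map ((trivializationAt FV V x₀).linearMapAt ℂ x)
        (l ∘ₗ (trivializationAt FL L x₀).linearMapAt ℂ x)
        (toFun x ((trivializationAt FW W x₀).symmL ℂ x w)))) x₀

variable {FV V FW W FL L} in
/-- The rank of a bundle map is its generic rank, that is, the maximal rank on the fibres. -/
def TwistedHom.rank (φ : TwistedHom FV V FW W FL L) : ℕ :=
  ⨆ x, finrank ℂ (LinearMap.range (φ.toFun x))

/-- An `L`-twisted `U(p,q)`-Higgs bundle `(V, W, β, γ)`, where `p` and `q` are the ranks of `V`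
and `W`. -/
structure HiggsBundle where
  β : TwistedHom FV V FW W FL L
  γ : TwistedHom FW W FV V FL L

namespace HiggsBundle

variable {FV V FW W FL L}
variable (E : HiggsBundle FV V FW W FL L)

/-- A subobject `(V', W')`: subbundles with `β(W') ⊆ V' ⊗ L` and `γ(V') ⊆ W' ⊗ L`. -/
structure Subobject where
  V' : HolomorphicSubbundle FV V
  W' : HolomorphicSubbundle FW W
  β_mem : ∀ x, ∀ w ∈ W'.fiber x,
    E.β.toFun x w ∈ LinearMap.range ((V'.fiber x).subtype.rTensor (L x))
  γ_mem : ∀ x, ∀ v ∈ V'.fiber x,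
    E.γ.toFun x v ∈ LinearMap.range ((W'.fiber x).subtype.rTensor (L x))

variable {E} in
/-- The subobjects `(0, 0)` and `(V, W)` are the trivial ones. -/
def Subobject.IsTrivial (S : E.Subobject) : Prop :=
  (∀ x, S.V'.fiber x = ⊥ ∧ S.W'.fiber x = ⊥) ∨ (∀ x, S.V'.fiber x = ⊤ ∧ S.W'.fiber x = ⊤)

variable [IsManifold 𝓘(ℂ) ω X] [CompactSpace X] [T2Space X]
  [FiniteDimensional ℂ FV] [ContMDiffVectorBundle ω FV V 𝓘(ℂ)]
  [FiniteDimensional ℂ FW] [ContMDiffVectorBundle ω FW W 𝓘(ℂ)]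

variable {E} in
/-- The `α`-slope `μ(V' ⊕ W') + α p' / (p' + q')` of a subobject. -/
def Subobject.slope (S : E.Subobject) (α : ℝ) : ℝ :=
  (S.V'.degree + S.W'.degree) / (S.V'.rank + S.W'.rank) +
    α * (S.V'.rank / (S.V'.rank + S.W'.rank))

/-- The `α`-slope `μ(V ⊕ W) + α p / (p + q)`. -/
def slope (_E : HiggsBundle FV V FW W FL L) (α : ℝ) : ℝ :=
  (degree FV V + degree FW W) / (finrank ℂ FV + finrank ℂ FW) +
    α * (finrank ℂ FV / (finrank ℂ FV + finrank ℂ FW))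

/-- `α`-semistability. -/
def IsSemistable (α : ℝ) : Prop :=
  ∀ S : E.Subobject, ¬ S.IsTrivial → S.slope α ≤ E.slope α

/-- The Toledo invariant `(2pq / (p + q)) (μ(V) - μ(W))`. -/
def toledo (_E : HiggsBundle FV V FW W FL L) : ℝ :=
  2 * finrank ℂ FV * finrank ℂ FW / (finrank ℂ FV + finrank ℂ FW) *
    (degree FV V / finrank ℂ FV - degree FW W / finrank ℂ FW)

end HiggsBundle

end Higgs

end UpqHiggs

end

set_option linter.unusedSectionVars false

noncomputable section

namespace UpqHiggs

/-! ### The Laplacian on the complex plane -/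

section Laplacian

/-! Let `N ⊆ V` and `I ⊆ W` be the saturations of the kernel and the image of `γ`, and let `r = rk
γ`, so that `rk I = r` and `rk N = p - r`. Both `(N, 0)` and `(V, I)` are subobjects. Adding their
semistability inequalities gives `deg V + deg N + deg I + α (2p - r) ≤ 2p μ`, where `μ` is the
`α`-slope of `E`. Together with `deg V ≤ deg N + deg I + r deg L` this is the upper bound
(`toledo_le`). The lower bound (`le_toledo`) comes in the same way from `β` and the subobjects `(0,
N)` and `(I, W)`.

The degree inequality (`TwistedHom.degree_le`) says that the determinant of `V / N → I ⊗ L`, a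
nonzero holomorphic section of a line bundle, forces that line bundle to have degree at least `0`.
As degrees are curvature integrals, the argument is analytic. The squared norm `σ` of the
determinant is a `C²` function with finitely many zeros, and away from them `Δ log σ` is `-4π` times
the Chern density of the line bundle, because `log ‖g‖` is harmonic for holomorphic `g ≠ 0`. By
Stokes `∫ Δ log (σ + ε) = 0`, while `Δ log (σ + ε) ≥ σ / (σ + ε) Δ log σ`; letting `ε → 0` gives `∫
Δ log σ ≤ 0` (`finsum_integral_nonpos`). No count of zeros is needed.

The subbundles `N` and `I` (`exists_kernel_image`) are built locally: Cramer's rule gives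
holomorphic frames off isolated points, and dividing relations by the local coordinate extends them
over those points (`exists_saturation`). The fibres are described by germs of sections,
independently of the frames, so the local pieces glue (`exists_subbundle`). -/

theorem laplacian_eq_fderiv_fderiv (f : ℂ → ℝ) (z : ℂ) :
    Laplacian.laplacian f z = fderiv ℝ (fderiv ℝ f) z 1 1 +
      fderiv ℝ (fderiv ℝ f) z Complex.I Complex.I := by
  rw [InnerProductSpace.laplacian_eq_iteratedFDeriv_complexPlane]
  simp [iteratedFDeriv_two_apply]

theorem continuousAt_laplacian {f : ℂ → ℝ} {z : ℂ} (hf : ContDiffAt ℝ 2 f z) :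
    ContinuousAt (Laplacian.laplacian f) z := by
  rw [InnerProductSpace.laplacian_eq_iteratedFDeriv_complexPlane]
  have h := hf.continuousAt_iteratedFDeriv (k := 2) le_rfl
  have h1 : ∀ v : Fin 2 → ℂ, ContinuousAt (fun w => iteratedFDeriv ℝ 2 f w v) z := fun v =>
    (ContinuousMultilinearMap.apply ℝ (fun _ : Fin 2 => ℂ) ℝ v).continuous.continuousAt.comp h
  exact (h1 _).add (h1 _)

/-- The second-order chain rule serves twice: with a holomorphic inner map for conformal covariance,
and with the outer function `t ↦ log (exp t + ε)`. -/
theorem fderiv_fderiv_comp {E F : Type*} [NormedAddCommGroup E] [NormedSpace ℝ E]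
    [NormedAddCommGroup F] [NormedSpace ℝ F] {G : Type*} [NormedAddCommGroup G] [NormedSpace ℝ G]
    {f : F → G} {h : E → F} {z : E}
    (hf : ContDiffAt ℝ 2 f (h z)) (hh : ContDiffAt ℝ 2 h z) (v w : E) :
    fderiv ℝ (fderiv ℝ (f ∘ h)) z v w =
      fderiv ℝ (fderiv ℝ f) (h z) (fderiv ℝ h z v) (fderiv ℝ h z w) +
        fderiv ℝ f (h z) (fderiv ℝ (fderiv ℝ h) z v w) := by
  have hev : fderiv ℝ (f ∘ h) =ᶠ[𝓝 z] fun y => (fderiv ℝ f (h y)).comp (fderiv ℝ h y) := by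
    filter_upwards [hh.eventually (by simp), hh.continuousAt.eventually (hf.eventually (by simp))]
      with y hy hy'
    exact fderiv_comp y (hy'.differentiableAt (by simp)) (hy.differentiableAt (by simp))
  rw [hev.fderiv_eq]
  have h1 : DifferentiableAt ℝ (fderiv ℝ f) (h z) :=
    (hf.fderiv_right (m := 1) (by norm_num)).differentiableAt (by simp)
  have h2 : DifferentiableAt ℝ (fderiv ℝ h) z :=
    (hh.fderiv_right (m := 1) (by norm_num)).differentiableAt (by simp)
  have h3 := (h1.hasFDerivAt.comp z (hh.differentiableAt (by simp)).hasFDerivAt).clm_comp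
    h2.hasFDerivAt
  have h4 := h3.fderiv
  simp only [Function.comp_def] at h4
  rw [h4]
  simp [add_comm]

/-- The Laplacian is conformally covariant. -/
theorem laplacian_comp_analytic {f : ℂ → ℝ} {h : ℂ → ℂ} {z : ℂ}
    (hf : ContDiffAt ℝ 2 f (h z)) (hh : AnalyticAt ℂ h z) :
    Laplacian.laplacian (f ∘ h) z = ‖deriv h z‖ ^ 2 * Laplacian.laplacian f (h z) := by
  have hc : ContDiffAt ℂ 2 h z := hh.contDiffAt
  have hr : ContDiffAt ℝ 2 h z := hc.restrict_scalars ℝ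
  rw [laplacian_eq_fderiv_fderiv, laplacian_eq_fderiv_fderiv, fderiv_fderiv_comp hf hr,
    fderiv_fderiv_comp hf hr]
  have hd : ∀ y, AnalyticAt ℂ h y → ∀ v, fderiv ℝ h y v = v * deriv h y := fun y hy v => by
    rw [(hy.differentiableAt.hasDerivAt.hasFDerivAt.restrictScalars ℝ).fderiv]
    simp
  -- The second derivative of a holomorphic map is complex bilinear. Its values at `(1, 1)` and `(I,
  -- I)` are opposite, so this term drops out of the Laplacian.
  have hdd : ∀ v w, fderiv ℝ (fderiv ℝ h) z v w = v * w * deriv (deriv h) z := fun v w => by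
    have h2 : DifferentiableAt ℝ (fderiv ℝ h) z :=
      (hr.fderiv_right (m := 1) (by norm_num)).differentiableAt (by simp)
    have h3 : fderiv ℝ (fderiv ℝ h) z v w = fderiv ℝ (fun y => fderiv ℝ h y w) z v := by
      rw [fderiv_clm_apply h2 (differentiableAt_const w)]
      simp
    have h4 : (fun y => fderiv ℝ h y w) =ᶠ[𝓝 z] fun y => w * deriv h y := by
      filter_upwards [hh.eventually_analyticAt] with y hy
      exact hd y hy w
    rw [h3, h4.fderiv_eq, ((hh.deriv.differentiableAt.hasDerivAt.const_mul
      w).hasFDerivAt.restrictScalars ℝ).fderiv]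
    simp
    ring
  rw [hd z hh, hd z hh, hdd, hdd]
  set a := deriv h z
  -- In the real basis `1, I` the mixed terms cancel by symmetry of the second derivative, and the
  -- diagonal terms each acquire the factor `|a|²`.
  have e1 : Complex.I * a = -(a.im : ℝ) • (1 : ℂ) + (a.re : ℝ) • Complex.I := by
    apply Complex.ext <;> simp
  have e2 : (1 : ℂ) * a = (a.re : ℝ) • (1 : ℂ) + (a.im : ℝ) • Complex.I := by
    apply Complex.ext <;> simp
  have hsymm : fderiv ℝ (fderiv ℝ f) (h z) 1 Complex.I = fderiv ℝ (fderiv ℝ f) (h z) Complex.I 1 :=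
    (hf.isSymmSndFDerivAt (by simp)) 1 Complex.I
  rw [e1, e2]
  simp only [map_add, map_smul, add_apply, smul_apply,
    smul_eq_mul, hsymm, neg_smul, map_neg, neg_apply, one_mul, mul_one,
    Complex.I_mul_I, neg_mul]
  rw [← Complex.normSq_eq_norm_sq, Complex.normSq_apply]
  ring

theorem integral_laplacian_eq_zero {f : ℂ → ℝ} (hf : ContDiff ℝ 2 f) (hc : HasCompactSupport f) :
    ∫ z, Laplacian.laplacian f z = 0 := by
  have h1 : ContDiff ℝ 1 (fderiv ℝ f) := hf.fderiv_right (by norm_num)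
  have key : ∀ v : ℂ, MeasureTheory.Integrable (fun z => fderiv ℝ (fderiv ℝ f) z v v) ∧
      ∫ z, fderiv ℝ (fderiv ℝ f) z v v = 0 := fun v => by
    have hg : ContDiff ℝ 1 (fun z => fderiv ℝ f z v) := h1.clm_apply contDiff_const
    have hgc : HasCompactSupport (fun z => fderiv ℝ f z v) := hc.fderiv_apply ℝ v
    have he : ∀ z, fderiv ℝ (fderiv ℝ f) z v v = fderiv ℝ (fun z => fderiv ℝ f z v) z v := by
      intro z
      rw [fderiv_clm_apply ((h1.differentiable (by simp)) z) (differentiableAt_const v)]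
      simp
    simp only [he]
    have hint : MeasureTheory.Integrable (fun z => fderiv ℝ (fun z => fderiv ℝ f z v) z v) :=
      ((hg.continuous_fderiv_apply (by simp)).comp (continuous_id.prodMk
        continuous_const)).integrable_of_hasCompactSupport (hgc.fderiv_apply ℝ v)
    refine ⟨hint, ?_⟩
    -- Integration by parts against the constant function `1`.
    have := integral_mul_fderiv_eq_neg_fderiv_mul_of_integrable (μ := MeasureTheory.volume)
      (f := fun _ : ℂ => (1 : ℝ)) (g := fun z => fderiv ℝ f z v) (v := v)
      (by simp) (by simpa using hint)
      (by simpa using hg.continuous.integrable_of_hasCompactSupport hgc)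
      (fun x _ => differentiableAt_const _) (fun x _ => hg.differentiable (by simp) x)
    simpa using this
  simp only [laplacian_eq_fderiv_fderiv]
  rw [MeasureTheory.integral_add (key 1).1 (key Complex.I).1, (key 1).2, (key Complex.I).2, add_zero]

/-- If `s = exp u`, then `Δ log (s + ε) ≥ s / (s + ε) Δ u`. -/
theorem laplacian_log_add_ge {s : ℂ → ℝ} {z : ℂ} (hs : ContDiffAt ℝ 2 s z) (hz : 0 < s z)
    {ε : ℝ} (hε : 0 < ε) :
    s z / (s z + ε) * Laplacian.laplacian (fun w => Real.log (s w)) z ≤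
      Laplacian.laplacian (fun w => Real.log (s w + ε)) z := by
  have hu : ContDiffAt ℝ 2 (fun w => Real.log (s w)) z := hs.log hz.ne'
  -- With `χ t = log (exp t + ε)` and `u = log s`, one has `log (s + ε) = χ ∘ u` and `Δ (χ ∘ u) = χ'
  -- Δu + χ'' |∇u|²`. Here `χ' = s / (s + ε)`, and convexity `χ'' ≥ 0` gives the inequality.
  have hd1 : ∀ t, HasDerivAt (fun t => Real.log (Real.exp t + ε))
      (Real.exp t / (Real.exp t + ε)) t := fun t =>
    ((Real.hasDerivAt_exp t).add_const ε).log (by positivity)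
  have hd2 : ∀ t, HasDerivAt (fun t => Real.exp t / (Real.exp t + ε))
      (ε * Real.exp t / (Real.exp t + ε) ^ 2) t := fun t => by
    have := (Real.hasDerivAt_exp t).fun_div ((Real.hasDerivAt_exp t).add_const ε)
      (by positivity)
    refine this.congr_deriv ?_
    ring
  have hχ : ContDiff ℝ 2 (fun t => Real.log (Real.exp t + ε)) :=
    (Real.contDiff_exp.add contDiff_const).log fun t => by positivity
  have he : (fun w => Real.log (s w + ε)) =ᶠ[𝓝 z]
      (fun t => Real.log (Real.exp t + ε)) ∘ fun w => Real.log (s w) := by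
    filter_upwards [hs.continuousAt.eventually (lt_mem_nhds hz)] with w hw
    simp [Real.exp_log hw]
  have hf1 : ∀ t v, fderiv ℝ (fun t => Real.log (Real.exp t + ε)) t v =
      v * (Real.exp t / (Real.exp t + ε)) := fun t v => by
    rw [(hd1 t).hasFDerivAt.fderiv]; simp
  have hf2 : ∀ t v w, fderiv ℝ (fderiv ℝ (fun t => Real.log (Real.exp t + ε))) t v w =
      v * w * (ε * Real.exp t / (Real.exp t + ε) ^ 2) := fun t v w => by
    have h2 : DifferentiableAt ℝ (fderiv ℝ (fun t => Real.log (Real.exp t + ε))) t :=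
      ((hχ.fderiv_right (m := 1) (by norm_num)).differentiable (by simp)) t
    have h3 : fderiv ℝ (fderiv ℝ (fun t => Real.log (Real.exp t + ε))) t v w =
        fderiv ℝ (fun y => fderiv ℝ (fun t => Real.log (Real.exp t + ε)) y w) t v := by
      rw [fderiv_clm_apply h2 (differentiableAt_const w)]
      simp
    rw [h3]
    simp only [hf1]
    rw [((hd2 t).const_mul w).hasFDerivAt.fderiv]
    simp
    ring
  rw [InnerProductSpace.laplacian_congr_nhds he |>.eq_of_nhds, laplacian_eq_fderiv_fderiv,
    laplacian_eq_fderiv_fderiv, fderiv_fderiv_comp hχ.contDiffAt hu,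
    fderiv_fderiv_comp hχ.contDiffAt hu]
  simp only [hf1, hf2, Real.exp_log hz]
  have hp : 0 ≤ ε * s z / (s z + ε) ^ 2 := by positivity
  nlinarith [mul_nonneg (mul_self_nonneg (fderiv ℝ (fun w => Real.log (s w)) z 1)) hp,
    mul_nonneg (mul_self_nonneg (fderiv ℝ (fun w => Real.log (s w)) z Complex.I)) hp]

end Laplacian

/-! ### Integration over a Riemann surface with a partition of unity -/

section Stokes

open MeasureTheory

variable {X : Type*} [TopologicalSpace X] [ChartedSpace ℂ X]

/-- Holomorphic functions near a point of a Riemann surface. -/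
abbrev HolAt {G : Type*} [NormedAddCommGroup G] [NormedSpace ℂ G] (f : X → G) (x : X) : Prop :=
  ContMDiffAt 𝓘(ℂ) 𝓘(ℂ, G) ω f x

/-- Twice continuously real differentiable functions near a point of a Riemann surface. -/
abbrev C2At (f : X → ℝ) (x : X) : Prop :=
  ContMDiffAt 𝓘(ℝ, ℂ) 𝓘(ℝ, ℝ) 2 f x

theorem ChartPartition.finite (ρ : ChartPartition X) [CompactSpace X] :
    {c | (Function.support (ρ.toFun c)).Nonempty}.Finite :=
  ρ.toFun.locallyFinite.finite_nonempty_of_compact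

variable [IsManifold 𝓘(ℂ) ω X]

theorem C2At.comp_chart_symm {f : X → ℝ} {c : X} {z : ℂ} (hz : z ∈ (chartAt ℂ c).target)
    (hf : C2At f ((chartAt ℂ c).symm z)) :
    ContDiffAt ℝ 2 (fun w => f ((chartAt ℂ c).symm w)) z := by
  have : IsManifold 𝓘(ℝ, ℂ) ∞ X := isManifold_real
  have : IsManifold 𝓘(ℝ, ℂ) 2 X := IsManifold.of_le (n := ∞) (WithTop.coe_le_coe.2 le_top)
  rw [← contMDiffAt_iff_contDiffAt]
  exact hf.comp z ((contMDiffOn_chart_symm (n := 2)).contMDiffAt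
    ((chartAt ℂ c).open_target.mem_nhds hz))

theorem HolAt.comp_chart_symm {G : Type*} [NormedAddCommGroup G] [NormedSpace ℂ G]
    [CompleteSpace G] {f : X → G} {c : X} {z : ℂ} (hz : z ∈ (chartAt ℂ c).target)
    (hf : HolAt f ((chartAt ℂ c).symm z)) :
    AnalyticAt ℂ (fun w => f ((chartAt ℂ c).symm w)) z := by
  refine ContDiffAt.analyticAt ?_
  rw [← contMDiffAt_iff_contDiffAt]
  exact hf.comp z ((contMDiffOn_chart_symm (n := ω)).contMDiffAt
    ((chartAt ℂ c).open_target.mem_nhds hz))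

theorem analyticAt_transition {c d : X} {z : ℂ} (hz : z ∈ (chartAt ℂ d).target)
    (hz' : (chartAt ℂ d).symm z ∈ (chartAt ℂ c).source) :
    AnalyticAt ℂ (fun w => chartAt ℂ c ((chartAt ℂ d).symm w)) z :=
  HolAt.comp_chart_symm hz ((contMDiffOn_chart (n := ω)).contMDiffAt
    ((chartAt ℂ c).open_source.mem_nhds hz'))

theorem C2At.log {f : X → ℝ} {x : X} (hf : C2At f x) (hx : f x ≠ 0) :
    C2At (fun y => Real.log (f y)) x :=
  ContDiffAt.comp_contMDiffAt (g := Real.log) (Real.contDiffAt_log.2 hx) hf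

theorem continuousOn_laplacian_chart {f : X → ℝ} (hf : ∀ x, C2At f x) (c : X) :
    ContinuousOn (Laplacian.laplacian fun w => f ((chartAt ℂ c).symm w)) (chartAt ℂ c).target :=
  fun _ hz => (continuousAt_laplacian (C2At.comp_chart_symm hz (hf _))).continuousWithinAt

variable [CompactSpace X]

theorem ChartPartition.isCompact_image (ρ : ChartPartition X) (c : X) :
    IsCompact (chartAt ℂ c '' tsupport (ρ.toFun c)) ∧
      chartAt ℂ c '' tsupport (ρ.toFun c) ⊆ (chartAt ℂ c).target := by
  refine ⟨(isClosed_tsupport _).isCompact.image_of_continuousOn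
    ((chartAt ℂ c).continuousOn.mono (ρ.subordinate c)), ?_⟩
  rintro _ ⟨x, hx, rfl⟩
  exact (chartAt ℂ c).map_source (ρ.subordinate c hx)

theorem ChartPartition.notMem_tsupport {ρ : ChartPartition X} {c : X} {z : ℂ}
    (hz : z ∈ (chartAt ℂ c).target) (hz' : z ∉ chartAt ℂ c '' tsupport (ρ.toFun c)) :
    (chartAt ℂ c).symm z ∉ tsupport (ρ.toFun c) := fun h =>
  hz' ⟨_, h, (chartAt ℂ c).right_inv hz⟩

/-- Chart targets may be unbounded and `F` need not be bounded near their boundary; integrability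
comes from the compact image of the support of `ρ c`. -/
theorem ChartPartition.integrableOn (ρ : ChartPartition X) (c : X) {F : ℂ → ℝ}
    (hF : ContinuousOn F (chartAt ℂ c).target)
    (h0 : ∀ z ∈ (chartAt ℂ c).target, (chartAt ℂ c).symm z ∉ tsupport (ρ.toFun c) → F z = 0) :
    IntegrableOn F (chartAt ℂ c).target := by
  obtain ⟨hK, hKt⟩ := ρ.isCompact_image c
  refine ((hF.mono hKt).integrableOn_compact hK).of_forall_sdiff_eq_zero
    (chartAt ℂ c).open_target.measurableSet fun z hz => h0 z hz.1 (notMem_tsupport hz.1 hz.2)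

theorem ChartPartition.continuousOn (ρ : ChartPartition X) (c d : X) :
    ContinuousOn (fun z => ρ.toFun c ((chartAt ℂ d).symm z)) (chartAt ℂ d).target :=
  (ρ.toFun c).contMDiff.continuous.comp_continuousOn (chartAt ℂ d).continuousOn_symm

theorem ChartPartition.integrableOn_mul (ρ : ChartPartition X) (c : X) {F : ℂ → ℝ}
    (hF : ContinuousOn F (chartAt ℂ c).target) :
    IntegrableOn (fun z => ρ.toFun c ((chartAt ℂ c).symm z) * F z) (chartAt ℂ c).target :=
  ρ.integrableOn c ((ρ.continuousOn c c).mul hF) fun z _ hz => by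
    rw [image_eq_zero_of_notMem_tsupport hz, zero_mul]

theorem ChartPartition.finsum_eq (ρ : ChartPartition X) (G : X → ℝ)
    (hG : ∀ c, (∀ x, ρ.toFun c x = 0) → G c = 0) : ∑ᶠ c, G c = ∑ c ∈ ρ.finite.toFinset, G c := by
  refine finsum_eq_sum_of_support_subset _ fun c hc => ?_
  simp only [Set.Finite.coe_toFinset, Set.mem_ofPred_eq]
  by_contra h
  exact hc (hG c fun x => by_contra fun hx => h ⟨x, hx⟩)

theorem ChartPartition.sum_eq_one (ρ : ChartPartition X) (x : X) :
    ∑ c ∈ ρ.finite.toFinset, ρ.toFun c x = 1 := by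
  rw [← ρ.finsum_eq (fun c => ρ.toFun c x) (fun c h => h x)]
  exact ρ.toFun.sum_eq_one (Set.mem_univ x)

variable [T2Space X]

theorem ChartPartition.c2At (ρ : ChartPartition X) (c : X) (x : X) : C2At (ρ.toFun c) x :=
  ((ρ.toFun c).contMDiff.contMDiffAt).of_le (WithTop.coe_le_coe.2 le_top)

theorem C2At.mul {f g : X → ℝ} {x : X} (hf : C2At f x) (hg : C2At g x) :
    C2At (fun y => f y * g y) x :=
  ((contDiff_mul (𝕜 := ℝ) (𝔸 := ℝ)).contMDiff (x := (f x, g x))).comp x (hf.prodMk_space hg)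

theorem laplacian_eq_zero_of_notMem_tsupport {f g : X → ℝ} {c : X} {z : ℂ}
    (hz : z ∈ (chartAt ℂ c).target) (h : (chartAt ℂ c).symm z ∉ tsupport g) :
    Laplacian.laplacian (fun w => g ((chartAt ℂ c).symm w) * f ((chartAt ℂ c).symm w)) z = 0 := by
  have h1 : (fun w => g ((chartAt ℂ c).symm w) * f ((chartAt ℂ c).symm w)) =ᶠ[𝓝 z] fun _ => 0 := by
    have := ((chartAt ℂ c).continuousAt_symm hz).eventually
      ((isClosed_tsupport g).isOpen_compl.mem_nhds h)
    filter_upwards [this] with w hw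
    rw [image_eq_zero_of_notMem_tsupport hw, zero_mul]
  rw [(InnerProductSpace.laplacian_congr_nhds h1).eq_of_nhds]
  simp

theorem ChartPartition.integral_laplacian_eq_zero (ρ : ChartPartition X) {f : X → ℝ}
    (hf : ∀ x, C2At f x) (d : X) :
    ∫ z in (chartAt ℂ d).target, Laplacian.laplacian (fun w =>
      ρ.toFun d ((chartAt ℂ d).symm w) * f ((chartAt ℂ d).symm w)) z = 0 := by
  obtain ⟨hK, hKt⟩ := ρ.isCompact_image d
  set K := chartAt ℂ d '' tsupport (ρ.toFun d)
  set u : ℂ → ℝ := fun w => ρ.toFun d ((chartAt ℂ d).symm w) * f ((chartAt ℂ d).symm w) with hu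
  -- Extension by zero is `C²` on the whole plane because `u` is supported in the compact set `K`
  -- inside the chart target.
  let g : ℂ → ℝ := Set.indicator (chartAt ℂ d).target u
  have hgu : ∀ z ∈ (chartAt ℂ d).target, g =ᶠ[𝓝 z] u := fun z hz => by
    filter_upwards [(chartAt ℂ d).open_target.mem_nhds hz] with w hw
    exact Set.indicator_of_mem hw u
  have hg0 : ∀ z ∉ K, g z = 0 := fun z hz => by
    by_cases h : z ∈ (chartAt ℂ d).target
    · rw [(hgu z h).eq_of_nhds, hu]
      simp only
      rw [image_eq_zero_of_notMem_tsupport (notMem_tsupport h hz), zero_mul]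
    · exact Set.indicator_of_notMem h u
  have hg0' : ∀ z ∉ K, g =ᶠ[𝓝 z] fun _ => 0 := fun z hz => by
    filter_upwards [hK.isClosed.isOpen_compl.mem_nhds hz] with w hw using hg0 w hw
  have hgC : ContDiff ℝ 2 g := contDiff_iff_contDiffAt.2 fun z => by
    by_cases h : z ∈ K
    · refine ContDiffAt.congr_of_eventuallyEq ?_ (hgu z (hKt h))
      exact C2At.comp_chart_symm (hKt h) (f := fun x => ρ.toFun d x * f x)
        ((ρ.c2At d _).mul (hf _))
    · exact contDiffAt_const.congr_of_eventuallyEq (hg0' z h)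
  have hgc : HasCompactSupport g := HasCompactSupport.intro hK hg0
  have h1 := UpqHiggs.integral_laplacian_eq_zero hgC hgc
  rw [← h1, ← setIntegral_eq_integral_of_forall_compl_eq_zero (s := (chartAt ℂ d).target)
    (f := Laplacian.laplacian g)]
  · exact setIntegral_congr_fun (chartAt ℂ d).open_target.measurableSet fun z hz =>
      (InnerProductSpace.laplacian_congr_nhds (hgu z hz)).eq_of_nhds.symm
  · intro z hz
    have hzK : z ∉ K := fun h => hz (hKt h)
    rw [(InnerProductSpace.laplacian_congr_nhds (hg0' z hzK)).eq_of_nhds]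
    simp

/-- This Jacobian is the factor `‖h'‖²` by which the Laplacian changes under a holomorphic `h`, so
that `Δf dx ∧ dy` is a well-defined form. -/
theorem det_restrictScalars_mul (a : ℂ) :
    ((ContinuousLinearMap.toSpanSingleton ℂ a).restrictScalars ℝ).det = ‖a‖ ^ 2 := by
  rw [← Complex.normSq_eq_norm_sq]
  have h := congrFun (congrArg DFunLike.coe Algebra.norm_complex_eq) a
  rw [Algebra.norm_apply] at h
  change _ = Complex.normSq a at h
  rw [← h, ContinuousLinearMap.det]
  congr 1
  ext
  simp [mul_comm]

/-- Both integrands vanish off the overlap of the two charts, since `ρ c` and `ρ d` are supported in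
their own charts. On the overlap the Jacobian of the transition map matches the conformal factor of
the Laplacian. -/
theorem ChartPartition.integral_change_chart (ρ : ChartPartition X) {f : X → ℝ}
    (hf : ∀ x, C2At f x) (c d : X) :
    ∫ z in (chartAt ℂ c).target, ρ.toFun c ((chartAt ℂ c).symm z) *
      Laplacian.laplacian (fun w =>
        ρ.toFun d ((chartAt ℂ c).symm w) * f ((chartAt ℂ c).symm w)) z =
    ∫ z in (chartAt ℂ d).target, ρ.toFun c ((chartAt ℂ d).symm z) *
      Laplacian.laplacian (fun w =>
        ρ.toFun d ((chartAt ℂ d).symm w) * f ((chartAt ℂ d).symm w)) z := by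
  set S := ((chartAt ℂ d).symm.trans (chartAt ℂ c)).source with hSdef
  set h : ℂ → ℂ := fun w => chartAt ℂ c ((chartAt ℂ d).symm w) with hh
  have hS : ∀ z ∈ S, z ∈ (chartAt ℂ d).target ∧ (chartAt ℂ d).symm z ∈ (chartAt ℂ c).source :=
    fun z hz => by simpa [hSdef] using hz
  have hSo : IsOpen S := ((chartAt ℂ d).symm.trans (chartAt ℂ c)).open_source
  have himg : h '' S = ((chartAt ℂ d).symm.trans (chartAt ℂ c)).target :=
    ((chartAt ℂ d).symm.trans (chartAt ℂ c)).image_source_eq_target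
  have hT : ∀ z, z ∈ h '' S ↔ z ∈ (chartAt ℂ c).target ∧
      (chartAt ℂ c).symm z ∈ (chartAt ℂ d).source := fun z => by
    rw [himg]; simp
  have hd : ∀ z ∈ S, AnalyticAt ℂ h z := fun z hz =>
    analyticAt_transition (hS z hz).1 (hS z hz).2
  rw [setIntegral_eq_of_subset_of_forall_sdiff_eq_zero (s := h '' S)
      (chartAt ℂ c).open_target.measurableSet (fun z hz => ((hT z).1 hz).1),
    setIntegral_eq_of_subset_of_forall_sdiff_eq_zero (s := S)
      (chartAt ℂ d).open_target.measurableSet (fun z hz => (hS z hz).1),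
    integral_image_eq_integral_abs_det_fderiv_smul volume hSo.measurableSet
      (f' := fun z => (ContinuousLinearMap.toSpanSingleton ℂ (deriv h z)).restrictScalars ℝ)]
  · refine setIntegral_congr_fun hSo.measurableSet fun z hz => ?_
    obtain ⟨hz1, hz2⟩ := hS z hz
    have hzc : h z ∈ (chartAt ℂ c).target := (chartAt ℂ c).map_source hz2
    have e1 : (chartAt ℂ c).symm (h z) = (chartAt ℂ d).symm z := (chartAt ℂ c).left_inv hz2
    have e2 := laplacian_comp_analytic (C2At.comp_chart_symm hzc (f := fun x => ρ.toFun d x * f x)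
        ((ρ.c2At d _).mul (hf _))) (hd z hz)
    have e3 : (fun w => ρ.toFun d ((chartAt ℂ c).symm w) * f ((chartAt ℂ c).symm w)) ∘ h
        =ᶠ[𝓝 z] fun w => ρ.toFun d ((chartAt ℂ d).symm w) * f ((chartAt ℂ d).symm w) := by
      filter_upwards [hSo.mem_nhds hz] with w hw
      have : (chartAt ℂ c).symm (h w) = (chartAt ℂ d).symm w :=
        (chartAt ℂ c).left_inv (hS w hw).2
      simp only [Function.comp_apply, this]
    rw [(InnerProductSpace.laplacian_congr_nhds e3).eq_of_nhds] at e2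
    simp only [det_restrictScalars_mul, smul_eq_mul, e1, abs_of_nonneg (sq_nonneg ‖_‖)]
    rw [e2]
    ring
  · intro z hz
    have h1 := (hd z hz).differentiableAt.hasDerivAt.hasFDerivAt.restrictScalars ℝ
    exact h1.hasFDerivWithinAt
  · exact ((chartAt ℂ d).symm.trans (chartAt ℂ c)).injOn
  · intro z hz
    have : (chartAt ℂ d).symm z ∉ (chartAt ℂ c).source := fun h' =>
      hz.2 (by simpa [hSdef] using ⟨hz.1, h'⟩)
    rw [image_eq_zero_of_notMem_tsupport fun h' => this (ρ.subordinate c h'), zero_mul]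
  · intro z hz
    have : (chartAt ℂ c).symm z ∉ (chartAt ℂ d).source := fun h' => hz.2 ((hT z).2 ⟨hz.1, h'⟩)
    rw [laplacian_eq_zero_of_notMem_tsupport hz.1 fun h' => this (ρ.subordinate d h'), mul_zero]

theorem laplacian_sum {ι : Type*} (s : Finset ι) {f : ι → ℂ → ℝ} {z : ℂ}
    (hf : ∀ i ∈ s, ContDiffAt ℝ 2 (f i) z) :
    Laplacian.laplacian (fun w => ∑ i ∈ s, f i w) z =
      ∑ i ∈ s, Laplacian.laplacian (f i) z := by
  classical
  induction s using Finset.induction_on with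
  | empty => simp
  | insert a s ha ih =>
    have h1 : (fun w => ∑ i ∈ insert a s, f i w) = f a + fun w => ∑ i ∈ s, f i w := by
      ext w; simp [Finset.sum_insert ha]
    rw [h1, ContDiffAt.laplacian_add (hf a (by simp))
      (ContDiffAt.sum fun i hi => hf i (by simp [hi])), Finset.sum_insert ha,
      ih fun i hi => hf i (by simp [hi])]

/-- Stokes' theorem: the integral of `Δ f dx ∧ dy` over a compact Riemann surface vanishes. -/
theorem ChartPartition.sum_integral_laplacian_eq_zero (ρ : ChartPartition X) {f : X → ℝ}
    (hf : ∀ x, C2At f x) :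
    ∑ c ∈ ρ.finite.toFinset, ∫ z in (chartAt ℂ c).target, ρ.toFun c ((chartAt ℂ c).symm z) *
      Laplacian.laplacian (fun w => f ((chartAt ℂ c).symm w)) z = 0 := by
  have hdf : ∀ d x, C2At (fun x => ρ.toFun d x * f x) x := fun d x => (ρ.c2At d x).mul (hf x)
  -- Insert `∑ d, ρ d = 1` under the Laplacian. Each `(c, d)` term is then moved to the chart at
  -- `d`, where the outer weights `ρ c` sum to `1` and the compactly supported `ρ d * f` remains.
  have h1 : ∀ c, ∫ z in (chartAt ℂ c).target, ρ.toFun c ((chartAt ℂ c).symm z) *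
      Laplacian.laplacian (fun w => f ((chartAt ℂ c).symm w)) z =
      ∑ d ∈ ρ.finite.toFinset, ∫ z in (chartAt ℂ c).target, ρ.toFun c ((chartAt ℂ c).symm z) *
        Laplacian.laplacian (fun w =>
          ρ.toFun d ((chartAt ℂ c).symm w) * f ((chartAt ℂ c).symm w)) z := fun c => by
    rw [← integral_finsetSum _ fun d _ =>
      ρ.integrableOn_mul c (continuousOn_laplacian_chart (hdf d) c)]
    refine setIntegral_congr_fun (chartAt ℂ c).open_target.measurableSet fun z hz => ?_
    rw [← Finset.mul_sum, ← laplacian_sum _ fun d _ => C2At.comp_chart_symm hz (hdf d _)]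
    simp only [← Finset.sum_mul, ρ.sum_eq_one, one_mul]
  simp only [h1]
  rw [Finset.sum_comm]
  refine Finset.sum_eq_zero fun d _ => ?_
  simp only [ρ.integral_change_chart hf _ d]
  rw [← integral_finsetSum]
  · rw [← ρ.integral_laplacian_eq_zero hf d]
    refine setIntegral_congr_fun (chartAt ℂ d).open_target.measurableSet fun z _ => ?_
    rw [← Finset.sum_mul, ρ.sum_eq_one, one_mul]
  · intro c _
    refine ρ.integrableOn d ((ρ.continuousOn c d).mul (continuousOn_laplacian_chart (hdf d) d))
      fun z hz hz' => ?_
    rw [laplacian_eq_zero_of_notMem_tsupport hz hz', mul_zero]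

/-- If `σ ≥ 0` is a `C²` function with finitely many zeros, then `Δ log σ`, if it extends
continuously over the zeros of `σ`, has a nonpositive integral. -/
theorem ChartPartition.finsum_integral_nonpos (ρ : ChartPartition X) {σ : X → ℝ}
    {D : X → ℂ → ℝ} (hσ : ∀ x, 0 ≤ σ x) (hσ2 : ∀ x, C2At σ x) (hfin : {x | σ x = 0}.Finite)
    (hD : ∀ c, ContinuousOn (D c) (chartAt ℂ c).target)
    (hlog : ∀ c, ∀ z ∈ (chartAt ℂ c).target, σ ((chartAt ℂ c).symm z) ≠ 0 →
      Laplacian.laplacian (fun w => Real.log (σ ((chartAt ℂ c).symm w))) z = D c z) :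
    ∑ᶠ c : X, ∫ z in (chartAt ℂ c).target, ρ.toFun c ((chartAt ℂ c).symm z) * D c z ≤ 0 := by
  rw [ρ.finsum_eq _ fun c hc => by simp [hc]]
  -- The finitely many zeros of `σ` form a null set, so the pointwise comparison is only needed
  -- elsewhere.
  have hae : ∀ c, ∀ᵐ z ∂(volume.restrict (chartAt ℂ c).target),
      z ∈ (chartAt ℂ c).target ∧ σ ((chartAt ℂ c).symm z) ≠ 0 := fun c => by
    have h0 : ({z | z ∈ (chartAt ℂ c).target ∧ σ ((chartAt ℂ c).symm z) = 0}).Finite := by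
      refine (hfin.image (chartAt ℂ c)).subset ?_
      rintro z ⟨hz, hz0⟩
      exact ⟨_, hz0, (chartAt ℂ c).right_inv hz⟩
    filter_upwards [ae_restrict_mem (chartAt ℂ c).open_target.measurableSet,
      ae_restrict_of_ae (measure_eq_zero_iff_ae_notMem.1 (h0.measure_zero volume))] with z hz hz'
    exact ⟨hz, fun h => hz' ⟨hz, h⟩⟩
  have hσc : ∀ c, ContinuousOn (fun z => σ ((chartAt ℂ c).symm z)) (chartAt ℂ c).target :=
    fun c => (continuous_iff_continuousAt.2 fun x => (hσ2 x).continuousAt).comp_continuousOn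
      (chartAt ℂ c).continuousOn_symm
  have hcont : ∀ ε > 0, ∀ c, ContinuousOn (fun z => σ ((chartAt ℂ c).symm z) /
      (σ ((chartAt ℂ c).symm z) + ε) * D c z) (chartAt ℂ c).target := fun ε hε c =>
    ((hσc c).div ((hσc c).add continuousOn_const) fun z _ =>
      (add_pos_of_nonneg_of_pos (hσ _) hε).ne').mul (hD c)
  have key : ∀ ε > 0, ∑ c ∈ ρ.finite.toFinset, ∫ z in (chartAt ℂ c).target,
      ρ.toFun c ((chartAt ℂ c).symm z) * (σ ((chartAt ℂ c).symm z) /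
        (σ ((chartAt ℂ c).symm z) + ε) * D c z) ≤ 0 := fun ε hε => by
    have hlogε : ∀ x, C2At (fun y => Real.log (σ y + ε)) x := fun x =>
      C2At.log ((hσ2 x).add contMDiffAt_const) (add_pos_of_nonneg_of_pos (hσ x) hε).ne'
    rw [← ρ.sum_integral_laplacian_eq_zero hlogε]
    refine Finset.sum_le_sum fun c _ => integral_mono_ae (ρ.integrableOn_mul c (hcont ε hε c))
      (ρ.integrableOn_mul c (continuousOn_laplacian_chart hlogε c)) ?_
    filter_upwards [hae c] with z ⟨hz, hz0⟩
    refine mul_le_mul_of_nonneg_left ?_ (ρ.toFun.nonneg c _)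
    rw [← hlog c z hz hz0]
    exact laplacian_log_add_ge (C2At.comp_chart_symm hz (hσ2 _))
      (lt_of_le_of_ne (hσ _) hz0.symm) hε
  -- Dominated convergence with `ε = 1 / (n + 1)`: the factor `σ / (σ + ε)` lies in `[0, 1]` and
  -- tends to `1` off the zeros.
  have hlim : Filter.Tendsto (fun n : ℕ => ∑ c ∈ ρ.finite.toFinset, ∫ z in (chartAt ℂ c).target,
      ρ.toFun c ((chartAt ℂ c).symm z) * (σ ((chartAt ℂ c).symm z) /
        (σ ((chartAt ℂ c).symm z) + 1 / ((n : ℝ) + 1)) * D c z)) Filter.atTop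
      (𝓝 (∑ c ∈ ρ.finite.toFinset, ∫ z in (chartAt ℂ c).target,
        ρ.toFun c ((chartAt ℂ c).symm z) * D c z)) := by
    refine tendsto_finsetSum _ fun c _ => ?_
    refine tendsto_integral_of_dominated_convergence
      (fun z => ‖ρ.toFun c ((chartAt ℂ c).symm z) * D c z‖)
      (fun n => (ρ.integrableOn_mul c (hcont _ (by positivity) c)).aestronglyMeasurable)
      (ρ.integrableOn_mul c (hD c)).norm (fun n => ?_) ?_
    · refine Filter.Eventually.of_forall fun z => ?_
      have h0 := hσ ((chartAt ℂ c).symm z)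
      have hn : (0 : ℝ) < 1 / ((n : ℝ) + 1) := by positivity
      have h1 : σ ((chartAt ℂ c).symm z) / (σ ((chartAt ℂ c).symm z) + 1 / ((n : ℝ) + 1)) ≤ 1 :=
        div_le_one_of_le₀ (by linarith) (by positivity)
      rw [norm_mul, norm_mul, norm_mul]
      refine mul_le_mul_of_nonneg_left ?_ (norm_nonneg _)
      rw [Real.norm_of_nonneg (div_nonneg h0 (by positivity))]
      exact mul_le_of_le_one_left (norm_nonneg _) h1
    · filter_upwards [hae c] with z ⟨hz, hz0⟩
      refine Filter.Tendsto.const_mul _ ?_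
      have h2 : Filter.Tendsto (fun n : ℕ => σ ((chartAt ℂ c).symm z) /
          (σ ((chartAt ℂ c).symm z) + 1 / ((n : ℝ) + 1))) Filter.atTop
          (𝓝 (σ ((chartAt ℂ c).symm z) / (σ ((chartAt ℂ c).symm z) + 0))) :=
        tendsto_const_nhds.div (tendsto_const_nhds.add tendsto_one_div_add_atTop_nhds_zero_nat)
          (by simpa using hz0)
      rw [add_zero, div_self hz0] at h2
      simpa using h2.mul_const (D c z)
  exact le_of_tendsto hlim (Filter.Eventually.of_forall fun n => key _ (by positivity))

end Stokes

/-! ### Linear algebra -/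

section LinearAlgebra

variable {ι F : Type*} [Fintype ι] [DecidableEq ι] [AddCommGroup F] [Module ℂ F]

/-- Dual forms turn independence at one point into the nonvanishing of a determinant, which is
holomorphic when the vectors vary holomorphically. -/
theorem exists_dual_family {v : ι → F} (hv : LinearIndependent ℂ v) :
    ∃ l : ι → F →ₗ[ℂ] ℂ, ∀ i j, l j (v i) = (1 : Matrix ι ι ℂ) i j := by
  obtain ⟨g, hg⟩ := LinearMap.exists_leftInverse_of_injective _
    (LinearMap.ker_eq_bot.2 (hv : Function.Injective (Finsupp.linearCombination ℂ v)))
  refine ⟨fun j => Finsupp.lapply j ∘ₗ g, fun i j => ?_⟩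
  have := LinearMap.congr_fun hg (Finsupp.single i 1)
  simp at this
  simp [this, Matrix.one_apply, Finsupp.single_apply]

theorem linearIndependent_of_det_ne_zero {v : ι → F} {l : ι → F →ₗ[ℂ] ℂ}
    (h : (Matrix.of fun i j => l j (v i)).det ≠ 0) : LinearIndependent ℂ v := by
  rw [Fintype.linearIndependent_iff]
  intro c hc
  have h0 : Matrix.vecMul c (Matrix.of fun i j => l j (v i)) = 0 := by
    ext j
    have := congrArg (l j) hc
    simpa [Matrix.vecMul, dotProduct] using this
  exact fun i => congrFun (Matrix.eq_zero_of_vecMul_eq_zero h h0) i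

/-- The determinants of a family of linear forms on two families of vectors. -/
theorem det_dual_of_eq_sum {s t : ι → F} {P : Matrix ι ι ℂ} (h : ∀ i, s i = ∑ j, P i j • t j)
    (l : ι → F →ₗ[ℂ] ℂ) : (Matrix.of fun i j => l j (s i)).det =
      P.det * (Matrix.of fun i j => l j (t i)).det := by
  rw [← Matrix.det_mul]
  congr 1
  ext i j
  simp [h, Matrix.mul_apply]

theorem exists_matrix_of_mem_span {κ : Type*} {s : κ → F} {t : ι → F}
    (h : ∀ i, s i ∈ Submodule.span ℂ (Set.range t)) :
    ∃ P : Matrix κ ι ℂ, ∀ i, s i = ∑ j, P i j • t j := by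
  choose P hP using fun i => (Submodule.mem_span_range_iff_exists_fun ℂ).1 (h i)
  exact ⟨P, fun i => (hP i).symm⟩

theorem span_eq_of_linearIndependent {s t : ι → F} (hs : LinearIndependent ℂ s)
    (h : ∀ i, s i ∈ Submodule.span ℂ (Set.range t)) :
    Submodule.span ℂ (Set.range s) = Submodule.span ℂ (Set.range t) := by
  have : FiniteDimensional ℂ (Submodule.span ℂ (Set.range t)) :=
    FiniteDimensional.span_of_finite ℂ (Set.finite_range t)
  refine Submodule.eq_of_le_of_finrank_le (Submodule.span_le.2 ?_) ?_
  · rintro _ ⟨i, rfl⟩; exact h i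
  · rw [finrank_span_eq_card hs]
    exact finrank_range_le_card t

end LinearAlgebra

/-! ### Holomorphic functions on a Riemann surface -/

section Holomorphic

variable {X : Type*} [TopologicalSpace X] [ChartedSpace ℂ X]
variable {F : Type*} [NormedAddCommGroup F] [NormedSpace ℂ F]
variable {G : Type*} [NormedAddCommGroup G] [NormedSpace ℂ G]

theorem HolAt.comp_contDiff {f : X → F} {x : X} {g : F → G} (hg : ContDiffAt ℂ ω g (f x))
    (hf : HolAt f x) : HolAt (fun y => g (f y)) x :=
  hg.comp_contMDiffAt hf

theorem HolAt.linear [FiniteDimensional ℂ F] {f : X → F} {x : X} (hf : HolAt f x)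
    (l : F →ₗ[ℂ] G) : HolAt (fun y => l (f y)) x :=
  hf.comp_contDiff (g := LinearMap.toContinuousLinearMap l)
    (LinearMap.toContinuousLinearMap l).contDiff.contDiffAt

theorem HolAt.mul {f g : X → ℂ} {x : X} (hf : HolAt f x) (hg : HolAt g x) :
    HolAt (fun y => f y * g y) x :=
  ((contDiff_mul (𝕜 := ℂ) (𝔸 := ℂ)).contMDiff (x := (f x, g x))).comp x (hf.prodMk_space hg)

theorem HolAt.smul {f : X → ℂ} {g : X → F} {x : X} (hf : HolAt f x) (hg : HolAt g x) :
    HolAt (fun y => f y • g y) x :=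
  ((contDiff_smul (𝕜 := ℂ) (F := F)).contMDiff (x := (f x, g x))).comp x (hf.prodMk_space hg)

theorem HolAt.inv {f : X → ℂ} {x : X} (hf : HolAt f x) (h0 : f x ≠ 0) :
    HolAt (fun y => (f y)⁻¹) x :=
  hf.comp_contDiff (contDiffAt_inv ℂ h0)

theorem HolAt.det {ι : Type*} [Fintype ι] [DecidableEq ι] {M : X → Matrix ι ι ℂ} {x : X}
    (hM : ∀ i j, HolAt (fun y => M y i j) x) : HolAt (fun y => (M y).det) x := by
  have h1 : ContDiff ℂ ω fun N : ι → ι → ℂ => (Matrix.of N).det := by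
    simp only [Matrix.det_apply]
    refine ContDiff.sum fun σ _ => ContDiff.const_smul _ (contDiff_prod fun i _ => ?_)
    exact contDiff_apply_apply ℂ ℂ (σ i) i
  have h2 : HolAt (G := ι → ι → ℂ) (fun y => M y) x :=
    contMDiffAt_pi_space.2 fun i => contMDiffAt_pi_space.2 fun j => hM i j
  exact HolAt.comp_contDiff (F := ι → ι → ℂ) (f := fun y => M y)
    (g := fun N => (Matrix.of N).det) h1.contDiffAt h2

variable [IsManifold 𝓘(ℂ) ω X]

theorem HolAt.eventually {f : X → F} {x : X} (hf : HolAt f x) : ∀ᶠ y in 𝓝 x, HolAt f y :=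
  (contMDiffAt_iff_contMDiffAt_nhds (by simp)).1 hf

theorem HolAt.analyticAt [CompleteSpace F] {f : X → F} {x : X} (hf : HolAt f x) :
    AnalyticAt ℂ (fun z => f ((chartAt ℂ x).symm z)) (chartAt ℂ x x) :=
  HolAt.comp_chart_symm (mem_chart_target ℂ x)
    (by rwa [(chartAt ℂ x).left_inv (mem_chart_source ℂ x)])

theorem _root_.AnalyticAt.holAt [CompleteSpace F] {f : ℂ → F} {x : X}
    (hf : AnalyticAt ℂ f (chartAt ℂ x x)) :
    HolAt (fun y => f (chartAt ℂ x y)) x :=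
  ContDiffAt.comp_contMDiffAt (g := f) hf.contDiffAt
    ((contMDiffOn_chart (n := ω)).contMDiffAt (chart_source_mem_nhds ℂ x))

theorem tendsto_chart_punctured (x : X) :
    Filter.Tendsto (chartAt ℂ x) (𝓝[≠] x) (𝓝[≠] (chartAt ℂ x x)) := by
  refine tendsto_nhdsWithin_iff.2 ⟨((chartAt ℂ x).continuousAt
    (mem_chart_source ℂ x)).tendsto.mono_left nhdsWithin_le_nhds, ?_⟩
  filter_upwards [nhdsWithin_le_nhds (chart_source_mem_nhds ℂ x), self_mem_nhdsWithin] with y hy hne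
    h
  exact hne ((chartAt ℂ x).injOn hy (mem_chart_source ℂ x) h)

theorem tendsto_chart_symm_punctured (x : X) :
    Filter.Tendsto (chartAt ℂ x).symm (𝓝[≠] (chartAt ℂ x x)) (𝓝[≠] x) := by
  have h0 : (chartAt ℂ x).symm (chartAt ℂ x x) = x := (chartAt ℂ x).left_inv (mem_chart_source ℂ x)
  refine tendsto_nhdsWithin_iff.2 ⟨?_, ?_⟩
  · have := ((chartAt ℂ x).continuousAt_symm (mem_chart_target ℂ x)).tendsto
    rw [h0] at this
    exact this.mono_left nhdsWithin_le_nhds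
  · filter_upwards [nhdsWithin_le_nhds (chart_target_mem_nhds ℂ x), self_mem_nhdsWithin]
      with z hz hne h
    refine hne ?_
    rw [← (chartAt ℂ x).right_inv hz, Set.mem_singleton_iff.1 h]
    rfl

/-- No point is isolated, so two properties valid on punctured neighbourhoods of the same point hold
together somewhere. -/
instance punctured_neBot (x : X) : (𝓝[≠] x).NeBot :=
  (tendsto_chart_symm_punctured x).neBot

/-- Every point has arbitrarily small neighbourhoods on which the identity theorem holds. -/
theorem exists_identity_nhd (x₀ : X) {S : Set X} (hS : S ∈ 𝓝 x₀) :
    ∃ U ⊆ S, U ∈ 𝓝 x₀ ∧ ∀ g : X → ℂ, (∀ x ∈ U, HolAt g x) → (∃ y ∈ U, g y ≠ 0) →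
      ∀ᶠ x in 𝓝[≠] x₀, g x ≠ 0 := by
  have h0 : (chartAt ℂ x₀).symm (chartAt ℂ x₀ x₀) = x₀ :=
    (chartAt ℂ x₀).left_inv (mem_chart_source ℂ x₀)
  have h1 : (chartAt ℂ x₀).symm ⁻¹' S ∩ (chartAt ℂ x₀).target ∈ 𝓝 (chartAt ℂ x₀ x₀) :=
    Filter.inter_mem ((chartAt ℂ x₀).continuousAt_symm (mem_chart_target ℂ x₀)
      (by rwa [h0])) (chart_target_mem_nhds ℂ x₀)
  obtain ⟨ε, hε, hB⟩ := Metric.mem_nhds_iff.1 h1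
  refine ⟨(chartAt ℂ x₀).symm '' Metric.ball (chartAt ℂ x₀ x₀) ε, ?_, ?_, ?_⟩
  · rintro _ ⟨z, hz, rfl⟩
    exact (hB hz).1
  · have h2 := ((chartAt ℂ x₀).continuousAt (mem_chart_source ℂ x₀)) (Metric.ball_mem_nhds _ hε)
    filter_upwards [h2, chart_source_mem_nhds ℂ x₀] with y hy hy'
    exact ⟨_, hy, (chartAt ℂ x₀).left_inv hy'⟩
  · rintro g hg ⟨_, ⟨w, hw, rfl⟩, hne⟩
    have han : AnalyticOnNhd ℂ (fun z => g ((chartAt ℂ x₀).symm z))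
        (Metric.ball (chartAt ℂ x₀ x₀) ε) := fun z hz =>
      HolAt.comp_chart_symm (hB hz).2 (hg _ ⟨z, hz, rfl⟩)
    -- A zero of infinite order at the centre would make `g` vanish on the whole ball, which is
    -- connected; this is why `U` is taken to be a coordinate ball.
    rcases (han _ (Metric.mem_ball_self hε)).eventually_eq_zero_or_eventually_ne_zero with h | h
    · exact absurd (han.eqOn_zero_of_preconnected_of_eventuallyEq_zero
        (convex_ball _ _).isPreconnected (Metric.mem_ball_self hε) h hw) hne
    · filter_upwards [(tendsto_chart_punctured x₀).eventually h,
        nhdsWithin_le_nhds (chart_source_mem_nhds ℂ x₀)] with x hx hx'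
      rwa [(chartAt ℂ x₀).left_inv hx'] at hx

theorem HolAt.eventually_linearIndependent [FiniteDimensional ℂ F] {ι : Type*} [Finite ι]
    {t : ι → X → F} {x₀ : X} (ht : ∀ i, HolAt (t i) x₀)
    (h0 : LinearIndependent ℂ fun i => t i x₀) :
    ∀ᶠ x in 𝓝 x₀, LinearIndependent ℂ fun i => t i x := by
  have hc : ContinuousAt (fun x i => t i x) x₀ := continuousAt_pi.2 fun i => (ht i).continuousAt
  exact hc (isOpen_setOfPred_linearIndependent.mem_nhds h0)

/-- Otherwise `s` together with `t` would be independent at `x₀`. Independence is an open condition,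
contradicting membership at nearby points. -/
theorem mem_span_of_eventually [FiniteDimensional ℂ F] {ι : Type*} [Finite ι]
    {t : ι → X → F} {s : X → F} {x₀ : X} (ht : ∀ i, HolAt (t i) x₀)
    (h0 : LinearIndependent ℂ fun i => t i x₀) (hs : HolAt s x₀)
    (h : ∀ᶠ x in 𝓝[≠] x₀, s x ∈ Submodule.span ℂ (Set.range fun i => t i x)) :
    s x₀ ∈ Submodule.span ℂ (Set.range fun i => t i x₀) := by
  by_contra hn
  have h1 : LinearIndependent ℂ fun o : Option ι => (o.elim s t) x₀ := by
    rw [linearIndependent_option]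
    exact ⟨h0, hn⟩
  have h2 := HolAt.eventually_linearIndependent (t := fun o : Option ι => o.elim s t)
    (fun o => by cases o; exacts [hs, ht _]) h1
  obtain ⟨x, hx', hx⟩ := (h.and (nhdsWithin_le_nhds h2)).exists
  rw [linearIndependent_option] at hx
  exact hx.2 hx'

/-- The determinant of the matrix expressing sections in a holomorphic frame is holomorphic. -/
theorem exists_hol_det [FiniteDimensional ℂ F] {ι : Type*} [Fintype ι] [DecidableEq ι]
    {s t : ι → X → F} {x₀ : X} (hs : ∀ i, HolAt (s i) x₀) (ht : ∀ i, HolAt (t i) x₀)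
    (h0 : LinearIndependent ℂ fun i => t i x₀)
    (h : ∀ᶠ x in 𝓝 x₀, ∀ i, s i x ∈ Submodule.span ℂ (Set.range fun i => t i x)) :
    ∃ a : X → ℂ, HolAt a x₀ ∧ ∀ᶠ x in 𝓝 x₀, ∃ P : Matrix ι ι ℂ,
      (∀ i, s i x = ∑ j, P i j • t j x) ∧ P.det = a x := by
  obtain ⟨l, hl⟩ := exists_dual_family h0
  have hdt : HolAt (fun x => (Matrix.of fun i j => l j (t i x)).det) x₀ :=
    HolAt.det fun i j => (ht i).linear (l j)
  have hds : HolAt (fun x => (Matrix.of fun i j => l j (s i x)).det) x₀ :=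
    HolAt.det fun i j => (hs i).linear (l j)
  have hne : (Matrix.of fun i j => l j (t i x₀)).det ≠ 0 := by
    have : (Matrix.of fun i j => l j (t i x₀)) = 1 := by ext i j; exact hl i j
    rw [this]; simp
  -- Applying the forms `l` to `s = P t` expresses `det P` as a quotient of holomorphic
  -- determinants, with denominator `1` at `x₀`.
  refine ⟨fun x => (Matrix.of fun i j => l j (s i x)).det *
    (Matrix.of fun i j => l j (t i x)).det⁻¹, hds.mul (hdt.inv hne), ?_⟩
  filter_upwards [h, hdt.continuousAt.eventually_ne hne] with x hx hx'
  obtain ⟨P, hP⟩ := exists_matrix_of_mem_span hx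
  refine ⟨P, hP, ?_⟩
  rw [det_dual_of_eq_sum hP l, mul_inv_cancel_right₀ hx']

end Holomorphic

/-! ### Saturation of generically independent families of holomorphic vectors -/

section Saturation

variable {F : Type*} [NormedAddCommGroup F] [NormedSpace ℂ F] [FiniteDimensional ℂ F]

theorem _root_.AnalyticAt.det_dual {ι : Type*} [Fintype ι] [DecidableEq ι] {f : ι → ℂ → F} {z : ℂ}
    (hf : ∀ i, AnalyticAt ℂ (f i) z) (l : ι → F →ₗ[ℂ] ℂ) :
    AnalyticAt ℂ (fun w => (Matrix.of fun i j => l j (f i w)).det) z := by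
  refine ContDiffAt.analyticAt (contMDiffAt_iff_contDiffAt.1 ?_)
  have := FiniteDimensional.complete ℂ F
  exact HolAt.det (X := ℂ) fun i j =>
    HolAt.linear (contMDiffAt_iff_contDiffAt.2 (hf i).contDiffAt) (l j)

theorem det_dual_update {ι : Type*} [Fintype ι] [DecidableEq ι] (v : ι → F) (l : ι → F →ₗ[ℂ] ℂ)
    (c : ι → ℂ) (i₀ : ι) :
    (Matrix.of fun i j => l j (Function.update v i₀ (∑ i, c i • v i) i)).det =
      c i₀ * (Matrix.of fun i j => l j (v i)).det := by
  have h1 : (Matrix.of fun i j => l j (Function.update v i₀ (∑ i, c i • v i) i)) =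
      (Matrix.of fun i j => l j (v i)).updateRow i₀
        (∑ k, c k • (Matrix.of fun i j => l j (v i)) k) := by
    ext i j
    by_cases h : i = i₀
    · subst h; simp
    · simp [h]
  rw [h1, Matrix.det_updateRow_sum, smul_eq_mul]

/-- Induction on the order of vanishing of the determinant. If the vectors are dependent at `z₀`, a
relation `∑ cᵢ fᵢ` vanishes there; dividing it by `z - z₀` and substituting the quotient for some `f
i₀` with `c i₀ ≠ 0` lowers the order by one. The old vectors stay in the span of the new ones. -/
theorem exists_saturation {r : ℕ} (l : Fin r → F →ₗ[ℂ] ℂ) (z₀ : ℂ) (n : ℕ) :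
    ∀ f : Fin r → ℂ → F, (∀ i, AnalyticAt ℂ (f i) z₀) →
    analyticOrderAt (fun z => (Matrix.of fun i j => l j (f i z)).det) z₀ = n →
    ∃ t : Fin r → ℂ → F, (∀ i, AnalyticAt ℂ (t i) z₀) ∧ LinearIndependent ℂ (fun i => t i z₀) ∧
      ∀ z ≠ z₀, ∀ i, f i z ∈ Submodule.span ℂ (Set.range fun i => t i z) := by
  induction n with
  | zero =>
    intro f hf hn
    refine ⟨f, hf, ?_, fun z _ i => Submodule.subset_span ⟨i, rfl⟩⟩
    exact linearIndependent_of_det_ne_zero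
      ((AnalyticAt.det_dual hf l).analyticOrderAt_eq_zero.1 (by simpa using hn))
  | succ n ih =>
    intro f hf hn
    have hd0 : (Matrix.of fun i j => l j (f i z₀)).det = 0 := by
      by_contra h
      have := (AnalyticAt.det_dual hf l).analyticOrderAt_eq_zero.2 h
      rw [hn] at this
      exact absurd this (by exact_mod_cast Nat.succ_ne_zero n)
    -- The forms `l` are fixed in advance, so the determinant may vanish at `z₀` although the
    -- vectors are independent there.
    by_cases hind : LinearIndependent ℂ fun i => f i z₀
    · exact ⟨f, hf, hind, fun z _ i => Submodule.subset_span ⟨i, rfl⟩⟩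
    obtain ⟨c, hc, i₀, hi₀⟩ := Fintype.not_linearIndependent_iff.1 hind
    set g : ℂ → F := fun z => ∑ i, c i • f i z with hg
    have hga : AnalyticAt ℂ g z₀ := by
      rw [hg]
      exact Finset.analyticAt_fun_sum _ fun i _ => (hf i).const_smul
    have hda : AnalyticAt ℂ (dslope g z₀) z₀ := by
      obtain ⟨p, hp⟩ := hga
      exact ⟨_, hp.has_fpower_series_dslope_fslope⟩
    have hgd : ∀ z, g z = (z - z₀) • dslope g z₀ z := fun z => by
      rw [sub_smul_dslope, show g z₀ = 0 from hc, sub_zero]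
    have hupd : ∀ z, (fun i => Function.update f i₀ (dslope g z₀) i z) =
        Function.update (fun i => f i z) i₀ (dslope g z₀ z) := fun z => by
      ext i
      by_cases h : i = i₀
      · subst h; simp
      · simp [h]
    have hf' : ∀ i, AnalyticAt ℂ (Function.update f i₀ (dslope g z₀) i) z₀ := fun i => by
      by_cases h : i = i₀
      · subst h; simpa using hda
      · simpa [h] using hf i
    have hdet : ∀ z, c i₀ * (Matrix.of fun i j => l j (f i z)).det = (z - z₀) *
        (Matrix.of fun i j => l j (Function.update f i₀ (dslope g z₀) i z)).det := fun z => by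
      rw [← det_dual_update (fun i => f i z) l c i₀]
      have h1 : ∀ i, Function.update f i₀ (dslope g z₀) i z =
        Function.update (fun i => f i z) i₀ (dslope g z₀ z) i := fun i => congrFun (hupd z) i
      simp only [h1]
      have h2 : (Matrix.of fun i j => l j (Function.update (fun i => f i z) i₀ (g z) i)) =
          (Matrix.of fun i j =>
            l j (Function.update (fun i => f i z) i₀ (dslope g z₀ z) i)).updateRow i₀
          ((z - z₀) • (fun j => l j (dslope g z₀ z))) := by
        ext i j
        by_cases h : i = i₀
        · subst h; simp only [Matrix.of_apply, Function.update_self, Matrix.updateRow_self, hgd z,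
            map_smul, Pi.smul_apply]
        · simp [h]
      rw [show ∑ i, c i • f i z = g z from rfl, h2, Matrix.det_updateRow_smul]
      congr 2
      ext i j
      by_cases h : i = i₀
      · subst h; simp
      · simp [h]
    have hord : analyticOrderAt (fun z =>
        (Matrix.of fun i j => l j (Function.update f i₀ (dslope g z₀) i z)).det) z₀ = n := by
      have h1 : (fun z => (Matrix.of fun i j => l j (f i z)).det) =
          (fun z => (c i₀)⁻¹ * (z - z₀)) * fun z => (Matrix.of fun i j =>
            l j (Function.update f i₀ (dslope g z₀) i z)).det := by
        ext z
        rw [Pi.mul_apply, mul_assoc, ← hdet, inv_mul_cancel_left₀ hi₀]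
      have h2 : AnalyticAt ℂ (fun z => (c i₀)⁻¹ * (z - z₀)) z₀ := by fun_prop
      have h3 : analyticOrderAt (fun z => (c i₀)⁻¹ * (z - z₀)) z₀ = (1 : ℕ) := by
        rw [h2.analyticOrderAt_eq_natCast]
        refine ⟨fun _ => (c i₀)⁻¹, analyticAt_const, inv_ne_zero hi₀, ?_⟩
        exact Filter.Eventually.of_forall fun z => by simp [mul_comm]
      rw [h1, analyticOrderAt_mul h2 (AnalyticAt.det_dual hf' l), h3] at hn
      rw [add_comm n 1, Nat.cast_add, Nat.cast_one] at hn
      exact ENat.add_right_injective_of_ne_top (by simp) hn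
    obtain ⟨t, ht, hti, htf⟩ := ih _ hf' hord
    refine ⟨t, ht, hti, fun z hz i => ?_⟩
    by_cases h : i = i₀
    · subst h
      -- Solving the relation for the replaced vector recovers it from the new family.
      have h1 : f i z = (c i)⁻¹ • ((z - z₀) • dslope g z₀ z -
          ∑ k ∈ Finset.univ.erase i, c k • f k z) := by
        rw [← hgd, hg]
        simp only
        rw [← Finset.add_sum_erase _ _ (Finset.mem_univ i), add_sub_cancel_right,
          inv_smul_smul₀ hi₀]
      rw [h1]
      refine Submodule.smul_mem _ _ (Submodule.sub_mem _ (Submodule.smul_mem _ _ ?_)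
        (Submodule.sum_mem _ fun k hk => Submodule.smul_mem _ _ ?_))
      · simpa using htf z hz i
      · simpa [Finset.ne_of_mem_erase hk] using htf z hz k
    · simpa [h] using htf z hz i

variable {X : Type*} [TopologicalSpace X] [ChartedSpace ℂ X] [IsManifold 𝓘(ℂ) ω X]

/-- A generically independent family of holomorphic vectors has a saturation. -/
theorem HolAt.exists_saturation {r : ℕ} {f : Fin r → X → F} {x₀ : X} (hf : ∀ i, HolAt (f i) x₀)
    (h : ∀ᶠ x in 𝓝[≠] x₀, LinearIndependent ℂ fun i => f i x) :
    ∃ t : Fin r → X → F, (∀ i, HolAt (t i) x₀) ∧ LinearIndependent ℂ (fun i => t i x₀) ∧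
      ∀ᶠ x in 𝓝[≠] x₀, Submodule.span ℂ (Set.range fun i => f i x) =
        Submodule.span ℂ (Set.range fun i => t i x) := by
  have hall : ∀ᶠ x in 𝓝 x₀, ∀ i, HolAt (f i) x :=
    Filter.eventually_all.2 fun i => (hf i).eventually
  obtain ⟨U, hUS, hU, hid⟩ := exists_identity_nhd x₀ hall
  obtain ⟨y, hy, hyU⟩ := (h.and (nhdsWithin_le_nhds hU)).exists
  obtain ⟨l, hl⟩ := exists_dual_family hy
  -- Forms dual to the family at one nearby point `y` give a determinant that is nonzero at `y`,
  -- hence by the identity theorem on a punctured neighbourhood of `x₀`. Its order at `x₀` is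
  -- therefore finite.
  have hd := hid (fun x => (Matrix.of fun i j => l j (f i x)).det)
    (fun x hx => HolAt.det fun i j => (hUS hx i).linear (l j))
    ⟨y, hyU, by
      have : (Matrix.of fun i j => l j (f i y)) = 1 := by ext i j; exact hl i j
      rw [this]; simp⟩
  have := FiniteDimensional.complete ℂ F
  have han : ∀ i, AnalyticAt ℂ (fun z => f i ((chartAt ℂ x₀).symm z)) (chartAt ℂ x₀ x₀) :=
    fun i => (hf i).analyticAt
  have hne : analyticOrderAt (fun z => (Matrix.of fun i j =>
      l j (f i ((chartAt ℂ x₀).symm z))).det) (chartAt ℂ x₀ x₀) ≠ ⊤ := by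
    intro htop
    rw [analyticOrderAt_eq_top] at htop
    obtain ⟨z, hz, hz'⟩ := (((tendsto_chart_symm_punctured x₀).eventually hd).and
      (nhdsWithin_le_nhds htop)).exists
    exact hz hz'
  obtain ⟨n, hn⟩ := ENat.ne_top_iff_exists.1 hne
  obtain ⟨t, ht, hti, htf⟩ := UpqHiggs.exists_saturation l _ n _ han hn.symm
  refine ⟨fun i x => t i (chartAt ℂ x₀ x), fun i => (ht i).holAt, hti, ?_⟩
  filter_upwards [h, tendsto_chart_punctured x₀ self_mem_nhdsWithin,
    nhdsWithin_le_nhds (chart_source_mem_nhds ℂ x₀)] with x hx hx' hxs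
  refine span_eq_of_linearIndependent hx fun i => ?_
  simpa [(chartAt ℂ x₀).left_inv hxs] using htf _ hx' i

end Saturation

/-! ### Kernel and image of a holomorphic family of linear maps -/

section KernelImage

variable {X : Type*} [TopologicalSpace X] [ChartedSpace ℂ X] [IsManifold 𝓘(ℂ) ω X]
variable {F : Type*} [NormedAddCommGroup F] [NormedSpace ℂ F] [FiniteDimensional ℂ F]
variable {G : Type*} [NormedAddCommGroup G] [NormedSpace ℂ G] [FiniteDimensional ℂ G]

/-- A linear map has a basis of its kernel and a complementary family mapped to a basis of the
range. -/
theorem exists_adapted_basis {F G : Type*} [AddCommGroup F] [Module ℂ F] [FiniteDimensional ℂ F]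
    [AddCommGroup G] [Module ℂ G] (T : F →ₗ[ℂ] G) :
    ∃ (k : Fin (finrank ℂ F - finrank ℂ (LinearMap.range T)) → F)
      (m : Fin (finrank ℂ (LinearMap.range T)) → F),
      LinearIndependent ℂ (Sum.elim k m) ∧ (∀ i, T (k i) = 0) ∧
      LinearIndependent ℂ fun i => T (m i) := by
  have hfr := LinearMap.finrank_range_add_finrank_ker T
  let bk := finBasisOfFinrankEq ℂ (LinearMap.ker T)
    (n := finrank ℂ F - finrank ℂ (LinearMap.range T)) (by omega)
  let br := finBasis ℂ (LinearMap.range T)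
  choose m hm using fun i => (br i).2
  have hTm : LinearIndependent ℂ fun i => T (m i) := by
    simp only [hm]
    exact br.linearIndependent.map' (LinearMap.range T).subtype (Submodule.ker_subtype _)
  have hk : LinearIndependent ℂ fun i => (bk i : F) :=
    bk.linearIndependent.map' (LinearMap.ker T).subtype (Submodule.ker_subtype _)
  refine ⟨fun i => bk i, m, ?_, fun i => (bk i).2, hTm⟩
  refine LinearIndependent.sum_type hk (LinearIndependent.of_comp T hTm) ?_
  rw [Submodule.disjoint_def]
  intro x hx hx'
  obtain ⟨c, rfl⟩ := (Submodule.mem_span_range_iff_exists_fun ℂ).1 hx'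
  have h0 : T (∑ i, c i • m i) = 0 := by
    have : Submodule.span ℂ (Set.range fun i => (bk i : F)) ≤ LinearMap.ker T :=
      Submodule.span_le.2 (by rintro _ ⟨i, rfl⟩; exact (bk i).2)
    exact this hx
  rw [map_sum] at h0
  simp only [map_smul] at h0
  have := Fintype.linearIndependent_iff.1 hTm c h0
  simp [this]

/-- Cramer's rule for the kernel of `T`, given a family `m` and linear forms `l` such that the
matrix `l j (T (m i))` has a nonzero determinant of maximal size. -/
theorem cramer_kernel {F G : Type*} [AddCommGroup F] [Module ℂ F] [FiniteDimensional ℂ F]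
    [AddCommGroup G] [Module ℂ G] (T : F →ₗ[ℂ] G) {r : ℕ}
    {k : Fin (finrank ℂ F - r) → F} {m : Fin r → F} (hkm : LinearIndependent ℂ (Sum.elim k m))
    (l : Fin r → G →ₗ[ℂ] ℂ) (hrank : finrank ℂ (LinearMap.range T) ≤ r)
    (hd : (Matrix.of fun i j => l j (T (m i))).det ≠ 0) :
    let M : Matrix (Fin r) (Fin r) ℂ := Matrix.of fun i j => l j (T (m i))
    let k' : Fin (finrank ℂ F - r) → F := fun i =>
      M.det • k i - ∑ j, (∑ a, l a (T (k i)) * M.adjugate a j) • m j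
    finrank ℂ (LinearMap.range T) = r ∧ LinearIndependent ℂ k' ∧
      Submodule.span ℂ (Set.range k') = LinearMap.ker T ∧
      LinearIndependent ℂ (fun i => T (m i)) ∧
      Submodule.span ℂ (Set.range fun i => T (m i)) = LinearMap.range T := by
  intro M k'
  have hTm : LinearIndependent ℂ fun i => T (m i) := linearIndependent_of_det_ne_zero hd
  have hle : Submodule.span ℂ (Set.range fun i => T (m i)) ≤ LinearMap.range T :=
    Submodule.span_le.2 (by rintro _ ⟨i, rfl⟩; exact ⟨m i, rfl⟩)
  have hsp : Submodule.span ℂ (Set.range fun i => T (m i)) = LinearMap.range T :=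
    Submodule.eq_of_le_of_finrank_le hle (by rwa [finrank_span_eq_card hTm, Fintype.card_fin])
  have hr : finrank ℂ (LinearMap.range T) = r := by
    rw [← hsp, finrank_span_eq_card hTm, Fintype.card_fin]
  -- Modulo the span of `m`, each `k' i` is the nonzero multiple `M.det • k i`.
  have hk' : LinearIndependent ℂ k' := by
    rw [Fintype.linearIndependent_iff]
    intro c hc
    rw [Fintype.linearIndependent_iff] at hkm
    have h1 := hkm (Sum.elim (fun i => c i * M.det) fun j =>
      -∑ i, c i * ∑ a, l a (T (k i)) * M.adjugate a j) (by
        rw [Fintype.sum_sum_type]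
        simp only [Sum.elim_inl, Sum.elim_inr, neg_smul, Finset.sum_neg_distrib, Finset.sum_smul]
        rw [← hc, Finset.sum_comm (f := fun j i => (c i * ∑ a, l a (T (k i)) * M.adjugate a j) •
          m j), ← sub_eq_add_neg, ← Finset.sum_sub_distrib]
        refine Finset.sum_congr rfl fun i _ => ?_
        simp only [k', smul_sub, mul_smul, Finset.smul_sum])
    intro i
    have := h1 (Sum.inl i)
    simp only [Sum.elim_inl, mul_eq_zero] at this
    exact this.resolve_right hd
  -- The identity `adj M * M = det M` makes every `l a` vanish on `T (k' i)`. This vector lies in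
  -- the span of the `T (m j)`, where the forms `l` separate points because `M` is invertible.
  have hker : ∀ i, k' i ∈ LinearMap.ker T := by
    intro i
    have hmem : T (k' i) ∈ Submodule.span ℂ (Set.range fun i => T (m i)) := by
      rw [hsp]; exact ⟨_, rfl⟩
    obtain ⟨c, hc⟩ := (Submodule.mem_span_range_iff_exists_fun ℂ).1 hmem
    have h0 : ∀ a, l a (T (k' i)) = 0 := fun a => by
      have h2 := fun b => congrFun (congrFun (Matrix.adjugate_mul M) b) a
      simp only [Matrix.mul_apply, Matrix.smul_apply, smul_eq_mul] at h2
      simp only [k', map_sub, map_smul, map_sum, smul_eq_mul, Finset.sum_mul]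
      rw [Finset.sum_comm]
      have h3 : ∀ b, ∑ j, l b (T (k i)) * M.adjugate b j * l a (T (m j)) =
          l b (T (k i)) * (M.det * (1 : Matrix (Fin r) (Fin r) ℂ) b a) := fun b => by
        rw [← h2 b, Finset.mul_sum]
        exact Finset.sum_congr rfl fun j _ => by rw [mul_assoc]; rfl
      simp only [h3, Matrix.one_apply]
      simp [mul_comm]
    have h4 : Matrix.vecMul c M = 0 := by
      ext a
      have := h0 a
      rw [← hc] at this
      simpa [Matrix.vecMul, dotProduct, M] using this
    have h5 := Matrix.eq_zero_of_vecMul_eq_zero hd h4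
    rw [LinearMap.mem_ker, ← hc, h5]
    simp
  refine ⟨hr, hk', ?_, hTm, hsp⟩
  refine Submodule.eq_of_le_of_finrank_le
    (Submodule.span_le.2 (by rintro _ ⟨i, rfl⟩; exact hker i)) ?_
  have := LinearMap.finrank_range_add_finrank_ker T
  rw [finrank_span_eq_card hk', Fintype.card_fin]
  omega

/-- The rank is maximal wherever a maximal minor is nonzero, and by the identity theorem such a
minor vanishes near `x₀` at most at `x₀` itself. Cramer's rule with that minor yields kernel vectors
depending holomorphically on the point. -/
theorem exists_local_kernel_image {A : X → F →ₗ[ℂ] G} {x₀ : X} (hA : ∀ v, HolAt (fun x => A x v) x₀) :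
    ∃ r, r ≤ finrank ℂ F ∧ finrank ℂ (LinearMap.range (A x₀)) ≤ r ∧
      ∃ (k : Fin (finrank ℂ F - r) → X → F) (m : Fin r → F), (∀ i, HolAt (k i) x₀) ∧
        ∀ᶠ x in 𝓝[≠] x₀, finrank ℂ (LinearMap.range (A x)) = r ∧
          LinearIndependent ℂ (fun i => k i x) ∧
          Submodule.span ℂ (Set.range fun i => k i x) = LinearMap.ker (A x) ∧
          LinearIndependent ℂ (fun i => A x (m i)) ∧
          Submodule.span ℂ (Set.range fun i => A x (m i)) = LinearMap.range (A x) := by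
  let b := finBasis ℂ F
  have hall : ∀ᶠ x in 𝓝 x₀, ∀ i, HolAt (fun y => A y (b i)) x :=
    Filter.eventually_all.2 fun i => (hA (b i)).eventually
  obtain ⟨U, hUS, hU, hid⟩ := exists_identity_nhd x₀ hall
  have hAU : ∀ x ∈ U, ∀ v, HolAt (fun y => A y v) x := fun x hx v => by
    have h1 : (fun y => A y v) = fun y => ∑ i, b.repr v i • A y (b i) := by
      ext y
      conv_lhs => rw [← b.sum_repr v]
      rw [map_sum]
      simp only [map_smul]
    rw [h1]
    exact contMDiffAt_finsetSum fun i _ => HolAt.smul contMDiffAt_const (hUS hx i)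
  have hbdd : BddAbove ((fun x => finrank ℂ (LinearMap.range (A x))) '' U) :=
    ⟨finrank ℂ F, by rintro _ ⟨x, _, rfl⟩; exact LinearMap.finrank_range_le _⟩
  -- The point `y` realizes the maximal rank on `U`. It need not be `x₀`, where the rank may drop.
  obtain ⟨y, hyU, hy⟩ := Nat.sSup_mem (Set.Nonempty.image _ ⟨x₀, mem_of_mem_nhds hU⟩) hbdd
  have hmax : ∀ x ∈ U, finrank ℂ (LinearMap.range (A x)) ≤ finrank ℂ (LinearMap.range (A y)) :=
    fun x hx => by
      simp only at hy
      rw [hy]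
      exact le_csSup hbdd ⟨x, hx, rfl⟩
  obtain ⟨k, m, hkm, -, hm⟩ := exists_adapted_basis (A y)
  obtain ⟨l, hl⟩ := exists_dual_family hm
  have hMh : ∀ x ∈ U, ∀ i j, HolAt (fun y => l j (A y (m i))) x := fun x hx i j =>
    (hAU x hx (m i)).linear (l j)
  have hd := hid (fun x => (Matrix.of fun i j => l j (A x (m i))).det)
    (fun x hx => HolAt.det (hMh x hx))
    ⟨y, hyU, by
      have : (Matrix.of fun i j => l j (A y (m i))) = 1 := by ext i j; exact hl i j
      rw [this]; simp⟩
  have hx₀ := mem_of_mem_nhds hU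
  refine ⟨_, LinearMap.finrank_range_le (A y), hmax x₀ hx₀, fun i x =>
    (Matrix.of fun i j => l j (A x (m i))).det • k i -
      ∑ j, (∑ a, l a (A x (k i)) * (Matrix.of fun i j => l j (A x (m i))).adjugate a j) • m j, m,
    fun i => ?_, ?_⟩
  · refine ContMDiffAt.sub (HolAt.smul (HolAt.det (hMh x₀ hx₀)) contMDiffAt_const) ?_
    refine contMDiffAt_finsetSum fun j _ => HolAt.smul ?_ contMDiffAt_const
    refine contMDiffAt_finsetSum fun a _ => HolAt.mul ((hAU x₀ hx₀ (k i)).linear (l a)) ?_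
    simp only [Matrix.adjugate_apply]
    refine HolAt.det fun i' j' => ?_
    by_cases h : i' = j
    · subst h; simpa using contMDiffAt_const
    · simpa [h] using hMh x₀ hx₀ i' j'
  · filter_upwards [hd, nhdsWithin_le_nhds hU] with x hx hxU
    exact cramer_kernel (A x) hkm l (hmax x hxU) hx

end KernelImage

/-! ### Holomorphic sections -/

section Sections

variable {X : Type*} [TopologicalSpace X] [ChartedSpace ℂ X]
variable (F : Type*) [NormedAddCommGroup F] [NormedSpace ℂ F]
variable {V : X → Type*} [TopologicalSpace (TotalSpace F V)]
  [∀ x, AddCommGroup (V x)] [∀ x, Module ℂ (V x)] [∀ x, TopologicalSpace (V x)]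
  [FiberBundle F V]

/-- Sections of `V` which are holomorphic near a point. -/
def SecHolAt (s : ∀ x, V x) (x : X) : Prop :=
  ContMDiffAt 𝓘(ℂ) (𝓘(ℂ).prod 𝓘(ℂ, F)) ω (fun y => TotalSpace.mk' F y (s y)) x

variable [VectorBundle ℂ F V]

/-- Coordinates of a vector of `V x` in the preferred trivialization at `x₀`. -/
abbrev coord (x₀ x : X) : V x →ₗ[ℂ] F := (trivializationAt F V x₀).linearMapAt ℂ x

variable (V) in
/-- The vector with given coordinates in the preferred trivialization at `x₀`. -/
abbrev ofCoord (x₀ x : X) : F →L[ℂ] V x := (trivializationAt F V x₀).symmL ℂ x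

variable {F}

theorem mem_baseSet_nhds (x₀ : X) : (trivializationAt F V x₀).baseSet ∈ 𝓝 x₀ :=
  (trivializationAt F V x₀).open_baseSet.mem_nhds (FiberBundle.mem_baseSet_trivializationAt' x₀)

theorem ofCoord_coord {x₀ x : X} (hx : x ∈ (trivializationAt F V x₀).baseSet) (v : V x) :
    ofCoord F V x₀ x (coord F x₀ x v) = v :=
  (trivializationAt F V x₀).symmL_continuousLinearMapAt (R := ℂ) hx v

theorem coord_ofCoord {x₀ x : X} (hx : x ∈ (trivializationAt F V x₀).baseSet) (w : F) :
    coord F x₀ x (ofCoord F V x₀ x w) = w :=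
  (trivializationAt F V x₀).continuousLinearMapAt_symmL (R := ℂ) hx w

theorem ker_coord {x₀ x : X} (hx : x ∈ (trivializationAt F V x₀).baseSet) :
    LinearMap.ker (coord (V := V) F x₀ x) = ⊥ :=
  LinearMap.ker_eq_bot.2 (Function.LeftInverse.injective (ofCoord_coord hx))

theorem linearIndependent_coord_iff {ι : Type*} {x₀ x : X}
    (hx : x ∈ (trivializationAt F V x₀).baseSet) {s : ι → V x} :
    LinearIndependent ℂ (fun i => coord F x₀ x (s i)) ↔ LinearIndependent ℂ s :=
  LinearMap.linearIndependent_iff _ (ker_coord hx)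

theorem coord_mem_span_iff {ι : Type*} {x₀ x : X}
    (hx : x ∈ (trivializationAt F V x₀).baseSet) {s : ι → V x} {v : V x} :
    coord F x₀ x v ∈ Submodule.span ℂ (Set.range fun i => coord F x₀ x (s i)) ↔
      v ∈ Submodule.span ℂ (Set.range s) := by
  have : (Set.range fun i => coord F x₀ x (s i)) = coord F x₀ x '' Set.range s := by
    rw [← Set.range_comp]; rfl
  rw [this, Submodule.span_image, Submodule.mem_map]
  refine ⟨?_, fun h => ⟨v, h, rfl⟩⟩
  rintro ⟨w, hw, h⟩
  rwa [← LinearMap.ker_eq_bot.1 (ker_coord hx) h]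

theorem linearIndependent_ofCoord {ι : Type*} {x₀ x : X}
    (hx : x ∈ (trivializationAt F V x₀).baseSet) {s : ι → F} :
    LinearIndependent ℂ (fun i => ofCoord F V x₀ x (s i)) ↔ LinearIndependent ℂ s := by
  rw [← linearIndependent_coord_iff hx]
  simp only [coord_ofCoord hx]

theorem finrank_fiber (x : X) : finrank ℂ (V x) = finrank ℂ F :=
  ((trivializationAt F V x).linearEquivAt ℂ x
    (FiberBundle.mem_baseSet_trivializationAt' x)).finrank_eq

theorem finiteDimensional_fiber [FiniteDimensional ℂ F] (x : X) : FiniteDimensional ℂ (V x) :=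
  ((trivializationAt F V x).linearEquivAt ℂ x
    (FiberBundle.mem_baseSet_trivializationAt' x)).symm.finiteDimensional

variable [ContMDiffVectorBundle ω F V 𝓘(ℂ)]

theorem secHolAt_iff {s : ∀ x, V x} {x₀ x : X} (hx : x ∈ (trivializationAt F V x₀).baseSet) :
    SecHolAt F s x ↔ HolAt (fun y => coord F x₀ y (s y)) x := by
  rw [SecHolAt]
  refine ((trivializationAt F V x₀).contMDiffAt_section_iff hx).trans
    (Filter.EventuallyEq.contMDiffAt_iff ?_)
  filter_upwards [(trivializationAt F V x₀).open_baseSet.mem_nhds hx] with y hy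
  rw [coord, Trivialization.coe_linearMapAt_of_mem _ hy]

theorem secHolAt_ofCoord {f : X → F} {x₀ x : X} (hx : x ∈ (trivializationAt F V x₀).baseSet)
    (hf : HolAt f x) : SecHolAt F (fun y => ofCoord F V x₀ y (f y)) x := by
  rw [secHolAt_iff hx]
  refine hf.congr_of_eventuallyEq ?_
  filter_upwards [(trivializationAt F V x₀).open_baseSet.mem_nhds hx] with y hy
  exact coord_ofCoord hy _

theorem SecHolAt.coord {s : ∀ x, V x} {x : X} (hs : SecHolAt F s x) :
    HolAt (fun y => UpqHiggs.coord F x y (s y)) x :=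
  (secHolAt_iff (FiberBundle.mem_baseSet_trivializationAt' x)).1 hs

variable [IsManifold 𝓘(ℂ) ω X]

theorem SecHolAt.eventually {s : ∀ x, V x} {x : X} (hs : SecHolAt F s x) :
    ∀ᶠ y in 𝓝 x, SecHolAt F s y := by
  filter_upwards [hs.coord.eventually, mem_baseSet_nhds (F := F) (V := V) x] with y hy hy'
  exact (secHolAt_iff hy').2 hy

variable [FiniteDimensional ℂ F]

theorem SecHolAt.eventually_linearIndependent {ι : Type*} [Finite ι]
    {t : ι → ∀ x, V x} {x₀ : X} (ht : ∀ i, SecHolAt F (t i) x₀)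
    (h0 : LinearIndependent ℂ fun i => t i x₀) :
    ∀ᶠ x in 𝓝 x₀, LinearIndependent ℂ fun i => t i x := by
  filter_upwards [HolAt.eventually_linearIndependent (fun i => (ht i).coord)
    ((linearIndependent_coord_iff (mem_of_mem_nhds (mem_baseSet_nhds x₀))).2 h0),
    mem_baseSet_nhds (F := F) (V := V) x₀] with x hx hx'
  exact (linearIndependent_coord_iff hx').1 hx

theorem SecHolAt.mem_span_of_eventually {ι : Type*} [Finite ι]
    {t : ι → ∀ x, V x} {s : ∀ x, V x} {x₀ : X} (ht : ∀ i, SecHolAt F (t i) x₀)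
    (h0 : LinearIndependent ℂ fun i => t i x₀) (hs : SecHolAt F s x₀)
    (h : ∀ᶠ x in 𝓝[≠] x₀, s x ∈ Submodule.span ℂ (Set.range fun i => t i x)) :
    s x₀ ∈ Submodule.span ℂ (Set.range fun i => t i x₀) := by
  have hx₀ := mem_of_mem_nhds (mem_baseSet_nhds (F := F) (V := V) x₀)
  rw [← coord_mem_span_iff hx₀]
  refine UpqHiggs.mem_span_of_eventually (t := fun i y => UpqHiggs.coord F x₀ y (t i y))
    (s := fun y => UpqHiggs.coord F x₀ y (s y)) (fun i => (ht i).coord)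
    ((linearIndependent_coord_iff hx₀).2 h0) hs.coord ?_
  filter_upwards [h, nhdsWithin_le_nhds (mem_baseSet_nhds (F := F) (V := V) x₀)] with x hx hx'
  exact (coord_mem_span_iff hx').2 hx

theorem SecHolAt.exists_hol_det {ι : Type*} [Fintype ι] [DecidableEq ι]
    {s t : ι → ∀ x, V x} {x₀ : X} (hs : ∀ i, SecHolAt F (s i) x₀) (ht : ∀ i, SecHolAt F (t i) x₀)
    (h0 : LinearIndependent ℂ fun i => t i x₀)
    (h : ∀ᶠ x in 𝓝 x₀, ∀ i, s i x ∈ Submodule.span ℂ (Set.range fun i => t i x)) :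
    ∃ a : X → ℂ, HolAt a x₀ ∧ ∀ᶠ x in 𝓝 x₀, ∃ P : Matrix ι ι ℂ,
      (∀ i, s i x = ∑ j, P i j • t j x) ∧ P.det = a x := by
  have hx₀ := mem_of_mem_nhds (mem_baseSet_nhds (F := F) (V := V) x₀)
  obtain ⟨a, ha, hP⟩ := UpqHiggs.exists_hol_det (fun i => (hs i).coord) (fun i => (ht i).coord)
    ((linearIndependent_coord_iff hx₀).2 h0) (by
      filter_upwards [h, mem_baseSet_nhds (F := F) (V := V) x₀] with x hx hx' i
      exact (coord_mem_span_iff hx').2 (hx i))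
  refine ⟨a, ha, ?_⟩
  filter_upwards [hP, mem_baseSet_nhds (F := F) (V := V) x₀] with x ⟨P, hP, hPa⟩ hx
  refine ⟨P, fun i => LinearMap.ker_eq_bot.1 (ker_coord hx) ?_, hPa⟩
  rw [hP]
  simp only [map_sum, map_smul]

theorem SecHolAt.exists_saturation {r : ℕ} {f : Fin r → ∀ x, V x} {x₀ : X}
    (hf : ∀ i, SecHolAt F (f i) x₀)
    (h : ∀ᶠ x in 𝓝[≠] x₀, LinearIndependent ℂ fun i => f i x) :
    ∃ t : Fin r → ∀ x, V x, (∀ i, SecHolAt F (t i) x₀) ∧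
      LinearIndependent ℂ (fun i => t i x₀) ∧
      ∀ᶠ x in 𝓝[≠] x₀, Submodule.span ℂ (Set.range fun i => f i x) =
        Submodule.span ℂ (Set.range fun i => t i x) := by
  have hx₀ := mem_of_mem_nhds (mem_baseSet_nhds (F := F) (V := V) x₀)
  have hb := nhdsWithin_le_nhds (s := {x₀}ᶜ) (mem_baseSet_nhds (F := F) (V := V) x₀)
  have hi : ∀ᶠ x in 𝓝[≠] x₀, LinearIndependent ℂ fun i => UpqHiggs.coord F x₀ x (f i x) := by
    filter_upwards [h, hb] with x hx hx'
    exact (linearIndependent_coord_iff hx').2 hx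
  obtain ⟨t, ht, hti, hsp⟩ := HolAt.exists_saturation (fun i => (hf i).coord) hi
  refine ⟨fun i x => ofCoord F V x₀ x (t i x), fun i => secHolAt_ofCoord hx₀ (ht i),
    (linearIndependent_ofCoord hx₀).2 hti, ?_⟩
  filter_upwards [h, hsp, hb] with x hx hx' hxb
  refine span_eq_of_linearIndependent hx fun i => ?_
  rw [← coord_mem_span_iff hxb]
  simp only [coord_ofCoord hxb]
  rw [← hx']
  exact Submodule.subset_span ⟨i, rfl⟩

/-- The family `K` may jump at isolated points. The fibre at `x` is redefined as the set of values
at `x` of holomorphic sections lying in `K` on a punctured neighbourhood; this involves no choice of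
frame, so the saturated local frames all span the same object. -/
theorem exists_subbundle [T2Space X] {r : ℕ} (K : ∀ x, Submodule ℂ (V x))
    (hK : ∀ x₀ : X, ∃ f : Fin r → ∀ x, V x, (∀ i, SecHolAt F (f i) x₀) ∧
      ∀ᶠ x in 𝓝[≠] x₀, LinearIndependent ℂ (fun i => f i x) ∧
        Submodule.span ℂ (Set.range fun i => f i x) = K x) :
    ∃ S : HolomorphicSubbundle F V, S.rank = r ∧
      (∀ x v, v ∈ S.fiber x ↔
        ∃ s : ∀ x, V x, SecHolAt F s x ∧ s x = v ∧ ∀ᶠ y in 𝓝[≠] x, s y ∈ K y) ∧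
      ∀ x₀, ∀ᶠ x in 𝓝[≠] x₀, K x ≤ S.fiber x := by
  have hmem : ∀ x, x ∈ (trivializationAt F V x).baseSet := fun x =>
    mem_of_mem_nhds (mem_baseSet_nhds (F := F) (V := V) x)
  let fib : ∀ x, Submodule ℂ (V x) := fun x =>
    { carrier := {v | ∃ s : ∀ x, V x, SecHolAt F s x ∧ s x = v ∧ ∀ᶠ y in 𝓝[≠] x, s y ∈ K y}
      add_mem' := by
        rintro _ _ ⟨s, hs, rfl, hsK⟩ ⟨t, ht, rfl, htK⟩
        refine ⟨fun y => s y + t y, (secHolAt_iff (hmem x)).2 ?_, rfl, ?_⟩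
        · have := hs.coord.add ht.coord
          simp only [map_add]
          exact this
        · filter_upwards [hsK, htK] with y h1 h2 using add_mem h1 h2
      zero_mem' := by
        refine ⟨fun y => 0, (secHolAt_iff (hmem x)).2 ?_, rfl, ?_⟩
        · simpa only [map_zero] using contMDiffAt_const
        · exact Filter.Eventually.of_forall fun y => zero_mem _
      smul_mem' := by
        rintro c _ ⟨s, hs, rfl, hsK⟩
        refine ⟨fun y => c • s y, (secHolAt_iff (hmem x)).2 ?_, rfl, ?_⟩
        · simpa only [map_smul] using HolAt.smul (contMDiffAt_const (c := c)) hs.coord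
        · filter_upwards [hsK] with y h1 using Submodule.smul_mem _ c h1 }
  refine ⟨⟨r, fib, fun x₀ => ?_⟩, rfl, fun x v => Iff.rfl, fun x₀ => ?_⟩
  swap
  · obtain ⟨f, hf, hfK⟩ := hK x₀
    have hfh : ∀ᶠ x in 𝓝 x₀, ∀ i, SecHolAt F (f i) x :=
      Filter.eventually_all.2 fun i => (hf i).eventually
    filter_upwards [nhdsWithin_le_nhds hfh, eventually_eventually_nhdsWithin.2 hfK, hfK,
      self_mem_nhdsWithin] with x hx hxK hx' hne
    rw [← hx'.2]
    refine Submodule.span_le.2 ?_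
    rintro _ ⟨i, rfl⟩
    refine ⟨f i, hx i, rfl, ?_⟩
    rw [isOpen_compl_singleton.nhdsWithin_eq hne] at hxK
    filter_upwards [nhdsWithin_le_nhds hxK] with y hy
    rw [← hy.2]
    exact Submodule.subset_span ⟨i, rfl⟩
  obtain ⟨f, hf, hfK⟩ := hK x₀
  obtain ⟨t, ht, hti, htf⟩ := SecHolAt.exists_saturation hf (hfK.mono fun x hx => hx.1)
  have htK : ∀ᶠ x in 𝓝[≠] x₀, K x = Submodule.span ℂ (Set.range fun i => t i x) := by
    filter_upwards [hfK, htf] with x hx hx'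
    rw [← hx.2, hx']
  rw [eventually_nhdsWithin_iff] at htK
  have hall : ∀ᶠ x in 𝓝 x₀, ((∀ i, SecHolAt F (t i) x) ∧ LinearIndependent ℂ fun i => t i x) ∧
      (x ∈ ({x₀}ᶜ : Set X) → K x = Submodule.span ℂ (Set.range fun i => t i x)) :=
    ((Filter.eventually_all.2 fun i => (ht i).eventually).and
      (SecHolAt.eventually_linearIndependent ht hti)).and htK
  obtain ⟨O, hO, hOo, hx₀⟩ := eventually_nhds_iff.1 hall
  refine ⟨t, O, hOo, hx₀, fun i y hy => ((hO y hy).1.1 i).contMDiffWithinAt,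
    fun y hy => ⟨(hO y hy).1.2, ?_⟩⟩
  -- The frame `t` spans `K` off `x₀`, hence on a punctured neighbourhood of every `y ∈ O`,
  -- including `y = x₀`.
  have hev : ∀ᶠ x in 𝓝[≠] y, K x = Submodule.span ℂ (Set.range fun i => t i x) := by
    by_cases h : y = x₀
    · subst h
      filter_upwards [nhdsWithin_le_nhds (hOo.mem_nhds hy), self_mem_nhdsWithin] with x hx hx'
      exact (hO x hx).2 hx'
    · filter_upwards [nhdsWithin_le_nhds (hOo.mem_nhds hy),
        nhdsWithin_le_nhds (isOpen_compl_singleton.mem_nhds h)] with x hx hx'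
      exact (hO x hx).2 hx'
  refine le_antisymm (Submodule.span_le.2 ?_) ?_
  · rintro _ ⟨i, rfl⟩
    refine ⟨t i, (hO y hy).1.1 i, rfl, ?_⟩
    filter_upwards [hev] with x hx
    rw [hx]
    exact Submodule.subset_span ⟨i, rfl⟩
  · rintro _ ⟨s, hs, rfl, hsK⟩
    refine SecHolAt.mem_span_of_eventually (hO y hy).1.1 (hO y hy).1.2 hs ?_
    filter_upwards [hsK, hev] with x hx hx'
    rwa [← hx']

end Sections

/-! ### Gram determinants -/

section Gram

open scoped ComplexOrder

variable {ι E : Type*} [Fintype ι] [DecidableEq ι] [AddCommGroup E] [Module ℂ E]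

/-- The Gram determinant of a family of vectors with respect to a sesquilinear form. -/
def gram (h : E →ₗ⋆[ℂ] E →ₗ[ℂ] ℂ) (s : ι → E) : ℂ := (Matrix.of fun i j => h (s i) (s j)).det

/-- The Gram matrix transforms as `P̄ G Pᵀ`. For holomorphic `P` the logarithm of its determinant
thus changes by `2 log ‖det P‖`, which is harmonic where `det P ≠ 0`. -/
theorem gram_eq_of_eq_sum (h : E →ₗ⋆[ℂ] E →ₗ[ℂ] ℂ) {s t : ι → E} {P : Matrix ι ι ℂ}
    (hP : ∀ i, s i = ∑ j, P i j • t j) : gram h s = (‖P.det‖ ^ 2 : ℝ) * gram h t := by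
  have h1 : (Matrix.of fun i j => h (s i) (s j)) =
      (starRingEnd ℂ).mapMatrix P * (Matrix.of fun i j => h (t i) (t j)) * P.transpose := by
    ext i j
    simp only [Matrix.of_apply, hP, map_sum, LinearMap.sum_apply, map_smulₛₗ, LinearMap.smul_apply,
      Matrix.mul_apply, Matrix.transpose_apply, RingHom.mapMatrix_apply, Matrix.map_apply,
      Finset.sum_mul, smul_eq_mul, RingHom.id_apply, Finset.mul_sum]
    exact Finset.sum_congr rfl fun _ _ => Finset.sum_congr rfl fun _ _ => by ring
  rw [gram, gram, h1, Matrix.det_mul, Matrix.det_mul, Matrix.det_transpose, ← RingHom.map_det,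
    ← Complex.normSq_eq_norm_sq, Complex.normSq_eq_conj_mul_self]
  ring

theorem gram_comp_equiv {κ : Type*} [Fintype κ] [DecidableEq κ] (h : E →ₗ⋆[ℂ] E →ₗ[ℂ] ℂ)
    (s : ι → E) (e : κ ≃ ι) : gram h (s ∘ e) = gram h s := by
  rw [gram, gram, ← Matrix.det_submatrix_equiv_self e]
  rfl

theorem gram_pos {h : E →ₗ⋆[ℂ] E →ₗ[ℂ] ℂ} (hsymm : ∀ u v, h v u = starRingEnd ℂ (h u v))
    (hpos : ∀ v, v ≠ 0 → 0 < (h v v).re) {s : ι → E} (hs : LinearIndependent ℂ s) :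
    0 < (gram h s).re := by
  refine (Complex.pos_iff.1 ?_).1
  refine Matrix.PosDef.det_pos ?_
  rw [Matrix.posDef_iff_dotProduct_mulVec]
  refine ⟨by ext i j; simp [Matrix.conjTranspose_apply, hsymm (s i) (s j)], fun x hx => ?_⟩
  have h1 : star x ⬝ᵥ (Matrix.of fun i j => h (s i) (s j)).mulVec x =
      h (∑ i, x i • s i) (∑ i, x i • s i) := by
    simp only [dotProduct, Matrix.mulVec, map_sum, LinearMap.sum_apply, map_smulₛₗ,
      LinearMap.smul_apply, RingHom.id_apply, smul_eq_mul, Finset.mul_sum, Matrix.of_apply,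
      Pi.star_apply]
    rw [Finset.sum_comm]
    exact Finset.sum_congr rfl fun _ _ => Finset.sum_congr rfl fun _ _ => by
      simp only [RCLike.star_def]; ring
  rw [h1]
  set v := ∑ i, x i • s i with hv
  have hv0 : v ≠ 0 := fun h0 => hx (funext (Fintype.linearIndependent_iff.1 hs x h0))
  rw [Complex.pos_iff]
  refine ⟨hpos v hv0, ?_⟩
  have := congrArg Complex.im (hsymm v v)
  simp only [Complex.conj_im] at this
  linarith

end Gram

/-! ### Regularity of Gram determinants and of Chern densities -/

section HermitianGram

variable {X : Type*} [TopologicalSpace X] [ChartedSpace ℂ X]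
variable {F : Type*} [NormedAddCommGroup F] [NormedSpace ℂ F]
variable {V : X → Type*} [TopologicalSpace (TotalSpace F V)]
  [∀ x, AddCommGroup (V x)] [∀ x, Module ℂ (V x)] [∀ x, TopologicalSpace (V x)]
  [FiberBundle F V] [VectorBundle ℂ F V]

/-- Twice continuously real differentiable complex functions near a point of a Riemann surface. -/
abbrev CC2At (f : X → ℂ) (x : X) : Prop :=
  ContMDiffAt 𝓘(ℝ, ℂ) 𝓘(ℝ, ℂ) 2 f x

theorem HolAt.cc2At {f : X → ℂ} {x : X} (hf : HolAt f x) : CC2At f x :=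
  (contMDiffAt_real hf).of_le (WithTop.coe_le_coe.2 le_top)

theorem CC2At.re {f : X → ℂ} {x : X} (hf : CC2At f x) : C2At (fun y => (f y).re) x :=
  ContDiffAt.comp_contMDiffAt (g := Complex.re) Complex.reCLM.contDiff.contDiffAt hf

theorem CC2At.conj {f : X → ℂ} {x : X} (hf : CC2At f x) :
    CC2At (fun y => starRingEnd ℂ (f y)) x :=
  ContDiffAt.comp_contMDiffAt (g := starRingEnd ℂ) Complex.conjCLE.contDiff.contDiffAt hf

theorem CC2At.mul {f g : X → ℂ} {x : X} (hf : CC2At f x) (hg : CC2At g x) :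
    CC2At (fun y => f y * g y) x :=
  ((contDiff_mul (𝕜 := ℝ) (𝔸 := ℂ)).contMDiff (x := (f x, g x))).comp x (hf.prodMk_space hg)

theorem CC2At.det {ι : Type*} [Fintype ι] [DecidableEq ι] {M : X → Matrix ι ι ℂ} {x : X}
    (hM : ∀ i j, CC2At (fun y => M y i j) x) : CC2At (fun y => (M y).det) x := by
  have h1 : ContDiff ℝ 2 fun N : ι → ι → ℂ => (Matrix.of N).det := by
    simp only [Matrix.det_apply]
    refine ContDiff.sum fun σ _ => ContDiff.const_smul _ (contDiff_prod fun i _ => ?_)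
    exact contDiff_apply_apply ℝ ℂ (σ i) i
  have h2 : ContMDiffAt (M' := ι → ι → ℂ) 𝓘(ℝ, ℂ) 𝓘(ℝ, ι → ι → ℂ) 2 (fun y => M y) x :=
    contMDiffAt_pi_space.2 fun i => contMDiffAt_pi_space.2 fun j => hM i j
  exact ContDiffAt.comp_contMDiffAt (F := ι → ι → ℂ) (f := fun y => M y)
    (g := fun N => (Matrix.of N).det) h1.contDiffAt h2

variable [FiniteDimensional ℂ F] [IsManifold 𝓘(ℂ) ω X] [ContMDiffVectorBundle ω F V 𝓘(ℂ)]

/-- Smoothness of the metric is given on vectors with constant coordinates; general sections are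
expanded in such vectors with holomorphic coefficients. -/
theorem HermitianMetric.cc2At_inner (H : HermitianMetric F V) {s t : ∀ x, V x} {x₀ : X}
    (hs : SecHolAt F s x₀) (ht : SecHolAt F t x₀) :
    CC2At (fun x => H.inner x (s x) (t x)) x₀ := by
  let b := finBasis ℂ F
  have h1 : (fun x => H.inner x (s x) (t x)) =ᶠ[𝓝 x₀] fun x => ∑ i, ∑ j,
      starRingEnd ℂ (b.repr (coord F x₀ x (s x)) i) * (b.repr (coord F x₀ x (t x)) j *
        H.inner x (ofCoord F V x₀ x (b i)) (ofCoord F V x₀ x (b j))) := by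
    filter_upwards [mem_baseSet_nhds (F := F) (V := V) x₀] with x hx
    have key : ∀ v : V x, v = ∑ i, b.repr (coord F x₀ x v) i • ofCoord F V x₀ x (b i) := fun v => by
      conv_lhs => rw [← ofCoord_coord hx v, ← b.sum_repr (coord F x₀ x v)]
      rw [map_sum]
      simp only [map_smul]
    conv_lhs => rw [key (s x), key (t x)]
    simp only [map_sum, LinearMap.sum_apply, map_smulₛₗ, LinearMap.smul_apply, RingHom.id_apply,
      smul_eq_mul, Finset.mul_sum]
    rw [Finset.sum_comm]
    exact Finset.sum_congr rfl fun _ _ => Finset.sum_congr rfl fun _ _ => by ring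
  refine ContMDiffAt.congr_of_eventuallyEq ?_ h1
  have hc : ∀ {s : ∀ x, V x}, SecHolAt F s x₀ → ∀ i,
      CC2At (fun x => b.repr (coord F x₀ x (s x)) i) x₀ := fun hs i =>
    (hs.coord.linear (b.coord i)).cc2At
  exact contMDiffAt_finsetSum fun i _ => contMDiffAt_finsetSum fun j _ =>
    (hc hs i).conj.mul ((hc ht j).mul
      ((H.smooth x₀ (b i) (b j)).of_le (WithTop.coe_le_coe.2 le_top)))

theorem HermitianMetric.c2At_gram (H : HermitianMetric F V) {ι : Type*} [Fintype ι] [DecidableEq ι]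
    {s : ι → ∀ x, V x} {x₀ : X} (hs : ∀ i, SecHolAt F (s i) x₀) :
    C2At (fun x => (gram (H.inner x) fun i => s i x).re) x₀ :=
  CC2At.re (CC2At.det fun i j => H.cc2At_inner (hs i) (hs j))

theorem HermitianMetric.gram_pos (H : HermitianMetric F V) {ι : Type*} [Fintype ι] [DecidableEq ι]
    {x : X} {s : ι → V x} (hs : LinearIndependent ℂ s) : 0 < (gram (H.inner x) s).re :=
  UpqHiggs.gram_pos (H.conj_symm x) (H.pos x) hs

namespace HolomorphicSubbundle

variable (S : HolomorphicSubbundle F V)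

theorem frame_spec (x₀ : X) : ∀ᶠ x in 𝓝 x₀, (∀ i, SecHolAt F (S.frame x₀ i) x) ∧
    LinearIndependent ℂ (fun i => S.frame x₀ i x) ∧
    Submodule.span ℂ (Set.range fun i => S.frame x₀ i x) = S.fiber x := by
  obtain ⟨U, hU, hx₀, h1, h2⟩ := (S.exists_frame x₀).choose_spec
  filter_upwards [hU.mem_nhds hx₀] with x hx
  exact ⟨fun i => (h1 i).contMDiffAt (hU.mem_nhds hx), h2 x hx⟩

theorem finrank_fiber (x : X) : finrank ℂ (S.fiber x) = S.rank := by
  obtain ⟨-, h1, h2⟩ := (S.frame_spec x).self_of_nhds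
  rw [← h2, finrank_span_eq_card h1, Fintype.card_fin]

theorem logGram_eq (H : HermitianMetric F V) (x₀ x : X) :
    S.logGram H x₀ x = Real.log (gram (H.inner x) fun i => S.frame x₀ i x).re := rfl

theorem c2At_logGram (H : HermitianMetric F V) (x₀ : X) :
    ∀ᶠ x in 𝓝 x₀, C2At (S.logGram H x₀) x := by
  filter_upwards [S.frame_spec x₀] with x ⟨h1, h2, _⟩
  exact (H.c2At_gram h1).log (H.gram_pos h2).ne'

theorem frame_change (H : HermitianMetric F V) (x₀ : X) : ∀ᶠ x in 𝓝 x₀, ∃ a : X → ℂ,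
    HolAt a x ∧ a x ≠ 0 ∧ ∀ᶠ y in 𝓝 x,
      S.logGram H x y = 2 * Real.log ‖a y‖ + S.logGram H x₀ y := by
  filter_upwards [(S.frame_spec x₀).eventually_nhds] with x hx
  have hxx := S.frame_spec x
  obtain ⟨h1, h2, -⟩ := hx.self_of_nhds
  obtain ⟨h1', h2', -⟩ := hxx.self_of_nhds
  obtain ⟨a, ha, hP⟩ := SecHolAt.exists_hol_det h1' h1 h2 (by
    filter_upwards [hx, hxx] with y hy hy' i
    rw [hy.2.2, ← hy'.2.2]
    exact Submodule.subset_span ⟨i, rfl⟩)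
  have hgram : ∀ᶠ y in 𝓝 x, a y ≠ 0 ∧ (gram (H.inner y) fun i => S.frame x i y).re =
      ‖a y‖ ^ 2 * (gram (H.inner y) fun i => S.frame x₀ i y).re := by
    filter_upwards [hP, hxx] with y ⟨P, hP, hPa⟩ hy'
    have h3 : (gram (H.inner y) fun i => S.frame x i y).re =
        ‖a y‖ ^ 2 * (gram (H.inner y) fun i => S.frame x₀ i y).re := by
      rw [gram_eq_of_eq_sum (H.inner y) hP, hPa, Complex.re_ofReal_mul]
    refine ⟨fun h0 => ?_, h3⟩
    have := H.gram_pos hy'.2.1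
    rw [h3, h0] at this
    simp at this
  refine ⟨a, ha, hgram.self_of_nhds.1, ?_⟩
  filter_upwards [hgram, hx] with y hy hy'
  rw [logGram_eq, logGram_eq, hy.2, Real.log_mul (by simpa using hy.1) (H.gram_pos hy'.2.1).ne',
    Real.log_pow]
  norm_num

/-- In `chernDensity` the frame is the one chosen at the evaluation point, so it may jump with `z`.
Near `z₁` it can be replaced by the fixed frame at `z₁`, as the two logarithms differ by the
harmonic function `2 log ‖a‖`; continuity of the density follows. -/
theorem laplacian_logGram_congr (H : HermitianMetric F V) {c : X} {z₁ : ℂ}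
    (hz₁ : z₁ ∈ (chartAt ℂ c).target) : ∀ᶠ z in 𝓝 z₁,
      Laplacian.laplacian (fun w =>
        S.logGram H ((chartAt ℂ c).symm z) ((chartAt ℂ c).symm w)) z =
      Laplacian.laplacian (fun w =>
        S.logGram H ((chartAt ℂ c).symm z₁) ((chartAt ℂ c).symm w)) z := by
  have hcont := (chartAt ℂ c).continuousAt_symm hz₁
  filter_upwards [(chartAt ℂ c).open_target.mem_nhds hz₁,
    hcont.eventually (S.frame_change H ((chartAt ℂ c).symm z₁)),
    hcont.eventually (S.c2At_logGram H ((chartAt ℂ c).symm z₁))] with z hz ⟨a, ha, ha0, hev⟩ hC2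
  have han : AnalyticAt ℂ (fun w => a ((chartAt ℂ c).symm w)) z := HolAt.comp_chart_symm hz ha
  have hh := han.harmonicAt_log_norm ha0
  have h1 : (fun w => S.logGram H ((chartAt ℂ c).symm z) ((chartAt ℂ c).symm w)) =ᶠ[𝓝 z]
      (2 : ℝ) • (fun w => Real.log ‖a ((chartAt ℂ c).symm w)‖) +
        fun w => S.logGram H ((chartAt ℂ c).symm z₁) ((chartAt ℂ c).symm w) := by
    filter_upwards [((chartAt ℂ c).continuousAt_symm hz).eventually hev] with w hw
    simpa using hw
  have h2 : ContDiffAt ℝ 2 ((2 : ℝ) • fun w => Real.log ‖a ((chartAt ℂ c).symm w)‖) z :=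
    hh.1.const_smul (2 : ℝ)
  rw [(InnerProductSpace.laplacian_congr_nhds h1).eq_of_nhds,
    ContDiffAt.laplacian_add h2 (C2At.comp_chart_symm hz hC2),
    InnerProductSpace.laplacian_smul _ hh.1, hh.2.eq_of_nhds]
  simp

theorem continuousOn_chernDensity (H : HermitianMetric F V) (c : X) :
    ContinuousOn (S.chernDensity H c) (chartAt ℂ c).target := by
  intro z₁ hz₁
  refine ContinuousAt.continuousWithinAt (ContinuousAt.mul continuousAt_const ?_)
  have h1 : ContDiffAt ℝ 2 (fun w =>
      S.logGram H ((chartAt ℂ c).symm z₁) ((chartAt ℂ c).symm w)) z₁ :=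
    C2At.comp_chart_symm hz₁ (S.c2At_logGram H _).self_of_nhds
  exact (continuousAt_laplacian h1).congr (by
    filter_upwards [S.laplacian_logGram_congr H hz₁] with z hz using hz.symm)

end HolomorphicSubbundle

end HermitianGram

/-! ### Contraction with a linear form on a line -/

section Contraction

variable {M N : Type*} [AddCommGroup M] [Module ℂ M] [AddCommGroup N] [Module ℂ N]

/-- Contraction of `M ⊗ N` with a linear form on `N`. -/
def contract (l : N →ₗ[ℂ] ℂ) : M ⊗[ℂ] N →ₗ[ℂ] M :=
  (TensorProduct.rid ℂ M).toLinearMap ∘ₗ LinearMap.lTensor M l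

@[simp]
theorem contract_tmul (l : N →ₗ[ℂ] ℂ) (m : M) (n : N) : contract l (m ⊗ₜ n) = l n • m := by
  simp [contract]

theorem eq_smul_of_finrank_one (hN : finrank ℂ N = 1) {l : N →ₗ[ℂ] ℂ} {e : N} (he : l e = 1)
    (n : N) : n = l n • e := by
  have he0 : e ≠ 0 := by rintro rfl; simp at he
  obtain ⟨c, rfl⟩ := (finrank_eq_one_iff_of_nonzero' e he0).1 hN n
  simp [he]

/-- On a line `N`, contraction with `l` is inverted by tensoring with `e`. A map into `M ⊗ N` can
therefore be studied as a map into `M`. -/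
theorem contract_tmul_self (hN : finrank ℂ N = 1) {l : N →ₗ[ℂ] ℂ} {e : N} (he : l e = 1)
    (t : M ⊗[ℂ] N) : contract l t ⊗ₜ e = t := by
  induction t using TensorProduct.induction_on with
  | zero => simp
  | tmul m n =>
    rw [contract_tmul, TensorProduct.smul_tmul, ← eq_smul_of_finrank_one hN he]
  | add s t hs ht => rw [map_add, TensorProduct.add_tmul, hs, ht]

theorem contract_eq_zero_iff (hN : finrank ℂ N = 1) {l : N →ₗ[ℂ] ℂ} {e : N} (he : l e = 1)
    {t : M ⊗[ℂ] N} : contract l t = 0 ↔ t = 0 := by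
  refine ⟨fun h => ?_, fun h => by rw [h, map_zero]⟩
  rw [← contract_tmul_self hN he t, h, TensorProduct.zero_tmul]

theorem contract_mem_iff (hN : finrank ℂ N = 1) {l : N →ₗ[ℂ] ℂ} {e : N} (he : l e = 1)
    {p : Submodule ℂ M} {t : M ⊗[ℂ] N} :
    contract l t ∈ p ↔ t ∈ LinearMap.range (p.subtype.rTensor N) := by
  refine ⟨fun h => ⟨⟨_, h⟩ ⊗ₜ e, ?_⟩, ?_⟩
  · rw [LinearMap.rTensor_tmul, Submodule.subtype_apply, contract_tmul_self hN he]
  · rintro ⟨s, rfl⟩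
    induction s using TensorProduct.induction_on with
    | zero => simp
    | tmul m n => simpa using p.smul_mem (l n) m.2
    | add s t hs ht => simpa only [map_add] using p.add_mem hs ht

theorem contract_eq_smul (hN : finrank ℂ N = 1) {l l' : N →ₗ[ℂ] ℂ} {e : N} (he : l e = 1)
    (t : M ⊗[ℂ] N) : contract l' t = l' e • contract l t := by
  conv_lhs => rw [← contract_tmul_self hN he t]
  rw [contract_tmul]

end Contraction

/-! ### Kernel and image of a twisted homomorphism -/

section Twisted

variable {X : Type*} [TopologicalSpace X] [ChartedSpace ℂ X]
variable {FV : Type*} [NormedAddCommGroup FV] [NormedSpace ℂ FV]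
variable {V : X → Type*} [TopologicalSpace (TotalSpace FV V)]
  [∀ x, AddCommGroup (V x)] [∀ x, Module ℂ (V x)] [∀ x, TopologicalSpace (V x)]
  [FiberBundle FV V] [VectorBundle ℂ FV V]
variable {FW : Type*} [NormedAddCommGroup FW] [NormedSpace ℂ FW]
variable {W : X → Type*} [TopologicalSpace (TotalSpace FW W)]
  [∀ x, AddCommGroup (W x)] [∀ x, Module ℂ (W x)] [∀ x, TopologicalSpace (W x)]
  [FiberBundle FW W] [VectorBundle ℂ FW W]
variable {FL : Type*} [NormedAddCommGroup FL] [NormedSpace ℂ FL]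
variable {L : X → Type*} [TopologicalSpace (TotalSpace FL L)]
  [∀ x, AddCommGroup (L x)] [∀ x, Module ℂ (L x)] [∀ x, TopologicalSpace (L x)]
  [FiberBundle FL L] [VectorBundle ℂ FL L]

namespace TwistedHom

variable (φ : TwistedHom FW W FV V FL L) (l : FL →ₗ[ℂ] ℂ)

/-- The map between the fibres at `x` obtained from `φ` by contracting with the linear form `l` on
the model fibre of `L`, in the preferred trivialization of `L` at `x₀`. -/
def contracted (x₀ x : X) : V x →ₗ[ℂ] W x :=
  contract (l ∘ₗ coord FL x₀ x) ∘ₗ φ.toFun x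

theorem contracted_apply (x₀ x : X) (v : V x) :
    φ.contracted l x₀ x v = contract (l ∘ₗ coord FL x₀ x) (φ.toFun x v) := rfl

theorem holAt_contracted (x₀ : X) (w : FV) : HolAt (fun x =>
    coord FW x₀ x (φ.contracted l x₀ x (ofCoord FV V x₀ x w))) x₀ := by
  refine (φ.holomorphic x₀ w l).congr_of_eventuallyEq (Filter.Eventually.of_forall fun x => ?_)
  simp only [contracted_apply]
  induction φ.toFun x (ofCoord FV V x₀ x w) using TensorProduct.induction_on with
  | zero => simp
  | tmul m n => simp
  | add s t hs ht => simp only [map_add, hs, ht]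

section

variable [IsManifold 𝓘(ℂ) ω X] [FiniteDimensional ℂ FV] [FiniteDimensional ℂ FW]
  [ContMDiffVectorBundle ω FV V 𝓘(ℂ)] [ContMDiffVectorBundle ω FW W 𝓘(ℂ)]

theorem secHolAt_contracted {x₀ : X} {s : ∀ x, V x} (hs : SecHolAt FV s x₀) :
    SecHolAt FW (fun x => φ.contracted l x₀ x (s x)) x₀ := by
  rw [secHolAt_iff (mem_of_mem_nhds (mem_baseSet_nhds x₀))]
  let b := finBasis ℂ FV
  have h1 : (fun x => coord FW x₀ x (φ.contracted l x₀ x (s x))) =ᶠ[𝓝 x₀] fun x => ∑ i,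
      b.repr (coord FV x₀ x (s x)) i •
        coord FW x₀ x (φ.contracted l x₀ x (ofCoord FV V x₀ x (b i))) := by
    filter_upwards [mem_baseSet_nhds (F := FV) (V := V) x₀] with x hx
    conv_lhs => rw [← ofCoord_coord hx (s x), ← b.sum_repr (coord FV x₀ x (s x))]
    simp only [map_sum, map_smul]
  refine ContMDiffAt.congr_of_eventuallyEq ?_ h1
  exact contMDiffAt_finsetSum fun i _ =>
    (hs.coord.linear (b.coord i)).smul (φ.holAt_contracted l x₀ (b i))

theorem exists_local_kernel_image (x₀ : X) :
    ∃ r, r ≤ finrank ℂ FV ∧ finrank ℂ (LinearMap.range (φ.contracted l x₀ x₀)) ≤ r ∧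
      ∃ (k : Fin (finrank ℂ FV - r) → ∀ x, V x) (m : Fin r → ∀ x, V x),
        (∀ i, SecHolAt FV (k i) x₀) ∧ (∀ i, SecHolAt FV (m i) x₀) ∧
        ∀ᶠ x in 𝓝[≠] x₀, finrank ℂ (LinearMap.range (φ.contracted l x₀ x)) = r ∧
          LinearIndependent ℂ (fun i => k i x) ∧
          Submodule.span ℂ (Set.range fun i => k i x) = LinearMap.ker (φ.contracted l x₀ x) ∧
          LinearIndependent ℂ (fun i => φ.contracted l x₀ x (m i x)) ∧
          Submodule.span ℂ (Set.range fun i => φ.contracted l x₀ x (m i x)) =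
            LinearMap.range (φ.contracted l x₀ x) := by
  have hV := mem_baseSet_nhds (F := FV) (V := V) x₀
  have hW := mem_baseSet_nhds (F := FW) (V := W) x₀
  let A : X → FV →ₗ[ℂ] FW := fun x =>
    coord FW x₀ x ∘ₗ φ.contracted l x₀ x ∘ₗ (ofCoord FV V x₀ x).toLinearMap
  have hAapp : ∀ x w, A x w = coord FW x₀ x (φ.contracted l x₀ x (ofCoord FV V x₀ x w)) :=
    fun _ _ => rfl
  have hAr : ∀ x ∈ (trivializationAt FV V x₀).baseSet, LinearMap.range (A x) =
      (LinearMap.range (φ.contracted l x₀ x)).map (coord FW x₀ x) := fun x hx => by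
    have hs : LinearMap.range (ofCoord FV V x₀ x).toLinearMap = ⊤ :=
      LinearMap.range_eq_top.2 fun v => ⟨coord FV x₀ x v, ofCoord_coord hx v⟩
    rw [LinearMap.range_comp, LinearMap.range_comp, hs, Submodule.map_top]
  have hArf : ∀ x ∈ (trivializationAt FV V x₀).baseSet, x ∈ (trivializationAt FW W x₀).baseSet →
      finrank ℂ (LinearMap.range (A x)) = finrank ℂ (LinearMap.range (φ.contracted l x₀ x)) :=
    fun x hx hx' => by
    rw [hAr x hx]
    exact (Submodule.equivMapOfInjective _ (LinearMap.ker_eq_bot.1 (ker_coord hx')) _).finrank_eq.symm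
  obtain ⟨r, hr, hr0, k, m, hk, hkm⟩ := UpqHiggs.exists_local_kernel_image (A := A) (x₀ := x₀)
    (φ.holAt_contracted l x₀)
  rw [hArf x₀ (mem_of_mem_nhds hV) (mem_of_mem_nhds hW)] at hr0
  refine ⟨r, hr, hr0, fun i x => ofCoord FV V x₀ x (k i x), fun i x => ofCoord FV V x₀ x (m i),
    fun i => secHolAt_ofCoord (mem_of_mem_nhds hV) (hk i),
    fun i => secHolAt_ofCoord (mem_of_mem_nhds hV) contMDiffAt_const, ?_⟩
  filter_upwards [hkm, nhdsWithin_le_nhds hV, nhdsWithin_le_nhds hW]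
    with x ⟨h1, h2, h3, h4, h5⟩ hxV hxW
  refine ⟨by rw [← hArf x hxV hxW, h1], (linearIndependent_ofCoord hxV).2 h2, ?_,
    (linearIndependent_coord_iff hxW).1 h4, ?_⟩
  · ext v
    rw [← coord_mem_span_iff hxV]
    simp only [coord_ofCoord hxV]
    rw [h3, LinearMap.mem_ker, LinearMap.mem_ker, hAapp, ofCoord_coord hxV]
    exact map_eq_zero_iff _ (LinearMap.ker_eq_bot.1 (ker_coord hxW))
  · ext w
    rw [← coord_mem_span_iff hxW]
    have : Submodule.span ℂ (Set.range fun i => coord FW x₀ x (φ.contracted l x₀ x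
        (ofCoord FV V x₀ x (m i)))) = LinearMap.range (A x) := h5
    rw [this, hAr x hxV]
    refine ⟨?_, fun h => ⟨w, h, rfl⟩⟩
    rintro ⟨w', hw', h⟩
    rwa [← LinearMap.ker_eq_bot.1 (ker_coord hxW) h]

end

variable (hL : finrank ℂ FL = 1) {l} {e : FL} (he : l e = 1)

include hL

theorem finrank_line (x : X) : finrank ℂ (L x) = 1 := (finrank_fiber (F := FL) x).trans hL

include he

theorem form_ofCoord {x₀ x : X} (hx : x ∈ (trivializationAt FL L x₀).baseSet) :
    (l ∘ₗ coord FL x₀ x) (ofCoord FL L x₀ x e) = 1 := by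
  rw [LinearMap.comp_apply, coord_ofCoord hx, he]

theorem contracted_eq_zero_iff {x₀ x : X} (hx : x ∈ (trivializationAt FL L x₀).baseSet) {v : V x} :
    φ.contracted l x₀ x v = 0 ↔ φ.toFun x v = 0 :=
  contract_eq_zero_iff (finrank_line hL x) (form_ofCoord hL he hx)

theorem ker_contracted {x₀ x : X} (hx : x ∈ (trivializationAt FL L x₀).baseSet) :
    LinearMap.ker (φ.contracted l x₀ x) = LinearMap.ker (φ.toFun x) := by
  ext v
  exact φ.contracted_eq_zero_iff hL he hx

/-- Changing the trivialization of `L` rescales the contracted map and the generator of the line by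
compensating factors. Its kernel and range are unchanged, and so is its tensor product with the
generator. -/
theorem contracted_eq_smul {x₀ x : X} (hx : x ∈ (trivializationAt FL L x₀).baseSet) :
    ∃ c : ℂ, c ≠ 0 ∧ (∀ v, φ.contracted l x₀ x v = c • φ.contracted l x x v) ∧
      ofCoord FL L x x e = c • ofCoord FL L x₀ x e := by
  have hxx := FiberBundle.mem_baseSet_trivializationAt' (F := FL) (E := L) x
  have h1 := form_ofCoord hL he hx
  have h2 := form_ofCoord hL he hxx
  have h3 : ofCoord FL L x x e = (l ∘ₗ coord FL x₀ x) (ofCoord FL L x x e) • ofCoord FL L x₀ x e :=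
    eq_smul_of_finrank_one (finrank_line hL x) h1 _
  refine ⟨_, fun h0 => ?_, fun v => contract_eq_smul (finrank_line hL x) h2 _, h3⟩
  rw [h0, zero_smul] at h3
  rw [h3, map_zero] at h2
  exact zero_ne_one h2

theorem range_contracted {x₀ x : X} (hx : x ∈ (trivializationAt FL L x₀).baseSet) :
    LinearMap.range (φ.contracted l x₀ x) = LinearMap.range (φ.contracted l x x) := by
  obtain ⟨c, hc, h, -⟩ := φ.contracted_eq_smul hL he hx
  ext w
  constructor
  · rintro ⟨v, rfl⟩
    exact ⟨c • v, by rw [map_smul, h]⟩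
  · rintro ⟨v, rfl⟩
    exact ⟨c⁻¹ • v, by rw [map_smul, h, inv_smul_smul₀ hc]⟩

theorem finrank_range_contracted [FiniteDimensional ℂ FV] {x₀ x : X}
    (hx : x ∈ (trivializationAt FL L x₀).baseSet) :
    finrank ℂ (LinearMap.range (φ.contracted l x₀ x)) =
      finrank ℂ (LinearMap.range (φ.toFun x)) := by
  have := finiteDimensional_fiber (F := FV) (V := V) x
  have h1 := LinearMap.finrank_range_add_finrank_ker (φ.contracted l x₀ x)
  have h2 := LinearMap.finrank_range_add_finrank_ker (φ.toFun x)
  rw [φ.ker_contracted hL he hx] at h1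
  omega

variable [IsManifold 𝓘(ℂ) ω X] [FiniteDimensional ℂ FV] [FiniteDimensional ℂ FW]
  [ContMDiffVectorBundle ω FV V 𝓘(ℂ)] [ContMDiffVectorBundle ω FW W 𝓘(ℂ)]
  [T2Space X] [ConnectedSpace X]

/-- Generic ranks at nearby points agree, because they are compared at a common point of the
punctured neighbourhoods. Connectedness makes `r` constant; the constant bounds all fibre ranks and
is attained. -/
theorem rank_eq_of_eventually {r : X → ℕ}
    (h0 : ∀ x, finrank ℂ (LinearMap.range (φ.toFun x)) ≤ r x)
    (hr : ∀ x₀, ∀ᶠ x in 𝓝[≠] x₀, finrank ℂ (LinearMap.range (φ.toFun x)) = r x₀) (x : X) :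
    r x = φ.rank := by
  have hloc : IsLocallyConstant r := by
    rw [IsLocallyConstant.iff_eventually_eq]
    intro x₀
    have h1 := eventually_eventually_nhdsWithin.2 (hr x₀)
    rw [eventually_nhdsWithin_iff] at h1
    filter_upwards [h1] with y hy
    by_cases hne : y = x₀
    · rw [hne]
    · have h2 := hy hne
      rw [isOpen_compl_singleton.nhdsWithin_eq hne] at h2
      obtain ⟨z, hz, hz'⟩ := ((hr y).and (nhdsWithin_le_nhds h2)).exists
      rw [← hz, hz']
  have hconst : ∀ y, r y = r x := fun y => hloc.apply_eq_of_preconnectedSpace y x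
  refine le_antisymm ?_ (ciSup_le fun y => (h0 y).trans (hconst y).le)
  obtain ⟨y, hy⟩ := (hr x).exists
  rw [← hy]
  exact le_ciSup (f := fun y => finrank ℂ (LinearMap.range (φ.toFun y)))
    ⟨r x, by rintro _ ⟨z, rfl⟩; exact (h0 z).trans (hconst z).le⟩ y

theorem exists_kernel_image : ∃ (N : HolomorphicSubbundle FV V) (I : HolomorphicSubbundle FW W),
    N.rank + I.rank = finrank ℂ FV ∧ I.rank = φ.rank ∧
    (∀ x, ∀ v ∈ N.fiber x, φ.toFun x v = 0) ∧
    (∀ x v, φ.toFun x v ∈ LinearMap.range ((I.fiber x).subtype.rTensor (L x))) ∧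
    ∀ x₀, ∀ᶠ x in 𝓝[≠] x₀, LinearMap.ker (φ.toFun x) ≤ N.fiber x := by
  have hLb := fun x₀ : X => nhdsWithin_le_nhds (s := {x₀}ᶜ) (mem_baseSet_nhds (F := FL) (V := L) x₀)
  have hxL := fun x₀ : X => mem_of_mem_nhds (mem_baseSet_nhds (F := FL) (V := L) x₀)
  choose r hr hr0 hkm using φ.exists_local_kernel_image l
  have hrank := φ.rank_eq_of_eventually hL he (r := r)
    (fun x => by rw [← φ.finrank_range_contracted hL he (hxL x)]; exact hr0 x)
    (fun x₀ => by
      obtain ⟨_, _, _, _, h⟩ := hkm x₀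
      filter_upwards [h, hLb x₀] with x hx hxb
      rw [← φ.finrank_range_contracted hL he hxb, hx.1])
  obtain rfl : r = fun _ => φ.rank := funext hrank
  obtain ⟨N, hNr, hN, hNK⟩ := exists_subbundle (F := FV) (r := finrank ℂ FV - φ.rank)
    (fun x => LinearMap.ker (φ.toFun x)) (fun x₀ => by
      obtain ⟨k, m, hk, hm, h⟩ := hkm x₀
      refine ⟨k, hk, ?_⟩
      filter_upwards [h, hLb x₀] with x hx hxb
      exact ⟨hx.2.1, by rw [hx.2.2.1, φ.ker_contracted hL he hxb]⟩)
  obtain ⟨I, hIr, hI, -⟩ := exists_subbundle (F := FW) (r := φ.rank)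
    (fun x => LinearMap.range (φ.contracted l x x)) (fun x₀ => by
      obtain ⟨k, m, hk, hm, h⟩ := hkm x₀
      refine ⟨fun i x => φ.contracted l x₀ x (m i x), fun i => φ.secHolAt_contracted l (hm i), ?_⟩
      filter_upwards [h, hLb x₀] with x hx hxb
      exact ⟨hx.2.2.2.1, by rw [hx.2.2.2.2, φ.range_contracted hL he hxb]⟩)
  obtain ⟨x₁⟩ := (inferInstance : Nonempty X)
  refine ⟨N, I, by rw [hNr, hIr]; exact Nat.sub_add_cancel (hr x₁), hIr, fun x v hv => ?_,
    fun x v => ?_, hNK⟩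
  · obtain ⟨s, hs, rfl, hsK⟩ := (hN x v).1 hv
    rw [← φ.contracted_eq_zero_iff hL he (hxL x)]
    have h1 := (φ.secHolAt_contracted l hs).coord
    -- A section with values in the kernel off `x` is annihilated at `x` too, by continuity.
    have h2 : ∀ᶠ y in 𝓝[≠] x, coord FW x y (φ.contracted l x y (s y)) = 0 := by
      filter_upwards [hsK, hLb x] with y hy hyb
      rw [(φ.contracted_eq_zero_iff hL he hyb).2 hy, map_zero]
    have h3 : coord FW x x (φ.contracted l x x (s x)) = 0 :=
      tendsto_nhds_unique (h1.continuousAt.tendsto.mono_left nhdsWithin_le_nhds)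
        (tendsto_const_nhds.congr' (h2.mono fun y hy => hy.symm))
    exact (map_eq_zero_iff _ (LinearMap.ker_eq_bot.1
      (ker_coord (mem_of_mem_nhds (mem_baseSet_nhds x))))).1 h3
  · rw [← contract_mem_iff (finrank_line hL x) (form_ofCoord hL he (hxL x)), hI]
    have hxV := mem_of_mem_nhds (mem_baseSet_nhds (F := FV) (V := V) x)
    -- Extending `v` with constant coordinates exhibits its image as the value of a holomorphic
    -- section of the image.
    refine ⟨fun y => φ.contracted l x y (ofCoord FV V x y (coord FV x x v)),
      φ.secHolAt_contracted l (secHolAt_ofCoord hxV contMDiffAt_const), ?_, ?_⟩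
    · change φ.contracted l x x (ofCoord FV V x x (coord FV x x v)) = φ.contracted l x x v
      rw [ofCoord_coord hxV]
    · filter_upwards [hLb x] with y hy
      rw [← φ.range_contracted hL he hy]
      exact ⟨_, rfl⟩

end TwistedHom

end Twisted

/-! ### The squared norm of the determinant of a linear map -/

section DetNorm

variable {E E' E'' : Type*} [AddCommGroup E] [Module ℂ E] [AddCommGroup E'] [Module ℂ E']
  [AddCommGroup E''] [Module ℂ E'']
variable (h : E →ₗ⋆[ℂ] E →ₗ[ℂ] ℂ) (h' : E' →ₗ⋆[ℂ] E' →ₗ[ℂ] ℂ) (h'' : E'' →ₗ⋆[ℂ] E'' →ₗ[ℂ] ℂ)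

/-- The squared norm of the determinant of the map `E / span n → E' ⊗ E''` induced by `T ⊗ l⁻¹`,
where `(n, m)` is a basis of `E` and `l` a basis of the line `E''`. -/
def detNormSq (T : E →ₗ[ℂ] E') {a r : ℕ} (n : Fin a → E) (m : Fin r → E) (l : E'') : ℝ :=
  (gram h' fun i => T (m i)).re * (gram h'' fun _ : Fin 1 => l).re ^ r *
    (gram h n).re * ((gram h (Sum.elim n m)).re)⁻¹

variable {h h' h''}

/-- The Gram determinant of the `r` image vectors scales by `|c|^(2r)`; this balances the `r`-th
power of the squared norm of the generator of the line. -/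
theorem detNormSq_scale {T T' : E →ₗ[ℂ] E'} {c : ℂ} (hT : ∀ v, T' v = c • T v) {l l' : E''}
    (hl : l = c • l') {a r : ℕ} (n : Fin a → E) (m : Fin r → E) :
    detNormSq h h' h'' T n m l = detNormSq h h' h'' T' n m l' := by
  have h1 : gram h' (fun i => T' (m i)) = (‖c ^ r‖ ^ 2 : ℝ) * gram h' fun i => T (m i) := by
    have := gram_eq_of_eq_sum h' (s := fun i => T' (m i)) (t := fun i => T (m i))
      (P := c • (1 : Matrix (Fin r) (Fin r) ℂ)) fun i => by
        simp [hT, Matrix.one_apply]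
    rwa [Matrix.det_smul, Matrix.det_one, mul_one, Fintype.card_fin] at this
  have h2 : gram h'' (fun _ : Fin 1 => l) = (‖c‖ ^ 2 : ℝ) * gram h'' fun _ : Fin 1 => l' := by
    have := gram_eq_of_eq_sum h'' (s := fun _ : Fin 1 => l) (t := fun _ : Fin 1 => l')
      (P := c • (1 : Matrix (Fin 1) (Fin 1) ℂ)) fun i => by
        obtain rfl : i = 0 := Subsingleton.elim _ _
        simp [hl]
    rwa [Matrix.det_smul, Matrix.det_one, mul_one, Fintype.card_fin, pow_one] at this
  rw [detNormSq, detNormSq, h1, h2, Complex.re_ofReal_mul, Complex.re_ofReal_mul, norm_pow, mul_pow]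
  ring

/-- Since `n'` lies in the span of `n`, the base change is block triangular with diagonal blocks `P`
and `R`. The factors `|det P|²` and `|det R|²` each occur once on top and once in the inverse. -/
theorem detNormSq_change_basis {T : E →ₗ[ℂ] E'} {a r : ℕ} {n n' : Fin a → E} {m m' : Fin r → E}
    (hn : ∀ i, n' i ∈ Submodule.span ℂ (Set.range n)) (hT : ∀ i, T (n i) = 0)
    (hm : ∀ i, m' i ∈ Submodule.span ℂ (Set.range (Sum.elim n m)))
    (h0 : (gram h (Sum.elim n' m')).re ≠ 0) (l : E'') :
    detNormSq h h' h'' T n' m' l = detNormSq h h' h'' T n m l := by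
  obtain ⟨P, hP⟩ := exists_matrix_of_mem_span hn
  obtain ⟨Q, hQ⟩ := exists_matrix_of_mem_span hm
  let R : Matrix (Fin r) (Fin r) ℂ := Matrix.of fun i j => Q i (Sum.inr j)
  have hTm : ∀ i, T (m' i) = ∑ j, R i j • T (m j) := fun i => by
    rw [hQ, Fintype.sum_sum_type, map_add, map_sum, map_sum]
    simp [hT, R]
  have hnm : ∀ i, Sum.elim n' m' i = ∑ j, Matrix.fromBlocks P 0
      (Matrix.of fun i j => Q i (Sum.inl j)) R i j • Sum.elim n m j := fun i => by
    rw [Fintype.sum_sum_type]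
    cases i with
    | inl i => simp [hP i]
    | inr i => simp [hQ i, Fintype.sum_sum_type, R]
  have e1 := gram_eq_of_eq_sum h' hTm
  have e2 := gram_eq_of_eq_sum h hP
  have e3 := gram_eq_of_eq_sum h hnm
  rw [Matrix.det_fromBlocks_zero₁₂, norm_mul, mul_pow] at e3
  rw [e3, Complex.re_ofReal_mul] at h0
  rw [detNormSq, detNormSq, e1, e2, e3, Complex.re_ofReal_mul, Complex.re_ofReal_mul,
    Complex.re_ofReal_mul]
  have h1 := right_ne_zero_of_mul h0
  have h2 : ‖P.det‖ ≠ 0 := fun h => h0 (by rw [h]; ring)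
  have h3 : ‖R.det‖ ≠ 0 := fun h => h0 (by rw [h]; ring)
  field_simp

end DetNorm

/-! ### Local frames of the whole bundle adapted to a subbundle -/

section Complement

variable {X : Type*} [TopologicalSpace X] [ChartedSpace ℂ X]
variable {F : Type*} [NormedAddCommGroup F] [NormedSpace ℂ F] [FiniteDimensional ℂ F]
variable {V : X → Type*} [TopologicalSpace (TotalSpace F V)]
  [∀ x, AddCommGroup (V x)] [∀ x, Module ℂ (V x)] [∀ x, TopologicalSpace (V x)]
  [FiberBundle F V] [VectorBundle ℂ F V]

theorem span_eq_top_of_card {ι : Type*} [Fintype ι] {x : X} {s : ι → V x}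
    (hs : LinearIndependent ℂ s) (hc : Fintype.card ι = finrank ℂ F) :
    Submodule.span ℂ (Set.range s) = ⊤ := by
  have := finiteDimensional_fiber (F := F) (V := V) x
  exact hs.span_eq_top_of_card_eq_finrank' (hc.trans (finrank_fiber (F := F) x).symm)

variable [IsManifold 𝓘(ℂ) ω X] [ContMDiffVectorBundle ω F V 𝓘(ℂ)]

namespace HolomorphicSubbundle

variable (S : HolomorphicSubbundle F V)

theorem exists_complement {r : ℕ} (hr : S.rank + r = finrank ℂ F) (x₀ : X) :
    ∃ m : Fin r → F, LinearIndependent ℂ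
      (Sum.elim (fun i => S.frame x₀ i x₀) fun j => ofCoord F V x₀ x₀ (m j)) := by
  have := finiteDimensional_fiber (F := F) (V := V) x₀
  obtain ⟨-, hi, hsp⟩ := (S.frame_spec x₀).self_of_nhds
  have h1 := S.finrank_fiber x₀
  have h2 := (S.fiber x₀).finrank_quotient_add_finrank
  rw [h1, UpqHiggs.finrank_fiber (F := F) (V := V) x₀] at h2
  let b := finBasisOfFinrankEq ℂ (V x₀ ⧸ S.fiber x₀) (n := r) (by omega)
  choose g hg using fun j => Submodule.Quotient.mk_surjective (S.fiber x₀) (b j)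
  have hb : LinearIndependent ℂ (Submodule.Quotient.mk (p := S.fiber x₀) ∘ g) := by
    convert b.linearIndependent using 1
    exact funext hg
  have hf : ∀ i, S.frame x₀ i x₀ ∈ S.fiber x₀ := fun i => by
    rw [← hsp]; exact Submodule.subset_span ⟨i, rfl⟩
  have hn : LinearIndependent ℂ fun i => (⟨S.frame x₀ i x₀, hf i⟩ : S.fiber x₀) :=
    LinearIndependent.of_comp (S.fiber x₀).subtype hi
  refine ⟨fun j => coord F x₀ x₀ (g j), ?_⟩
  simp only [ofCoord_coord (mem_of_mem_nhds (mem_baseSet_nhds (F := F) (V := V) x₀))]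
  exact LinearIndependent.sumElim_of_quotient hn g hb

theorem top_frame_spec (x₀ : X) : ∀ᶠ x in 𝓝 x₀,
    (∀ i, SecHolAt F ((HolomorphicSubbundle.top : HolomorphicSubbundle F V).frame x₀ i) x) ∧
    LinearIndependent ℂ
      (fun i => (HolomorphicSubbundle.top : HolomorphicSubbundle F V).frame x₀ i x) ∧
    Submodule.span ℂ (Set.range fun i =>
      (HolomorphicSubbundle.top : HolomorphicSubbundle F V).frame x₀ i x) = ⊤ :=
  HolomorphicSubbundle.top.frame_spec x₀

/-- The Gram determinant of a local frame differs from that of the chosen frame of `V` by the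
squared norm of a holomorphic function. -/
theorem exists_gram_top (H : HermitianMetric F V) {ι : Type*} [Fintype ι] [DecidableEq ι]
    (e : ι ≃ Fin (HolomorphicSubbundle.top : HolomorphicSubbundle F V).rank) {s : ι → ∀ x, V x}
    {x₀ : X} (hs : ∀ i, SecHolAt F (s i) x₀) (hi : LinearIndependent ℂ fun i => s i x₀) :
    ∃ a : X → ℂ, HolAt a x₀ ∧ a x₀ ≠ 0 ∧ ∀ᶠ x in 𝓝 x₀, (gram (H.inner x) fun i => s i x).re =
      ‖a x‖ ^ 2 * (gram (H.inner x) fun i =>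
        (HolomorphicSubbundle.top : HolomorphicSubbundle F V).frame x₀ i x).re := by
  have htop := top_frame_spec (V := V) (F := F) x₀
  set t := (HolomorphicSubbundle.top : HolomorphicSubbundle F V).frame x₀
  have hspan : ∀ x, (Set.range fun i => t (e i) x) = Set.range fun i => t i x := fun x =>
    e.surjective.range_comp fun i => t i x
  obtain ⟨a, ha, hP⟩ := SecHolAt.exists_hol_det hs (t := fun i => t (e i))
    (fun i => htop.self_of_nhds.1 (e i)) (htop.self_of_nhds.2.1.comp e e.injective) (by
      filter_upwards [htop] with x hx i
      rw [hspan, hx.2.2]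
      trivial)
  have hg : ∀ᶠ x in 𝓝 x₀, (gram (H.inner x) fun i => s i x).re =
      ‖a x‖ ^ 2 * (gram (H.inner x) fun i => t i x).re := by
    filter_upwards [hP] with x ⟨P, hP, hPa⟩
    rw [gram_eq_of_eq_sum (H.inner x) hP, Complex.re_ofReal_mul, hPa,
      ← gram_comp_equiv (H.inner x) (fun i => t i x) e]
    rfl
  refine ⟨a, ha, fun h0 => ?_, hg⟩
  have h1 := H.gram_pos hi
  rw [hg.self_of_nhds, h0] at h1
  simp at h1

end HolomorphicSubbundle

end Complement

/-- A set with punctured neighbourhoods avoiding it at all points of a compact space is finite. -/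
theorem finite_of_eventually_punctured {X : Type*} [TopologicalSpace X] [CompactSpace X]
    {p : X → Prop} (h : ∀ x₀, ∀ᶠ x in 𝓝[≠] x₀, p x) : {x | ¬ p x}.Finite := by
  simp only [eventually_nhdsWithin_iff] at h
  obtain ⟨t, ht⟩ := isCompact_univ.elim_nhds_subcover (fun x₀ => {x | x ∈ ({x₀}ᶜ : Set X) → p x})
    (fun x₀ _ => h x₀)
  refine t.finite_toSet.subset fun x hx => ?_
  obtain ⟨y, hy, hxy⟩ := Set.mem_iUnion₂.1 (ht.2 (Set.mem_univ x))
  by_cases hne : x = y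
  · rw [hne]; exact hy
  · exact absurd (hxy hne) hx

/-! ### The degree inequality for the kernel and the image of a twisted homomorphism -/

section DegreeInequality

variable {X : Type*} [TopologicalSpace X] [ChartedSpace ℂ X]

theorem C2At.pow {f : X → ℝ} {x : X} (hf : C2At f x) (n : ℕ) : C2At (fun y => f y ^ n) x :=
  ContDiffAt.comp_contMDiffAt (g := fun t : ℝ => t ^ n) (contDiff_id.pow n).contDiffAt hf

theorem C2At.inv {f : X → ℝ} {x : X} (hf : C2At f x) (h0 : f x ≠ 0) :
    C2At (fun y => (f y)⁻¹) x :=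
  ContDiffAt.comp_contMDiffAt (g := fun t : ℝ => t⁻¹) (contDiffAt_inv ℝ h0) hf

variable [IsManifold 𝓘(ℂ) ω X] [CompactSpace X] [T2Space X]
variable {FV : Type*} [NormedAddCommGroup FV] [NormedSpace ℂ FV] [FiniteDimensional ℂ FV]
variable {V : X → Type*} [TopologicalSpace (TotalSpace FV V)]
  [∀ x, AddCommGroup (V x)] [∀ x, Module ℂ (V x)] [∀ x, TopologicalSpace (V x)]
  [FiberBundle FV V] [VectorBundle ℂ FV V] [ContMDiffVectorBundle ω FV V 𝓘(ℂ)]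
variable {FW : Type*} [NormedAddCommGroup FW] [NormedSpace ℂ FW] [FiniteDimensional ℂ FW]
variable {W : X → Type*} [TopologicalSpace (TotalSpace FW W)]
  [∀ x, AddCommGroup (W x)] [∀ x, Module ℂ (W x)] [∀ x, TopologicalSpace (W x)]
  [FiberBundle FW W] [VectorBundle ℂ FW W] [ContMDiffVectorBundle ω FW W 𝓘(ℂ)]
variable {FL : Type*} [NormedAddCommGroup FL] [NormedSpace ℂ FL] [FiniteDimensional ℂ FL]
variable {L : X → Type*} [TopologicalSpace (TotalSpace FL L)]
  [∀ x, AddCommGroup (L x)] [∀ x, Module ℂ (L x)] [∀ x, TopologicalSpace (L x)]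
  [FiberBundle FL L] [VectorBundle ℂ FL L] [ContMDiffVectorBundle ω FL L 𝓘(ℂ)]

namespace HolomorphicSubbundle

theorem integrableOn_chernDensity (S : HolomorphicSubbundle FV V) (H : HermitianMetric FV V)
    (ρ : ChartPartition X) (c : X) : MeasureTheory.IntegrableOn (fun z =>
      ρ.toFun c ((chartAt ℂ c).symm z) * S.chernDensity H c z) (chartAt ℂ c).target :=
  ρ.integrableOn_mul c (S.continuousOn_chernDensity H c)

theorem chernIntegral_eq_sum (S : HolomorphicSubbundle FV V) (H : HermitianMetric FV V)
    (ρ : ChartPartition X) : S.chernIntegral H ρ = ∑ c ∈ ρ.finite.toFinset,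
      ∫ z in (chartAt ℂ c).target, ρ.toFun c ((chartAt ℂ c).symm z) * S.chernDensity H c z :=
  ρ.finsum_eq _ fun c hc => by simp [hc]

end HolomorphicSubbundle

/-- If the determinant of a homomorphism is represented locally by holomorphic functions, the
degrees of its source and target satisfy the expected inequality. -/
theorem chernIntegral_le_of_local (N : HolomorphicSubbundle FV V) (I : HolomorphicSubbundle FW W)
    (HV : HermitianMetric FV V) (HW : HermitianMetric FW W) (HL : HermitianMetric FL L)
    (ρ : ChartPartition X) (A : HolomorphicSubbundle FV V) (B : HolomorphicSubbundle FL L)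
    (r : ℕ) {σ : X → ℝ} (hσ0 : ∀ x, 0 ≤ σ x) (hσ2 : ∀ x, C2At σ x)
    (hσf : ∀ x₀, ∀ᶠ x in 𝓝[≠] x₀, σ x ≠ 0)
    (hloc : ∀ x₀, σ x₀ ≠ 0 → ∃ g : X → ℂ, HolAt g x₀ ∧ g x₀ ≠ 0 ∧ ∀ᶠ x in 𝓝 x₀,
      Real.log (σ x) = 2 * Real.log ‖g x‖ + (I.logGram HW x₀ x + r * B.logGram HL x₀ x +
        N.logGram HV x₀ x - A.logGram HV x₀ x)) :
    A.chernIntegral HV ρ ≤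
      N.chernIntegral HV ρ + I.chernIntegral HW ρ + r * B.chernIntegral HL ρ := by
  have hfin : {x | σ x = 0}.Finite := by
    simpa using finite_of_eventually_punctured hσf
  -- The factor `-4π` undoes the normalization in `chernDensity`, so `D` is the Laplacian of the sum
  -- of the logarithms of Gram determinants.
  let D : X → ℂ → ℝ := fun c z => -(4 * Real.pi) * (I.chernDensity HW c z +
    r * B.chernDensity HL c z + N.chernDensity HV c z - A.chernDensity HV c z)
  have hD : ∀ c, ContinuousOn (D c) (chartAt ℂ c).target := fun c =>
    continuousOn_const.mul ((((I.continuousOn_chernDensity HW c).add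
      (continuousOn_const.mul (B.continuousOn_chernDensity HL c))).add
      (N.continuousOn_chernDensity HV c)).sub (A.continuousOn_chernDensity HV c))
  have hlog : ∀ c, ∀ z ∈ (chartAt ℂ c).target, σ ((chartAt ℂ c).symm z) ≠ 0 →
      Laplacian.laplacian (fun w => Real.log (σ ((chartAt ℂ c).symm w))) z = D c z := by
    intro c z hz h0
    obtain ⟨g, hg, hg0, hev⟩ := hloc _ h0
    have han : AnalyticAt ℂ (fun w => g ((chartAt ℂ c).symm w)) z := HolAt.comp_chart_symm hz hg
    have hh := han.harmonicAt_log_norm hg0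
    have cI := C2At.comp_chart_symm hz (I.c2At_logGram HW ((chartAt ℂ c).symm z)).self_of_nhds
    have cB := C2At.comp_chart_symm hz (B.c2At_logGram HL ((chartAt ℂ c).symm z)).self_of_nhds
    have cN := C2At.comp_chart_symm hz (N.c2At_logGram HV ((chartAt ℂ c).symm z)).self_of_nhds
    have cA := C2At.comp_chart_symm hz (A.c2At_logGram HV ((chartAt ℂ c).symm z)).self_of_nhds
    set fg : ℂ → ℝ := fun w => Real.log ‖g ((chartAt ℂ c).symm w)‖
    set fI : ℂ → ℝ := fun w => I.logGram HW ((chartAt ℂ c).symm z) ((chartAt ℂ c).symm w) with hfI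
    set fB : ℂ → ℝ := fun w => B.logGram HL ((chartAt ℂ c).symm z) ((chartAt ℂ c).symm w) with hfB
    set fN : ℂ → ℝ := fun w => N.logGram HV ((chartAt ℂ c).symm z) ((chartAt ℂ c).symm w) with hfN
    set fA : ℂ → ℝ := fun w => A.logGram HV ((chartAt ℂ c).symm z) ((chartAt ℂ c).symm w) with hfA
    have h1 : (fun w => Real.log (σ ((chartAt ℂ c).symm w))) =ᶠ[𝓝 z]
        (2 : ℝ) • fg + (fI + (r : ℝ) • fB + fN - fA) := by
      filter_upwards [((chartAt ℂ c).continuousAt_symm hz).eventually hev] with w hw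
      simpa using hw
    have c1 : ContDiffAt ℝ 2 ((2 : ℝ) • fg) z := hh.1.const_smul (2 : ℝ)
    have c2 : ContDiffAt ℝ 2 ((r : ℝ) • fB) z := cB.const_smul (r : ℝ)
    have c3 : ContDiffAt ℝ 2 (fI + (r : ℝ) • fB) z := cI.add c2
    have c4 : ContDiffAt ℝ 2 (fI + (r : ℝ) • fB + fN) z := c3.add cN
    have c5 : ContDiffAt ℝ 2 (fI + (r : ℝ) • fB + fN - fA) z := c4.sub cA
    rw [(InnerProductSpace.laplacian_congr_nhds h1).eq_of_nhds, c1.laplacian_add c5,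
      c4.laplacian_sub cA, c3.laplacian_add cN, cI.laplacian_add c2,
      InnerProductSpace.laplacian_smul _ hh.1, InnerProductSpace.laplacian_smul _ cB,
      hh.2.eq_of_nhds]
    simp only [D, HolomorphicSubbundle.chernDensity, hfI, hfB, hfN, hfA, smul_eq_mul, Pi.zero_apply]
    have hpi := Real.pi_ne_zero
    field_simp
    ring
  have key := ρ.finsum_integral_nonpos hσ0 hσ2 hfin hD hlog
  rw [ρ.finsum_eq _ fun c hc => by simp [hc]] at key
  have hint : ∀ c, ∫ z in (chartAt ℂ c).target, ρ.toFun c ((chartAt ℂ c).symm z) * D c z =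
      -(4 * Real.pi) * ((∫ z in (chartAt ℂ c).target,
          ρ.toFun c ((chartAt ℂ c).symm z) * I.chernDensity HW c z) +
        r * (∫ z in (chartAt ℂ c).target,
          ρ.toFun c ((chartAt ℂ c).symm z) * B.chernDensity HL c z) +
        (∫ z in (chartAt ℂ c).target,
          ρ.toFun c ((chartAt ℂ c).symm z) * N.chernDensity HV c z) -
        ∫ z in (chartAt ℂ c).target,
          ρ.toFun c ((chartAt ℂ c).symm z) * A.chernDensity HV c z) := fun c => by
    have iI := I.integrableOn_chernDensity HW ρ c
    have iB := (B.integrableOn_chernDensity HL ρ c).const_mul (r : ℝ)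
    have iN := N.integrableOn_chernDensity HV ρ c
    have iA := A.integrableOn_chernDensity HV ρ c
    have iIB : MeasureTheory.IntegrableOn
        (fun z => ρ.toFun c ((chartAt ℂ c).symm z) * I.chernDensity HW c z +
          (r : ℝ) * (ρ.toFun c ((chartAt ℂ c).symm z) * B.chernDensity HL c z))
        (chartAt ℂ c).target := iI.add iB
    have iIBN : MeasureTheory.IntegrableOn
        (fun z => ρ.toFun c ((chartAt ℂ c).symm z) * I.chernDensity HW c z +
          (r : ℝ) * (ρ.toFun c ((chartAt ℂ c).symm z) * B.chernDensity HL c z) +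
          ρ.toFun c ((chartAt ℂ c).symm z) * N.chernDensity HV c z)
        (chartAt ℂ c).target := iIB.add iN
    rw [← MeasureTheory.integral_const_mul (r : ℝ), ← MeasureTheory.integral_add iI iB,
      ← MeasureTheory.integral_add iIB iN, ← MeasureTheory.integral_sub iIBN iA,
      ← MeasureTheory.integral_const_mul]
    refine MeasureTheory.integral_congr_ae (Filter.Eventually.of_forall fun z => ?_)
    simp only [D]
    ring
  simp only [hint] at key
  rw [← Finset.mul_sum, Finset.sum_sub_distrib, Finset.sum_add_distrib, Finset.sum_add_distrib,
    ← Finset.mul_sum, ← I.chernIntegral_eq_sum, ← B.chernIntegral_eq_sum, ← N.chernIntegral_eq_sum,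
    ← A.chernIntegral_eq_sum] at key
  have := Real.pi_pos
  nlinarith

/-- If `N` and `I` are the saturated kernel and image of `φ : V → W ⊗ L`, then
`deg V ≤ deg N + deg I + rk I deg L`. -/
theorem TwistedHom.degree_le (φ : TwistedHom FW W FV V FL L) (hL : finrank ℂ FL = 1)
    {l : FL →ₗ[ℂ] ℂ} {e : FL} (he : l e = 1)
    (N : HolomorphicSubbundle FV V) (I : HolomorphicSubbundle FW W)
    (hr : N.rank + I.rank = finrank ℂ FV) (hN : ∀ x, ∀ v ∈ N.fiber x, φ.toFun x v = 0)
    (hI : ∀ x v, φ.toFun x v ∈ LinearMap.range ((I.fiber x).subtype.rTensor (L x)))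
    (hNK : ∀ x₀, ∀ᶠ x in 𝓝[≠] x₀, LinearMap.ker (φ.toFun x) ≤ N.fiber x) :
    degree FV V ≤ N.degree + I.degree + I.rank * degree FL L := by
  -- These are the metrics used in `degree`, the same one for `V` and for `N`, so independence of
  -- the degree from the metric is not needed.
  let HV : HermitianMetric FV V := Classical.arbitrary _
  let HW : HermitianMetric FW W := Classical.arbitrary _
  let HL : HermitianMetric FL L := Classical.arbitrary _
  have hxV := fun x₀ : X => mem_of_mem_nhds (mem_baseSet_nhds (F := FV) (V := V) x₀)
  have hLb := fun x₀ : X => mem_baseSet_nhds (F := FL) (V := L) x₀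
  have hxL := fun x₀ : X => mem_of_mem_nhds (hLb x₀)
  choose μ hμ using N.exists_complement hr
  let m : X → Fin I.rank → ∀ x, V x := fun x₀ j x => ofCoord FV V x₀ x (μ x₀ j)
  have hm : ∀ x₀ j, SecHolAt FV (m x₀ j) x₀ := fun x₀ j =>
    secHolAt_ofCoord (hxV x₀) contMDiffAt_const
  let s : X → Fin N.rank ⊕ Fin I.rank → ∀ x, V x := fun x₀ => Sum.elim (N.frame x₀) (m x₀)
  have hsE : ∀ x₀ x, (fun i => s x₀ i x) =
      Sum.elim (fun i => N.frame x₀ i x) fun j => m x₀ j x := fun x₀ x => by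
    ext i; cases i <;> rfl
  have hs : ∀ x₀ i, SecHolAt FV (s x₀ i) x₀ := fun x₀ i => by
    cases i with
    | inl i => exact (N.frame_spec x₀).self_of_nhds.1 i
    | inr j => exact hm x₀ j
  have hsi : ∀ x₀, LinearIndependent ℂ fun i => s x₀ i x₀ := fun x₀ => by
    rw [hsE]; exact hμ x₀
  have hsev : ∀ x₀, ∀ᶠ x in 𝓝 x₀, LinearIndependent ℂ
      (Sum.elim (fun i => N.frame x₀ i x) fun j => m x₀ j x) := fun x₀ => by
    filter_upwards [SecHolAt.eventually_linearIndependent (hs x₀) (hsi x₀)] with x hx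
    rwa [← hsE]
  have hcard : Fintype.card (Fin N.rank ⊕ Fin I.rank) = finrank ℂ FV := by simpa using hr
  -- In `τ x₀` all frames are those chosen at `x₀`, so it is regular near `x₀`. The diagonal `σ` is
  -- global, and invariance of `detNormSq` identifies it locally with `τ x₀`.
  let τ : X → X → ℝ := fun x₀ x => detNormSq (HV.inner x) (HW.inner x) (HL.inner x)
    (φ.contracted l x₀ x) (fun i => N.frame x₀ i x) (fun j => m x₀ j x) (ofCoord FL L x₀ x e)
  let σ : X → ℝ := fun x => τ x x
  have hTn : ∀ x₀ x, (Submodule.span ℂ (Set.range fun i => N.frame x₀ i x) = N.fiber x) →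
      ∀ i, φ.contracted l x₀ x (N.frame x₀ i x) = 0 := fun x₀ x hsp i => by
    rw [TwistedHom.contracted_apply, hN, map_zero]
    rw [← hsp]
    exact Submodule.subset_span ⟨i, rfl⟩
  have hστ : ∀ x₀, ∀ᶠ x in 𝓝 x₀, σ x = τ x₀ x := fun x₀ => by
    filter_upwards [N.frame_spec x₀, hsev x₀, hLb x₀] with x ⟨_, _, h3⟩ hx hxl
    obtain ⟨-, -, h3'⟩ := (N.frame_spec x).self_of_nhds
    obtain ⟨c, -, hc, hle⟩ := φ.contracted_eq_smul hL he hxl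
    have e1 : σ x = detNormSq (HV.inner x) (HW.inner x) (HL.inner x) (φ.contracted l x x)
        (fun i => N.frame x₀ i x) (fun j => m x₀ j x) (ofCoord FL L x x e) := by
      refine detNormSq_change_basis (fun i => ?_) (fun i => ?_) (fun j => ?_) ?_ _
      · rw [h3, ← h3']
        exact Submodule.subset_span ⟨i, rfl⟩
      · rw [TwistedHom.contracted_apply, hN, map_zero]
        rw [← h3]
        exact Submodule.subset_span ⟨i, rfl⟩
      · rw [span_eq_top_of_card (F := FV) hx hcard]
        trivial
      · exact (HV.gram_pos (hsev x).self_of_nhds).ne'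
    rw [e1]
    exact detNormSq_scale hc hle _ _
  have hσ2 : ∀ x₀, C2At σ x₀ := fun x₀ => by
    refine ContMDiffAt.congr_of_eventuallyEq ?_ (hστ x₀)
    refine C2At.mul (C2At.mul (C2At.mul ?_ (C2At.pow ?_ _)) ?_) (C2At.inv ?_ ?_)
    · exact HW.c2At_gram (s := fun j x => φ.contracted l x₀ x (m x₀ j x))
        fun j => φ.secHolAt_contracted l (hm x₀ j)
    · exact HL.c2At_gram (s := fun (_ : Fin 1) x => ofCoord FL L x₀ x e)
        fun _ => secHolAt_ofCoord (hxL x₀) contMDiffAt_const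
    · exact HV.c2At_gram (N.frame_spec x₀).self_of_nhds.1
    · simp only [← hsE]
      exact HV.c2At_gram (hs x₀)
    · exact (HV.gram_pos (hsev x₀).self_of_nhds).ne'
  have hσf : ∀ x₀, ∀ᶠ x in 𝓝[≠] x₀, σ x ≠ 0 := fun x₀ => by
    filter_upwards [nhdsWithin_le_nhds (hστ x₀), nhdsWithin_le_nhds (N.frame_spec x₀), hNK x₀,
      nhdsWithin_le_nhds (hsev x₀), nhdsWithin_le_nhds (hLb x₀)] with x hx ⟨_, h2, h3⟩ hker hi hxl
    rw [hx]
    -- A combination of the `m j` killed by `φ` lies in `N`, to which the `m j` are complementary.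
    have hTm : LinearIndependent ℂ fun j => φ.contracted l x₀ x (m x₀ j x) := by
      rw [Fintype.linearIndependent_iff]
      intro c hc
      have h4 : ∑ j, c j • m x₀ j x ∈ N.fiber x := hker (by
        rw [LinearMap.mem_ker, ← φ.contracted_eq_zero_iff hL he hxl, map_sum]
        simpa only [map_smul] using hc)
      rw [← h3] at h4
      obtain ⟨d, hd⟩ := (Submodule.mem_span_range_iff_exists_fun ℂ).1 h4
      have h5 := Fintype.linearIndependent_iff.1 hi (Sum.elim d fun j => -c j) (by
        rw [Fintype.sum_sum_type]
        simp only [Sum.elim_inl, Sum.elim_inr, neg_smul, Finset.sum_neg_distrib, hd]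
        exact add_neg_cancel _)
      exact fun j => neg_eq_zero.1 (h5 (Sum.inr j))
    have hl : LinearIndependent ℂ fun _ : Fin 1 => ofCoord FL L x₀ x e := by
      rw [linearIndependent_unique_iff]
      intro h0
      have := TwistedHom.form_ofCoord hL he hxl
      rw [h0, map_zero] at this
      exact zero_ne_one this
    exact mul_ne_zero (mul_ne_zero (mul_ne_zero (HW.gram_pos hTm).ne'
      (pow_ne_zero _ (HL.gram_pos hl).ne')) (HV.gram_pos h2).ne')
      (inv_ne_zero (HV.gram_pos hi).ne')
  have hloc : ∀ x₀, ∃ g₁ g₂ g₃ : X → ℂ, HolAt g₁ x₀ ∧ HolAt g₂ x₀ ∧ HolAt g₃ x₀ ∧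
      g₂ x₀ ≠ 0 ∧ g₃ x₀ ≠ 0 ∧ ∀ᶠ x in 𝓝 x₀, σ x =
        (‖g₁ x‖ ^ 2 * (gram (HW.inner x) fun i => I.frame x₀ i x).re) *
        (‖g₃ x‖ ^ 2 * (gram (HL.inner x) fun i =>
          (HolomorphicSubbundle.top : HolomorphicSubbundle FL L).frame x₀ i x).re) ^ I.rank *
        (gram (HV.inner x) fun i => N.frame x₀ i x).re *
        (‖g₂ x‖ ^ 2 * (gram (HV.inner x) fun i =>
          (HolomorphicSubbundle.top : HolomorphicSubbundle FV V).frame x₀ i x).re)⁻¹ := fun x₀ => by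
    have hIs := I.frame_spec x₀
    obtain ⟨g₁, hg₁, h1⟩ := SecHolAt.exists_hol_det
      (s := fun j x => φ.contracted l x₀ x (m x₀ j x)) (fun j => φ.secHolAt_contracted l (hm x₀ j))
      hIs.self_of_nhds.1 hIs.self_of_nhds.2.1 (by
        filter_upwards [hIs, hLb x₀] with x hx hxl j
        rw [hx.2.2, TwistedHom.contracted_apply, contract_mem_iff (TwistedHom.finrank_line hL x)
          (TwistedHom.form_ofCoord hL he hxl)]
        exact hI x _)
    obtain ⟨g₂, hg₂, hg₂0, h2⟩ := HolomorphicSubbundle.exists_gram_top HV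
      (finSumFinEquiv.trans (finCongr hr)) (hs x₀) (hsi x₀)
    obtain ⟨g₃, hg₃, hg₃0, h3⟩ := HolomorphicSubbundle.exists_gram_top HL (finCongr hL.symm)
      (s := fun (_ : Fin 1) x => ofCoord FL L x₀ x e)
      (fun _ => secHolAt_ofCoord (hxL x₀) contMDiffAt_const) (x₀ := x₀) (by
        rw [linearIndependent_unique_iff]
        intro h0
        have := TwistedHom.form_ofCoord hL he (hxL x₀)
        rw [h0, map_zero] at this
        exact zero_ne_one this)
    refine ⟨g₁, g₂, g₃, hg₁, hg₂, hg₃, hg₂0, hg₃0, ?_⟩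
    filter_upwards [hστ x₀, h1, h2, h3] with x hx ⟨P, hP, hPa⟩ h2 h3
    rw [hx, ← h2, ← h3, ← hPa, hsE]
    simp only [τ, detNormSq]
    rw [gram_eq_of_eq_sum (HW.inner x) hP, Complex.re_ofReal_mul]
  have hσ0 : ∀ x, 0 ≤ σ x := fun x => by
    obtain ⟨g₁, g₂, g₃, -, -, -, -, -, h⟩ := hloc x
    rw [h.self_of_nhds]
    have p1 := HW.gram_pos (I.frame_spec x).self_of_nhds.2.1
    have p2 := HL.gram_pos (HolomorphicSubbundle.top_frame_spec (F := FL) (V := L) x).self_of_nhds.2.1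
    have p3 := HV.gram_pos (N.frame_spec x).self_of_nhds.2.1
    have p4 := HV.gram_pos (HolomorphicSubbundle.top_frame_spec (F := FV) (V := V) x).self_of_nhds.2.1
    positivity
  refine chernIntegral_le_of_local N I HV HW HL (Classical.arbitrary _) .top .top I.rank hσ0 hσ2 hσf
    fun x₀ h0 => ?_
  obtain ⟨g₁, g₂, g₃, hg₁, hg₂, hg₃, hg₂0, hg₃0, h⟩ := hloc x₀
  -- Of the three functions only `g₁`, the determinant of `φ` in the chosen frames, can vanish at
  -- `x₀`; `g₂` and `g₃` come from changes of frame.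
  have hg₁0 : g₁ x₀ ≠ 0 := fun h1 => h0 (by rw [h.self_of_nhds, h1]; simp)
  refine ⟨fun x => g₁ x * (g₃ x ^ I.rank * (g₂ x)⁻¹), hg₁.mul (HolAt.mul ?_ (hg₂.inv hg₂0)),
    mul_ne_zero hg₁0 (mul_ne_zero (pow_ne_zero _ hg₃0) (inv_ne_zero hg₂0)), ?_⟩
  · exact hg₃.comp_contDiff (g := fun t : ℂ => t ^ I.rank) (contDiff_id.pow _).contDiffAt
  filter_upwards [h, I.frame_spec x₀, N.frame_spec x₀,
    HolomorphicSubbundle.top_frame_spec (F := FL) (V := L) x₀,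
    HolomorphicSubbundle.top_frame_spec (F := FV) (V := V) x₀,
    hg₁.continuousAt.eventually_ne hg₁0, hg₂.continuousAt.eventually_ne hg₂0,
    hg₃.continuousAt.eventually_ne hg₃0] with x hx hI hN hLx hVx n1 n2 n3
  have p1 := (HW.gram_pos hI.2.1).ne'
  have p2 := (HL.gram_pos hLx.2.1).ne'
  have p3 := (HV.gram_pos hN.2.1).ne'
  have p4 := (HV.gram_pos hVx.2.1).ne'
  have q1 := norm_ne_zero_iff.2 n1
  have q2 := norm_ne_zero_iff.2 n2
  have q3 := norm_ne_zero_iff.2 n3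
  simp only [HolomorphicSubbundle.logGram_eq]
  rw [hx, Real.log_mul (by positivity) (by positivity), Real.log_mul (by positivity) p3,
    Real.log_mul (by positivity) (by positivity), Real.log_mul (by positivity) p1, Real.log_inv,
    Real.log_pow, Real.log_pow, Real.log_mul (by positivity) p2, Real.log_mul (by positivity) p4,
    Real.log_pow, Real.log_pow, norm_mul, norm_mul, norm_pow, norm_inv,
    Real.log_mul q1 (by positivity), Real.log_mul (by positivity) (by positivity), Real.log_pow,
    Real.log_inv]
  push_cast
  ring

end DegreeInequality

/-! ### The zero subbundle and the whole bundle -/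

section Subbundle

variable {X : Type*} [TopologicalSpace X] [ChartedSpace ℂ X]
variable {F : Type*} [NormedAddCommGroup F] [NormedSpace ℂ F]
variable {V : X → Type*} [TopologicalSpace (TotalSpace F V)]
  [∀ x, AddCommGroup (V x)] [∀ x, Module ℂ (V x)] [∀ x, TopologicalSpace (V x)]
  [FiberBundle F V] [VectorBundle ℂ F V]

namespace HolomorphicSubbundle

/-- The zero subbundle. -/
def bot : HolomorphicSubbundle F V where
  rank := 0
  fiber _ := ⊥
  exists_frame x₀ := ⟨fun i => i.elim0, Set.univ, isOpen_univ, Set.mem_univ _, fun i => i.elim0,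
    fun x _ => ⟨linearIndependent_empty_type, by simp⟩⟩

theorem chernIntegral_eq_zero {S : HolomorphicSubbundle F V} (hS : S.rank = 0)
    (H : HermitianMetric F V) (ρ : ChartPartition X) : S.chernIntegral H ρ = 0 := by
  have hemp : IsEmpty (Fin S.rank) := by rw [hS]; infer_instance
  have h : ∀ x₀ x, S.logGram H x₀ x = 0 := fun x₀ x => by
    simp [logGram, Matrix.det_isEmpty]
  have hl : ∀ z : ℂ, Laplacian.laplacian (fun _ : ℂ => (0 : ℝ)) z = 0 := fun z => by
    simp
  simp [chernIntegral, chernDensity, h, hl]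

variable [FiniteDimensional ℂ F] [IsManifold 𝓘(ℂ) ω X] [CompactSpace X] [T2Space X]
  [ContMDiffVectorBundle ω F V 𝓘(ℂ)]

theorem degree_eq_zero {S : HolomorphicSubbundle F V} (hS : S.rank = 0) : S.degree = 0 :=
  chernIntegral_eq_zero hS _ _

theorem rank_le [Nonempty X] (S : HolomorphicSubbundle F V) : S.rank ≤ finrank ℂ F := by
  have x : X := Classical.arbitrary X
  have := finiteDimensional_fiber (F := F) (V := V) x
  rw [← S.finrank_fiber x, ← UpqHiggs.finrank_fiber (F := F) (V := V) x]
  exact Submodule.finrank_le _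

/-- Equality as structures holds because the frames are only asserted to exist; the degrees, which
use chosen frames, then agree at once. -/
theorem eq_top [Nonempty X] {S : HolomorphicSubbundle F V} (hS : ∀ x, S.fiber x = ⊤) :
    S = top := by
  have x : X := Classical.arbitrary X
  have hr : S.rank = finrank ℂ F := by
    rw [← S.finrank_fiber x, hS, finrank_top, UpqHiggs.finrank_fiber (F := F)]
  obtain ⟨r, f, hf⟩ := S
  obtain rfl : r = finrank ℂ F := hr
  obtain rfl : f = fun _ => ⊤ := funext hS
  rfl

end HolomorphicSubbundle

end Subbundle

/-! ### From semistability to the Milnor–Wood inequality -/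

section Higgs

variable {X : Type*} [TopologicalSpace X] [ChartedSpace ℂ X] [IsManifold 𝓘(ℂ) ω X]
  [CompactSpace X] [T2Space X]
variable {FV : Type*} [NormedAddCommGroup FV] [NormedSpace ℂ FV] [FiniteDimensional ℂ FV]
  {V : X → Type*} [TopologicalSpace (TotalSpace FV V)]
  [∀ x, AddCommGroup (V x)] [∀ x, Module ℂ (V x)] [∀ x, TopologicalSpace (V x)]
  [FiberBundle FV V] [VectorBundle ℂ FV V] [ContMDiffVectorBundle ω FV V 𝓘(ℂ)]
  {FW : Type*} [NormedAddCommGroup FW] [NormedSpace ℂ FW] [FiniteDimensional ℂ FW]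
  {W : X → Type*} [TopologicalSpace (TotalSpace FW W)]
  [∀ x, AddCommGroup (W x)] [∀ x, Module ℂ (W x)] [∀ x, TopologicalSpace (W x)]
  [FiberBundle FW W] [VectorBundle ℂ FW W] [ContMDiffVectorBundle ω FW W 𝓘(ℂ)]
  {FL : Type*} [NormedAddCommGroup FL] [NormedSpace ℂ FL] [FiniteDimensional ℂ FL]
  {L : X → Type*} [TopologicalSpace (TotalSpace FL L)]
  [∀ x, AddCommGroup (L x)] [∀ x, Module ℂ (L x)] [∀ x, TopologicalSpace (L x)]
  [FiberBundle FL L] [VectorBundle ℂ FL L] [ContMDiffVectorBundle ω FL L 𝓘(ℂ)]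

theorem exists_linear_form_eq_one (hL : finrank ℂ FL = 1) : ∃ (e : FL) (l : FL →ₗ[ℂ] ℂ), l e = 1 := by
  have := nontrivial_of_finrank_eq_succ hL
  obtain ⟨e, he⟩ := exists_ne (0 : FL)
  obtain ⟨l, hl⟩ := SeparatingDual.exists_eq_one (R := ℂ) he
  exact ⟨e, l, hl⟩

theorem mem_range_rTensor_top {E G : Type*} [AddCommGroup E] [Module ℂ E] [AddCommGroup G]
    [Module ℂ G] (t : E ⊗[ℂ] G) : t ∈ LinearMap.range ((⊤ : Submodule ℂ E).subtype.rTensor G) := by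
  rw [LinearMap.range_eq_top.2 (LinearMap.rTensor_surjective G fun v => ⟨⟨v, trivial⟩, rfl⟩)]
  trivial

theorem degree_eq_zero (h : finrank ℂ FV = 0) : degree FV V = 0 :=
  HolomorphicSubbundle.degree_eq_zero h

namespace HiggsBundle

variable {E : HiggsBundle FV V FW W FL L} {α : ℝ}

/-- Semistability without denominators; it then holds for the trivial subobjects too. -/
theorem IsSemistable.degree_add_le [Nonempty X] (hE : E.IsSemistable α) (S : E.Subobject) :
    S.V'.degree + S.W'.degree + α * S.V'.rank ≤ (S.V'.rank + S.W'.rank) * E.slope α := by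
  rcases Nat.eq_zero_or_pos (S.V'.rank + S.W'.rank) with h0 | hpos
  · obtain ⟨hV, hW⟩ := Nat.add_eq_zero_iff.1 h0
    simp [HolomorphicSubbundle.degree_eq_zero, hV, hW]
  have hpos' : (0 : ℝ) < S.V'.rank + S.W'.rank := by exact_mod_cast hpos
  have hslope : S.V'.degree + S.W'.degree + α * S.V'.rank =
      (S.V'.rank + S.W'.rank) * S.slope α := by
    rw [Subobject.slope]
    field_simp
  rw [hslope]
  refine mul_le_mul_of_nonneg_left ?_ hpos'.le
  by_cases hS : S.IsTrivial
  · rcases hS with h | h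
    · have x : X := Classical.arbitrary X
      rw [← S.V'.finrank_fiber x, ← S.W'.finrank_fiber x, (h x).1, (h x).2] at hpos
      simp at hpos
    · have hV := HolomorphicSubbundle.eq_top fun x => (h x).1
      have hW := HolomorphicSubbundle.eq_top fun x => (h x).2
      rw [Subobject.slope, hV, hW]
      exact le_rfl
  · exact hE S hS

theorem toledo_eq (E : HiggsBundle FV V FW W FL L) :
    E.toledo = 2 * (finrank ℂ FW * degree FV V - finrank ℂ FV * degree FW W) /
      (finrank ℂ FV + finrank ℂ FW) := by
  rw [toledo]
  -- For rank zero the slope is a division by zero, but the degree vanishes as well and both sides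
  -- are `0`.
  rcases Nat.eq_zero_or_pos (finrank ℂ FV) with hV | hV
  · simp [hV, degree_eq_zero hV]
  rcases Nat.eq_zero_or_pos (finrank ℂ FW) with hW | hW
  · simp [hW, degree_eq_zero hW]
  field_simp

/-- The test subobjects are `(N, 0)` and `(V, I)`. Their ranks add up to `2p`, so `r` disappears
from the coefficient of the slope. -/
theorem toledo_le [ConnectedSpace X] (hL : finrank ℂ FL = 1) (hE : E.IsSemistable α) :
    E.toledo ≤ E.γ.rank * degree FL L + α * (E.γ.rank -
      2 * finrank ℂ FV * finrank ℂ FW / (finrank ℂ FV + finrank ℂ FW)) := by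
  obtain ⟨e, l, he⟩ := exists_linear_form_eq_one hL
  obtain ⟨N, I, hr, hI, hN, hIm, hK⟩ := E.γ.exists_kernel_image hL he
  have hdeg := E.γ.degree_le hL he N I hr hN hIm hK
  have h1 := hE.degree_add_le ⟨N, .bot, fun x w hw => by
    rw [(Submodule.mem_bot ℂ).1 hw, map_zero]; exact zero_mem _, fun x v hv => by
    rw [hN x v hv]; exact zero_mem _⟩
  have h2 := hE.degree_add_le ⟨.top, I, fun x w _ => mem_range_rTensor_top _,
    fun x v _ => hIm x v⟩
  have hI' : I.rank ≤ finrank ℂ FW := I.rank_le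
  rw [toledo_eq, ← hI]
  rcases Nat.eq_zero_or_pos (finrank ℂ FV + finrank ℂ FW) with h0 | hpos
  · obtain ⟨hV, hW⟩ := Nat.add_eq_zero_iff.1 h0
    have : I.rank = 0 := by omega
    simp [hV, hW, this]
  have hpos' : (0 : ℝ) < finrank ℂ FV + finrank ℂ FW := by exact_mod_cast hpos
  have hr' : (N.rank : ℝ) = finrank ℂ FV - I.rank := by rw [← hr]; push_cast; ring
  have hb : (HolomorphicSubbundle.bot : HolomorphicSubbundle FW W).degree = 0 :=
    HolomorphicSubbundle.degree_eq_zero rfl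
  simp only [hb, show (HolomorphicSubbundle.bot : HolomorphicSubbundle FW W).rank = 0 from rfl,
    Nat.cast_zero, hr'] at h1
  change degree FV V + I.degree + α * finrank ℂ FV ≤ (finrank ℂ FV + I.rank) * E.slope α at h2
  have e1 : 2 * (finrank ℂ FW * degree FV V - finrank ℂ FV * degree FW W) /
      ((finrank ℂ FV : ℝ) + finrank ℂ FW) = 2 * degree FV V - 2 * finrank ℂ FV *
        (E.slope α - α * (finrank ℂ FV / (finrank ℂ FV + finrank ℂ FW))) := by
    rw [slope]
    field_simp
    ring
  -- The identity `p²/(p+q) = p - pq/(p+q)` converts the `α`-terms `-(2p - r) + 2p²/(p+q)` into `r -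
  -- 2pq/(p+q)`.
  have e2 : (finrank ℂ FV : ℝ) * (finrank ℂ FV / (finrank ℂ FV + finrank ℂ FW)) =
      finrank ℂ FV - finrank ℂ FV * finrank ℂ FW / (finrank ℂ FV + finrank ℂ FW) := by
    field_simp
    ring
  rw [e1]
  linear_combination hdeg + h1 + h2 + 2 * α * e2

/-- The test subobjects are now `(0, N)` and `(I, W)`, with ranks adding up to `2q`. Since `α`
weights only the part in `V`, their `α`-terms sum to `α r` directly. -/
theorem le_toledo [ConnectedSpace X] (hL : finrank ℂ FL = 1) (hE : E.IsSemistable α) :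
    -E.β.rank * degree FL L + α * (E.β.rank -
      2 * finrank ℂ FV * finrank ℂ FW / (finrank ℂ FV + finrank ℂ FW)) ≤ E.toledo := by
  obtain ⟨e, l, he⟩ := exists_linear_form_eq_one hL
  obtain ⟨N, I, hr, hI, hN, hIm, hK⟩ := E.β.exists_kernel_image hL he
  have hdeg := E.β.degree_le hL he N I hr hN hIm hK
  have h1 := hE.degree_add_le ⟨.bot, N, fun x w hw => by
    rw [hN x w hw]; exact zero_mem _, fun x v hv => by
    rw [(Submodule.mem_bot ℂ).1 hv, map_zero]; exact zero_mem _⟩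
  have h2 := hE.degree_add_le ⟨I, .top, fun x w _ => hIm x w,
    fun x v _ => mem_range_rTensor_top _⟩
  have hI' : I.rank ≤ finrank ℂ FV := I.rank_le
  rw [toledo_eq, ← hI]
  rcases Nat.eq_zero_or_pos (finrank ℂ FV + finrank ℂ FW) with h0 | hpos
  · obtain ⟨hV, hW⟩ := Nat.add_eq_zero_iff.1 h0
    have : I.rank = 0 := by omega
    simp [hV, hW, this]
  have hpos' : (0 : ℝ) < finrank ℂ FV + finrank ℂ FW := by exact_mod_cast hpos
  have hr' : (N.rank : ℝ) = finrank ℂ FW - I.rank := by rw [← hr]; push_cast; ring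
  have hb : (HolomorphicSubbundle.bot : HolomorphicSubbundle FV V).degree = 0 :=
    HolomorphicSubbundle.degree_eq_zero rfl
  simp only [hb, show (HolomorphicSubbundle.bot : HolomorphicSubbundle FV V).rank = 0 from rfl,
    Nat.cast_zero, hr'] at h1
  change I.degree + degree FW W + α * I.rank ≤ (I.rank + finrank ℂ FW) * E.slope α at h2
  have e1 : 2 * (finrank ℂ FW * degree FV V - finrank ℂ FV * degree FW W) /
      ((finrank ℂ FV : ℝ) + finrank ℂ FW) = 2 * finrank ℂ FW *
        (E.slope α - α * (finrank ℂ FV / (finrank ℂ FV + finrank ℂ FW))) - 2 * degree FW W := by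
    rw [slope]
    field_simp
    ring
  rw [e1]
  linear_combination hdeg + h1 + h2

end HiggsBundle

end Higgs

end UpqHiggs

end

theorem proposition3p3
    {X : Type*} [TopologicalSpace X] [ChartedSpace ℂ X] [IsManifold 𝓘(ℂ) ω X]
    [CompactSpace X] [T2Space X] [ConnectedSpace X]
    {FV : Type*} [NormedAddCommGroup FV] [NormedSpace ℂ FV] [FiniteDimensional ℂ FV]
    {V : X → Type*} [TopologicalSpace (TotalSpace FV V)]
    [∀ x, AddCommGroup (V x)] [∀ x, Module ℂ (V x)] [∀ x, TopologicalSpace (V x)]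
    [FiberBundle FV V] [VectorBundle ℂ FV V] [ContMDiffVectorBundle ω FV V 𝓘(ℂ)]
    {FW : Type*} [NormedAddCommGroup FW] [NormedSpace ℂ FW] [FiniteDimensional ℂ FW]
    {W : X → Type*} [TopologicalSpace (TotalSpace FW W)]
    [∀ x, AddCommGroup (W x)] [∀ x, Module ℂ (W x)] [∀ x, TopologicalSpace (W x)]
    [FiberBundle FW W] [VectorBundle ℂ FW W] [ContMDiffVectorBundle ω FW W 𝓘(ℂ)]
    {FL : Type*} [NormedAddCommGroup FL] [NormedSpace ℂ FL] [FiniteDimensional ℂ FL]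
    {L : X → Type*} [TopologicalSpace (TotalSpace FL L)]
    [∀ x, AddCommGroup (L x)] [∀ x, Module ℂ (L x)] [∀ x, TopologicalSpace (L x)]
    [FiberBundle FL L] [VectorBundle ℂ FL L] [ContMDiffVectorBundle ω FL L 𝓘(ℂ)]
    (p q : ℕ) (hp : finrank ℂ FV = p) (hq : finrank ℂ FW = q) (hL : finrank ℂ FL = 1)
    (E : UpqHiggs.HiggsBundle FV V FW W FL L) (α : ℝ) (hE : E.IsSemistable α) :
    -(E.β.rank : ℝ) * UpqHiggs.degree FL L + α * (E.β.rank - 2 * p * q / (p + q)) ≤ E.toledo ∧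
      E.toledo ≤
        (E.γ.rank : ℝ) * UpqHiggs.degree FL L + α * (E.γ.rank - 2 * p * q / (p + q)) := by
  subst hp hq
  exact ⟨UpqHiggs.HiggsBundle.le_toledo hL hE, UpqHiggs.HiggsBundle.toledo_le hL hE⟩
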